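/- **Lemma 2.1 (basic properties of the linearization).** Let $0<a<b$ and $c>1$, put $A=I-a\partial_x^2$, $B=I-b\partial_x^2$ and $$\alpha_c=\sqrt{\frac{c^2-1}{bc^2-a}},\qquad q_c(x)=\frac{c^2-1}{c}\,\operatorname{sech}^2\!\left(\tfrac12\alpha_c x\right),\qquad r_c=-c\,q_c .$$ Fix $\alpha$ with $0<\alpha<\alpha_c$. Let $L^2_\alpha=\{g : e^{\alpha x}g\in L^2(\mathbb R)\}$, with norm $\|g\|_{L^2_\alpha}=\|e^{\alpha x}g\|_{L^2}$, and $H^1_\alpha=\{g : e^{\alpha x}g\in H^1(\mathbb R)\}$; below, these are spaces of $\mathbb C^2$-valued functions $z=(q,r)$. Consider in $L^2_\alpha$ the operators $$\mathcal L_c=\begin{pmatrix} c\,\partial_x & \partial_x\\ -B^{-1}(-A\partial_x+r_c\partial_x+2r_c') & c\,\partial_x-B^{-1}(2q_c\partial_x+q_c')\end{pmatrix},\qquad L+c\,\partial_x=\begin{pmatrix} c\,\partial_x & \partial_x\\ B^{-1}A\partial_x & c\,\partial_x\end{pmatrix},$$ both with domain $H^1_\alpha$; here $w=\mathcal L_c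 z$ means that $w=(w_1,w_2)\in L^2_\alpha$, $w_1=c\,\partial_xq+\partial_xr$ and $B(w_2-c\,\partial_x r)=A\partial_xq-r_c\partial_xq-2r_c'q-2q_c\partial_xr-q_c'r$ in the sense of distributions, and similarly for $L+c\,\partial_x$ (with $q_c,r_c$ replaced by $0$). These relations define single-valued operators with domain exactly $H^1_\alpha$, and the following hold. (i) $\mathcal L_c$ is a compact perturbation of $L+c\,\partial_x$: there is a compact operator $K$ on $L^2_\alpha$ with $\mathcal L_c=L+c\,\partial_x+K$. (ii) $\mathcal L_c$ is the generator of a $C^0$ semigroup in $L^2_\alpha$. (iii) The essential spectrum of $\mathcal L_c$ is contained strictly in the left half-plane: there is $\delta>0$ such that $\operatorname{Re}\lambda\le-\delta$ for every $\lambda$ in it. Here $\lambda$ belongs to the essential spectrum (in the sense of Browder) if the range of $\lambda-\mathcal L_c$ is not closed, or $\lambda$ is a limit point of the spectrum of $\mathcal L_c$, or $\bigcup_n\ker(\lambda-\mathcal L_c)^n$ is infinite dimensional; so every other point is in the resolvent set or is an isolated eigenvalue of finite algebraic multiplicity. (iv) The value $\lambda=0$ is an eigenvalue of $\mathcal L_c$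 of algebraic multiplicity $2$. Specifically, $$z_{1,c}=\begin{pmatrix}\partial_xq_c\\ \partial_xr_c\end{pmatrix},\qquad z_{2,c}=-\begin{pmatrix}\partial_cq_c\\ \partial_cr_c\end{pmatrix}$$ lie in $H^1_\alpha$, $z_{1,c}\neq0$, they satisfy $\mathcal L_cz_{1,c}=0$ and $\mathcal L_cz_{2,c}=z_{1,c}$, and the generalized eigenspace $\bigcup_n\ker\mathcal L_c^{\,n}$ is two-dimensional and equal to $\operatorname{span}\{z_{1,c},z_{2,c}\}$. -/

import Mathlib

open MeasureTheory Filter Topology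
open scoped ContDiff ENNReal

noncomputable section

namespace BenneyLuke

/-! ### Unbounded operators: spectrum, multiplicity, semigroups -/

section Abstract

variable {E : Type*} [NormedAddCommGroup E] [NormedSpace ℂ E]

/-- The map `lam - T : D(T) → E` attached to an unbounded operator `T` with domain `D(T) ⊆ E`. -/
def shifted (T : E →ₗ.[ℂ] E) (lam : ℂ) : T.domain →ₗ[ℂ] E :=
  lam • T.domain.subtype - T.toFun

/-- `lam` is in the resolvent set of `T`: the map `lam - T : D(T) → E` has a bounded two-sided
inverse `R : E → D(T)`. -/
def InResolventSet (T : E →ₗ.[ℂ] E) (lam : ℂ) : Prop :=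
  ∃ R : E →L[ℂ] E, (∀ z : T.domain, R (shifted T lam z) = z) ∧
    ∀ w : E, ∃ h : R w ∈ T.domain, shifted T lam ⟨R w, h⟩ = w

/-- The spectrum of an unbounded operator. -/
def opSpectrum (T : E →ₗ.[ℂ] E) : Set ℂ := {lam | ¬ InResolventSet T lam}

/-- `kerPow T lam n` is the kernel of `(lam - T) ^ n`, on its natural domain: `z` belongs to the
kernel of `(lam - T) ^ (n + 1)` when `z ∈ D(T)` and `(lam - T) z` is in the kernel of
`(lam - T) ^ n`. -/
def kerPow (T : E →ₗ.[ℂ] E) (lam : ℂ) : ℕ → Submodule ℂ E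
  | 0 => ⊥
  | n + 1 => ((kerPow T lam n).comap (shifted T lam)).map T.domain.subtype

/-- The generalized eigenspace `⋃ₙ ker (lam - T) ^ n`; its dimension is the algebraic
multiplicity of `lam`. -/
def genEigenspace (T : E →ₗ.[ℂ] E) (lam : ℂ) : Submodule ℂ E := ⨆ n, kerPow T lam n

/-- The (Browder) essential spectrum: `lam` is in it when the range of `lam - T` is not closed, or
`lam` is a limit point of the spectrum, or the generalized eigenspace of `lam` is infinite
dimensional. For closed densely defined `T`, a point outside of it is either in the resolvent set
or an isolated eigenvalue of finite algebraic multiplicity. -/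
def essSpectrum (T : E →ₗ.[ℂ] E) : Set ℂ :=
  {lam | ¬ IsClosed (Set.range (shifted T lam)) ∨ AccPt lam (𝓟 (opSpectrum T)) ∨
    ¬ FiniteDimensional ℂ (genEigenspace T lam)}

/-- `S` is a `C⁰` semigroup of bounded operators (only the values `S t` with `t ≥ 0` matter). -/
structure IsC0Semigroup (S : ℝ → E →L[ℂ] E) : Prop where
  zero : S 0 = ContinuousLinearMap.id ℂ E
  add : ∀ s t : ℝ, 0 ≤ s → 0 ≤ t → S (s + t) = (S s).comp (S t)
  continuous : ∀ z : E, ContinuousOn (fun t => S t z) (Set.Ici 0)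

/-- `T` is the infinitesimal generator of `S`: one has `z ∈ D(T)` and `T z = w` exactly when
`(S t z - z) / t → w` as `t → 0⁺`. -/
def IsGenerator (T : E →ₗ.[ℂ] E) (S : ℝ → E →L[ℂ] E) : Prop :=
  ∀ z w : E, (z, w) ∈ T.graph ↔
    Tendsto (fun t : ℝ => ((t : ℂ)⁻¹) • (S t z - z)) (𝓝[>] 0) (𝓝 w)

end Abstract

/-! ### Weak derivatives and weighted spaces -/

/-- Test functions on the line. -/
def IsTest (φ : ℝ → ℝ) : Prop := ContDiff ℝ ∞ φ ∧ HasCompactSupport φ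

/-- `g` is the weak derivative of `f` on the line. -/
def HasWeakDeriv (f g : ℝ → ℂ) : Prop :=
  LocallyIntegrable f ∧ LocallyIntegrable g ∧
    ∀ φ, IsTest φ → ∫ x, deriv φ x • f x = -∫ x, φ x • g x

/-- The Sobolev space `H¹(ℝ)`. -/
def MemH1 (f : ℝ → ℂ) : Prop :=
  MemLp f 2 ∧ ∃ g : ℝ → ℂ, MemLp g 2 ∧ HasWeakDeriv f g

/-- The weighted Sobolev space `H¹_α = {g | e^{αx} g ∈ H¹(ℝ)}`. -/
def MemH1w (α : ℝ) (g : ℝ → ℂ) : Prop := MemH1 fun x => Real.exp (α * x) • g x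

/-- The measure `|e^{αx}|² dx`. -/
def weight (α : ℝ) : Measure ℝ :=
  volume.withDensity fun x => ENNReal.ofReal (Real.exp (α * x) ^ 2)

/-- The scalar space `L²_α`, with norm `(∫ |e^{αx} g(x)|² dx)^{1/2}`. -/
abbrev L2w (α : ℝ) : Type := Lp ℂ 2 (weight α)

/-- The space `L²_α` of pairs `z = (z.fst, z.snd)`, with its Hilbert norm. -/
abbrev State (α : ℝ) : Type := WithLp 2 (L2w α × L2w α)

/-- The distributional pairing `∫ ψ f dx` (unweighted). -/
def pair {α : ℝ} (ψ : ℝ → ℝ) (f : L2w α) : ℂ := ∫ x, ψ x • f x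

lemma measurable_density (α : ℝ) :
    Measurable fun x : ℝ => ENNReal.ofReal (Real.exp (α * x) ^ 2) :=
  ENNReal.measurable_ofReal.comp (Continuous.measurable (by fun_prop))

lemma ac_weight (α : ℝ) : (volume : Measure ℝ) ≪ weight α := by
  refine withDensity_absolutelyContinuous' ?_ ?_
  · exact (measurable_density α).aemeasurable
  · refine Eventually.of_forall fun x => ?_
    simp only [ne_eq, ENNReal.ofReal_eq_zero, not_le]
    positivity

lemma locInt {α : ℝ} (f : L2w α) : LocallyIntegrable f (volume : Measure ℝ) := by
  have : IsLocallyFiniteMeasure (weight α) :=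
    IsLocallyFiniteMeasure.withDensity_ofReal (by fun_prop)
  have h : LocallyIntegrable f (weight α) :=
    (Lp.memLp f).locallyIntegrable (by norm_num)
  generalize (f : ℝ → ℂ) = F at h ⊢
  rw [locallyIntegrable_iff] at h ⊢
  intro K hK
  have h1 := h K hK
  rw [IntegrableOn, weight, restrict_withDensity hK.measurableSet,
    integrable_withDensity_iff_integrable_smul' (measurable_density α)
      (Eventually.of_forall fun x => ENNReal.ofReal_lt_top)] at h1
  have h2 := IntegrableOn.continuousOn_smul (f := fun x : ℝ => (Real.exp (α * x) ^ 2)⁻¹) h1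
    (Continuous.continuousOn (by fun_prop (disch := intro x; positivity))) hK
  refine h2.congr (Eventually.of_forall fun x => ?_)
  have hp : 0 < Real.exp (α * x) ^ 2 := by positivity
  simp only [ENNReal.toReal_ofReal hp.le, smul_smul]
  rw [inv_mul_cancel₀ hp.ne', one_smul]

lemma pair_integrable {α : ℝ} {ψ : ℝ → ℝ} (hψ : Continuous ψ) (hs : HasCompactSupport ψ)
    (f : L2w α) : Integrable fun x => ψ x • f x :=
  (locInt f).integrable_smul_left_of_hasCompactSupport hψ hs

lemma pair_add {α : ℝ} {ψ : ℝ → ℝ} (hψ : Continuous ψ) (hs : HasCompactSupport ψ)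
    (f g : L2w α) : pair ψ (f + g) = pair ψ f + pair ψ g := by
  unfold pair
  rw [← integral_add (pair_integrable hψ hs f) (pair_integrable hψ hs g)]
  refine integral_congr_ae ?_
  filter_upwards [(ac_weight α).ae_le (Lp.coeFn_add f g)] with x hx
  rw [hx, Pi.add_apply, smul_add]

lemma pair_smul {α : ℝ} (ψ : ℝ → ℝ) (k : ℂ) (f : L2w α) :
    pair ψ (k • f) = k * pair ψ f := by
  unfold pair
  rw [← integral_const_mul]
  refine integral_congr_ae ?_
  filter_upwards [(ac_weight α).ae_le (Lp.coeFn_smul k f)] with x hx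
  rw [hx, Pi.smul_apply, smul_eq_mul, Complex.real_smul, Complex.real_smul]
  ring

lemma IsTest.continuous {φ : ℝ → ℝ} (h : IsTest φ) : Continuous φ := h.1.continuous

lemma IsTest.deriv {φ : ℝ → ℝ} (h : IsTest φ) : IsTest (deriv φ) :=
  ⟨(contDiff_infty_iff_deriv.1 h.1).2, h.2.deriv⟩

/-- A weak derivative within the space `L²_α`. -/
lemma hasWeakDeriv_iff {α : ℝ} (f g : L2w α) :
    HasWeakDeriv f g ↔ ∀ φ, IsTest φ → pair (deriv φ) f = -pair φ g :=
  ⟨fun h => h.2.2, fun h => ⟨locInt f, locInt g, h⟩⟩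

/-! ### The linearized operator -/

/-- The relation `w = 𝓛 z`, where `𝓛` is the linearization, in a frame of speed `c`, of the
Benney-Luke system about the profile `(Q, R)`:
`𝓛 = [[c∂, ∂], [-B⁻¹(-A∂ + R∂ + 2R'), c∂ - B⁻¹(2Q∂ + Q')]]`, `A = 1 - a∂²`, `B = 1 - b∂²`.
With `z = (q, r)`, where `q` and `r` have weak derivatives `dq` and `dr` in `L²_α`, this means
`w.fst = c dq + dr` and, in the sense of distributions,
`B (w.snd - c dr) = A dq - R dq - 2R' q - 2Q dr - Q' r`. -/
def LinRel (a b c : ℝ) (Q R : ℝ → ℝ) {α : ℝ} (z w : State α) : Prop :=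
  ∃ dq dr : L2w α, HasWeakDeriv z.fst dq ∧ HasWeakDeriv z.snd dr ∧
    w.fst = (c : ℂ) • dq + dr ∧
    ∀ φ, IsTest φ →
      pair (fun x => φ x - b * deriv (deriv φ) x) (w.snd + (-c : ℂ) • dr) =
        pair (fun x => φ x - a * deriv (deriv φ) x) dq
        - pair (fun x => R x * φ x) dq - pair (fun x => 2 * deriv R x * φ x) z.fst
        - pair (fun x => 2 * Q x * φ x) dr - pair (fun x => deriv Q x * φ x) z.snd

lemma LinRel.add {a b c : ℝ} {Q R : ℝ → ℝ} (hQ : ContDiff ℝ 1 Q) (hR : ContDiff ℝ 1 R) {α : ℝ}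
    {z w z' w' : State α} (h : LinRel a b c Q R z w) (h' : LinRel a b c Q R z' w') :
    LinRel a b c Q R (z + z') (w + w') := by
  obtain ⟨p, s, h1, h2, h3, h4⟩ := h
  obtain ⟨p', s', h1', h2', h3', h4'⟩ := h'
  rw [hasWeakDeriv_iff] at h1 h2 h1' h2'
  have hQ' : Continuous (deriv Q) := hQ.continuous_deriv le_rfl
  have hR' : Continuous (deriv R) := hR.continuous_deriv le_rfl
  have hQ0 := hQ.continuous
  have hR0 := hR.continuous
  refine ⟨p + p', s + s', (hasWeakDeriv_iff _ _).2 fun φ hφ => ?_,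
    (hasWeakDeriv_iff _ _).2 fun φ hφ => ?_, ?_, fun φ hφ => ?_⟩
  · rw [WithLp.add_fst, pair_add hφ.deriv.continuous hφ.deriv.2, pair_add hφ.continuous hφ.2,
      h1 φ hφ, h1' φ hφ]
    ring
  · rw [WithLp.add_snd, pair_add hφ.deriv.continuous hφ.deriv.2, pair_add hφ.continuous hφ.2,
      h2 φ hφ, h2' φ hφ]
    ring
  · rw [WithLp.add_fst, h3, h3', smul_add]
    abel
  · have c0 := hφ.continuous
    have c2 := hφ.deriv.deriv.continuous
    have s2 := hφ.deriv.deriv.2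
    have hs (k : ℝ) : HasCompactSupport fun x => φ x - k * deriv (deriv φ) x :=
      hφ.2.sub (s2.mul_left (f := fun _ => k))
    have e : (w + w').snd + (-c : ℂ) • (s + s') =
        (w.snd + (-c : ℂ) • s) + (w'.snd + (-c : ℂ) • s') := by
      rw [WithLp.add_snd, smul_add]; abel
    rw [e, WithLp.add_fst, WithLp.add_snd,
      pair_add (by fun_prop) (hs b), pair_add (by fun_prop) (hs a),
      pair_add (ψ := fun x => R x * φ x) (by fun_prop) (hφ.2.mul_left (f := R)),
      pair_add (ψ := fun x => 2 * deriv R x * φ x) (by fun_prop)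
        (hφ.2.mul_left (f := fun x => 2 * deriv R x)),
      pair_add (ψ := fun x => 2 * Q x * φ x) (by fun_prop) (hφ.2.mul_left (f := fun x => 2 * Q x)),
      pair_add (ψ := fun x => deriv Q x * φ x) (by fun_prop) (hφ.2.mul_left (f := deriv Q)),
      h4 φ hφ, h4' φ hφ]
    ring

lemma LinRel.smul {a b c : ℝ} {Q R : ℝ → ℝ} {α : ℝ} {z w : State α} (k : ℂ)
    (h : LinRel a b c Q R z w) : LinRel a b c Q R (k • z) (k • w) := by
  obtain ⟨p, s, h1, h2, h3, h4⟩ := h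
  rw [hasWeakDeriv_iff] at h1 h2
  refine ⟨k • p, k • s, (hasWeakDeriv_iff _ _).2 fun φ hφ => ?_,
    (hasWeakDeriv_iff _ _).2 fun φ hφ => ?_, ?_, fun φ hφ => ?_⟩
  · rw [WithLp.smul_fst, pair_smul, pair_smul, h1 φ hφ, mul_neg]
  · rw [WithLp.smul_snd, pair_smul, pair_smul, h2 φ hφ, mul_neg]
  · rw [WithLp.smul_fst, h3, smul_add, smul_comm]
  · have e : (k • w).snd + (-c : ℂ) • (k • s) = k • (w.snd + (-c : ℂ) • s) := by
      rw [WithLp.smul_snd, smul_add, smul_comm]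
    rw [e, WithLp.smul_fst, WithLp.smul_snd]
    simp only [pair_smul]
    rw [h4 φ hφ]
    ring

/-- The graph `{(z, w) | w = 𝓛 z}` of the linearization about the profile `(Q, R)`. -/
def linGraph (a b c α : ℝ) (Q R : ℝ → ℝ) (hQ : ContDiff ℝ 1 Q) (hR : ContDiff ℝ 1 R) :
    Submodule ℂ (State α × State α) where
  carrier := {p | LinRel a b c Q R p.1 p.2}
  add_mem' h h' := LinRel.add hQ hR h h'
  smul_mem' k _ h := LinRel.smul k h
  zero_mem' := by
    have h0 (ψ : ℝ → ℝ) : pair ψ (0 : L2w α) = 0 := by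
      have := pair_smul ψ 0 (0 : L2w α)
      simpa using this
    refine ⟨0, 0, (hasWeakDeriv_iff _ _).2 fun φ _ => ?_,
      (hasWeakDeriv_iff _ _).2 fun φ _ => ?_, ?_, fun φ _ => ?_⟩ <;> simp [h0]

/-! ### Solitary waves -/

/-- The decay rate `α_c` of the solitary wave. -/
def alphaC (a b c : ℝ) : ℝ := √((c ^ 2 - 1) / (b * c ^ 2 - a))

/-- The profile `q_c(x) = ((c² - 1) / c) sech² (α_c x / 2)`. -/
def qc (a b c : ℝ) (x : ℝ) : ℝ :=
  (c ^ 2 - 1) / c * (1 / Real.cosh (alphaC a b c * x / 2)) ^ 2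

/-- The profile `r_c = -c q_c`. -/
def rc (a b c : ℝ) (x : ℝ) : ℝ := -c * qc a b c x

lemma contDiff_qc (a b c : ℝ) : ContDiff ℝ 1 (qc a b c) := by
  unfold qc
  refine contDiff_const.mul (ContDiff.pow (contDiff_const.div ?_ fun x => ?_) 2)
  · exact Real.contDiff_cosh.comp (by fun_prop)
  · exact (Real.cosh_pos _).ne'

lemma contDiff_rc (a b c : ℝ) : ContDiff ℝ 1 (rc a b c) :=
  contDiff_const.mul (contDiff_qc a b c)

/-- The graph of `𝓛_c`, the linearization about the solitary wave `(q_c, r_c)`. -/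
def LcGraph (a b c α : ℝ) : Submodule ℂ (State α × State α) :=
  linGraph a b c α (qc a b c) (rc a b c) (contDiff_qc a b c) (contDiff_rc a b c)

/-- The graph of the constant-coefficient operator `L + c∂ = [[c∂, ∂], [B⁻¹A∂, c∂]]`, which is the
linearization about the state of rest. -/
def L0Graph (a b c α : ℝ) : Submodule ℂ (State α × State α) :=
  linGraph a b c α (fun _ => 0) (fun _ => 0) contDiff_const contDiff_const

/-- The operator `𝓛_c` in `L²_α`. -/
def Lc (a b c α : ℝ) : State α →ₗ.[ℂ] State α := (LcGraph a b c α).toLinearPMap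

/-- The operator `L + c∂` in `L²_α`. -/
def L0 (a b c α : ℝ) : State α →ₗ.[ℂ] State α := (L0Graph a b c α).toLinearPMap

end BenneyLuke

end

/-! Multiplication by `e^{αx}` carries `L²_α` isometrically to `L²` and turns `∂` into `∂ - α`.
After a Fourier transform (`ft`), constant-coefficient operators become multiplications, with `∂`
represented by `d = 2πiξ - α`. Throughout, `B` and `A` stand for `1 - b d²` and `1 - a d²`. The
condition `α < α_c` implies `b α² < 1`, so `B` stays away from zero and `B⁻¹`, `d B⁻¹`, `d² B⁻¹` are
bounded.

Free part. The symbol of `L + c∂` is `d [[c, 1], [S², c]]` with `S² = A / B`, hence it is similar to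
the diagonal matrix with entries `d (c ± S)`. The key estimate `abs_re_dsym_mul_le` bounds `|Re (d
S)|` by its value at `ξ = 0`, and `α < α_c` says exactly that this value is less than `α c`. So both
branches have real part at most `-gap < 0` (`branch_re_le`). Explicit multipliers then give a
bounded semigroup generated by `L + c∂` and a resolvent on `Re λ > -gap` whose norm tends to zero as
`Re λ → ∞`.

Perturbation. Writing `R q' + 2R' q = (R q)' + R' q` and `2Q r' + Q' r = 2(Q r)' - Q' r` moves all
derivatives onto `B⁻¹`. What is left is a sum of operators `m(D) φ(x)` with `m` and `φ` vanishing at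
infinity, which are compact. This gives (i). The bounded perturbation theorem
(`exists_semigroup_vadd`) gives (ii). For (iii), factor `λ - 𝓛_c = (1 - K R(λ)) (λ - L - c∂)` and
apply the analytic Fredholm alternative on the half-plane `Re λ > -gap`, which is connected and
contains a point where `K R(λ)` is a strict contraction
(`notMem_essSpectrum_of_compact_perturbation`).

Multiplicity. Differentiating the travelling-wave equation in `x` and in `c` gives `𝓛_c z₁ = 0` and
`𝓛_c z₂ = z₁`. The kernel is one-dimensional: the first row gives `r = -c q`, the second integrates
once to the second-order equation solved by `∂ₓ q_c`, and the Wronskian of two solutions in `L²_α`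
is a constant in `L²_α`, hence zero. The chain stops at `z₂`: if `𝓛_c z = β z₂`, testing the second
row against `q_c` and using the profile equation leaves `β` times the derivative in `c` of `∫ (c
(q_c² + b q_c'²) - q_c³ / 2)`, which is positive (`integral_momentum_pos`), so `β = 0`. -/

noncomputable section

namespace BenneyLuke

/-! ### Bounded perturbation of semigroup generators, via a Volterra equation. -/

section Perturbation

open BoundedContinuousFunction

variable {E : Type*} [NormedAddCommGroup E] [NormedSpace ℂ E]

/-- A bounded strongly continuous family of operators is jointly continuous. -/
lemma continuous_uncurry_of_bounded {X : Type*} [TopologicalSpace X] {W : X → E →L[ℂ] E} {M : ℝ}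
    (hM : ∀ t, ‖W t‖ ≤ M) (hW : ∀ z, Continuous fun t => W t z) :
    Continuous fun p : X × E => W p.1 p.2 := by
  rw [continuous_iff_continuousAt]
  rintro ⟨t₀, z₀⟩
  have h1 : Tendsto (fun p : X × E => W p.1 (p.2 - z₀)) (𝓝 (t₀, z₀)) (𝓝 0) := by
    refine squeeze_zero_norm (a := fun p => M * ‖p.2 - z₀‖) (fun p => ?_) ?_
    · exact (W p.1).le_of_opNorm_le (hM _) _
    · have : Continuous fun p : X × E => M * ‖p.2 - z₀‖ := by fun_prop
      simpa using this.tendsto (t₀, z₀)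
  have h2 : Tendsto (fun p : X × E => W p.1 z₀) (𝓝 (t₀, z₀)) (𝓝 (W t₀ z₀)) :=
    ((hW z₀).comp continuous_fst).tendsto (t₀, z₀)
  have := h1.add h2
  simpa [ContinuousAt] using this

/-- Since `∫ e^{-βs} ds ≤ 1 / β`, a large discount rate `β` makes the Volterra operator a
contraction. Time enters as `max t 0` so that one can work with bounded continuous functions on the
whole line. -/
lemma norm_volterra_integral_le {W : ℝ → E →L[ℂ] E} {M β : ℝ} (hβ : 0 < β)
    (hM : ∀ t, ‖W t‖ ≤ M) (hexp : ∀ t, 0 ≤ t → ‖W t‖ ≤ M * Real.exp (-β * t)) (P : E →L[ℂ] E)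
    (u : ℝ →ᵇ E) (t : ℝ) :
    ‖∫ s in (0 : ℝ)..max t 0, W s (P (u (max t 0 - s)))‖ ≤ M * ‖P‖ / β * ‖u‖ := by
  have hM0 : 0 ≤ M := (norm_nonneg _).trans (hM 0)
  have ht : (0 : ℝ) ≤ max t 0 := le_max_right _ _
  refine (intervalIntegral.norm_integral_le_of_norm_le (g := fun s =>
    (M * ‖P‖ * ‖u‖) * Real.exp (-β * s)) ht ?_ ?_).trans ?_
  · refine Eventually.of_forall fun s hs => ?_
    calc ‖W s (P (u (max t 0 - s)))‖ ≤ (M * Real.exp (-β * s)) * (‖P‖ * ‖u‖) :=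
          ((W s).le_of_opNorm_le (hexp s hs.1.le) _).trans <| by
            gcongr
            exact (P.le_opNorm _).trans (by gcongr; exact u.norm_coe_le_norm _)
      _ = _ := by ring
  · exact Continuous.intervalIntegrable (by fun_prop) _ _
  · rw [intervalIntegral.integral_const_mul]
    have : ∫ s in (0 : ℝ)..max t 0, Real.exp (-β * s) ≤ 1 / β := by
      have e : ∫ s in (0 : ℝ)..max t 0, Real.exp (-β * s) = (1 - Real.exp (-β * max t 0)) / β := by
        rw [intervalIntegral.integral_comp_mul_left (fun x => Real.exp x) (neg_ne_zero.2 hβ.ne'), integral_exp]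
        simp only [mul_zero, Real.exp_zero, smul_eq_mul]
        field_simp
        ring
      rw [e]
      have := Real.exp_pos (-β * max t 0)
      gcongr
      linarith
    calc _ ≤ (M * ‖P‖ * ‖u‖) * (1 / β) := by gcongr
      _ = _ := by ring

/-- The Volterra operator `u ↦ ∫₀ᵗ W(s) P u(t - s) ds` with an exponentially decaying kernel. -/
def volterra (W : ℝ → E →L[ℂ] E) (M β : ℝ) (hβ : 0 < β)
    (hW : ∀ z, Continuous fun t => W t z) (hM : ∀ t, ‖W t‖ ≤ M)
    (hexp : ∀ t, 0 ≤ t → ‖W t‖ ≤ M * Real.exp (-β * t)) (P : E →L[ℂ] E) :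
    (ℝ →ᵇ E) →L[ℂ] (ℝ →ᵇ E) :=
  have hc (u : ℝ →ᵇ E) : Continuous fun p : ℝ × ℝ => W p.2 (P (u (max p.1 0 - p.2))) :=
    (continuous_uncurry_of_bounded hM hW).comp
      (Continuous.prodMk (by fun_prop)
        (P.continuous.comp (u.continuous.comp (by fun_prop))))
  LinearMap.mkContinuous
    { toFun := fun u => BoundedContinuousFunction.ofNormedAddCommGroup
        (fun t => ∫ s in (0 : ℝ)..max t 0, W s (P (u (max t 0 - s))))
        (intervalIntegral.continuous_parametric_intervalIntegral_of_continuous (hc u)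
          (by fun_prop)) _
        (norm_volterra_integral_le hβ hM hexp P u)
      map_add' := fun u v => by
        ext t
        simp only [coe_ofNormedAddCommGroup, BoundedContinuousFunction.coe_add, Pi.add_apply,
          map_add]
        exact intervalIntegral.integral_add
          (((hc u).comp (Continuous.prodMk_right t)).intervalIntegrable _ _)
          (((hc v).comp (Continuous.prodMk_right t)).intervalIntegrable _ _)
      map_smul' := fun k u => by
        ext t
        simp only [coe_ofNormedAddCommGroup, BoundedContinuousFunction.coe_smul, map_smul,
          RingHom.id_apply]
        exact intervalIntegral.integral_smul _ _ }
    (M * ‖P‖ / β) fun u => by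
      have hM0 : 0 ≤ M := (norm_nonneg _).trans (hM 0)
      exact BoundedContinuousFunction.norm_ofNormedAddCommGroup_le _ (by positivity)
        (norm_volterra_integral_le hβ hM hexp P u)

lemma volterra_apply {W : ℝ → E →L[ℂ] E} {M β : ℝ} (hβ : 0 < β)
    (hW : ∀ z, Continuous fun t => W t z) (hM : ∀ t, ‖W t‖ ≤ M)
    (hexp : ∀ t, 0 ≤ t → ‖W t‖ ≤ M * Real.exp (-β * t)) (P : E →L[ℂ] E) (u : ℝ →ᵇ E) (t : ℝ) :
    volterra W M β hβ hW hM hexp P u t = ∫ s in (0 : ℝ)..max t 0, W s (P (u (max t 0 - s))) :=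
  rfl

lemma norm_volterra_le {W : ℝ → E →L[ℂ] E} {M β : ℝ} (hβ : 0 < β)
    (hW : ∀ z, Continuous fun t => W t z) (hM : ∀ t, ‖W t‖ ≤ M)
    (hexp : ∀ t, 0 ≤ t → ‖W t‖ ≤ M * Real.exp (-β * t)) (P : E →L[ℂ] E) :
    ‖volterra W M β hβ hW hM hexp P‖ ≤ M * ‖P‖ / β :=
  LinearMap.mkContinuous_norm_le _ (by have := (norm_nonneg _).trans (hM 0); positivity) fun u => by
    have hM0 : 0 ≤ M := (norm_nonneg _).trans (hM 0)
    exact BoundedContinuousFunction.norm_ofNormedAddCommGroup_le _ (by positivity)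
      (norm_volterra_integral_le hβ hM hexp P u)

/-- The orbit map `z ↦ W(·) z` into the bounded continuous functions. -/
def orbitMap (W : ℝ → E →L[ℂ] E) (M : ℝ) (hW : ∀ z, Continuous fun t => W t z)
    (hM : ∀ t, ‖W t‖ ≤ M) : E →L[ℂ] (ℝ →ᵇ E) :=
  LinearMap.mkContinuous
    { toFun := fun z => BoundedContinuousFunction.ofNormedAddCommGroup (fun t => W t z) (hW z)
        (M * ‖z‖) fun t => (W t).le_of_opNorm_le (hM t) z
      map_add' := fun z w => by ext t; simp
      map_smul' := fun k z => by ext t; simp }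
    M fun z => BoundedContinuousFunction.norm_ofNormedAddCommGroup_le _
      (mul_nonneg ((norm_nonneg _).trans (hM 0)) (norm_nonneg _))
      fun t => (W t).le_of_opNorm_le (hM t) z

lemma orbitMap_apply {W : ℝ → E →L[ℂ] E} {M : ℝ} (hW : ∀ z, Continuous fun t => W t z)
    (hM : ∀ t, ‖W t‖ ≤ M) (z : E) (t : ℝ) : orbitMap W M hW hM z t = W t z := rfl

variable [CompleteSpace E]

/-- A family `S` solving the Volterra equation
`S(t) z = T(t) z + ∫₀ᵗ T(s) P S(t - s) z ds` (after multiplication by `e^{-βt}`), where `P` is a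
bounded perturbation. -/
theorem exists_volterra_solution {W : ℝ → E →L[ℂ] E} {M β : ℝ} (hβ : 0 < β)
    (hW : ∀ z, Continuous fun t => W t z) (hM : ∀ t, ‖W t‖ ≤ M)
    (hexp : ∀ t, 0 ≤ t → ‖W t‖ ≤ M * Real.exp (-β * t)) (P : E →L[ℂ] E)
    (hsmall : M * ‖P‖ < β) :
    ∃ Z : E →L[ℂ] (ℝ →ᵇ E), ∀ (z : E) (u : ℝ →ᵇ E),
      (∀ t, u t = W t z + ∫ s in (0 : ℝ)..max t 0, W s (P (u (max t 0 - s)))) ↔ u = Z z := by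
  set V := volterra W M β hβ hW hM hexp P
  have hV : ‖V‖ < 1 :=
    (norm_volterra_le hβ hW hM hexp P).trans_lt (by rw [div_lt_one hβ]; exact hsmall)
  -- The equation reads `(1 - V) u = W(·) z`, and `1 - V` is inverted by a Neumann series. The
  -- equivalence in the conclusion also records uniqueness, from which the semigroup law will
  -- follow.
  set N := Units.oneSub V hV
  refine ⟨(↑N⁻¹ : (ℝ →ᵇ E) →L[ℂ] (ℝ →ᵇ E)).comp (orbitMap W M hW hM), fun z u => ?_⟩
  have hN : (N : (ℝ →ᵇ E) →L[ℂ] (ℝ →ᵇ E)) = 1 - V := Units.val_oneSub V hV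
  have h1 (x : ℝ →ᵇ E) : (↑N⁻¹ : (ℝ →ᵇ E) →L[ℂ] (ℝ →ᵇ E)) (x - V x) = x := by
    have := congrArg (fun A : (ℝ →ᵇ E) →L[ℂ] (ℝ →ᵇ E) => A x) N.inv_mul
    simpa [hN] using this
  have h2 (x : ℝ →ᵇ E) : (↑N⁻¹ : (ℝ →ᵇ E) →L[ℂ] (ℝ →ᵇ E)) x -
      V ((↑N⁻¹ : (ℝ →ᵇ E) →L[ℂ] (ℝ →ᵇ E)) x) = x := by
    have := congrArg (fun A : (ℝ →ᵇ E) →L[ℂ] (ℝ →ᵇ E) => A x) N.mul_inv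
    simpa [hN] using this
  constructor
  · intro h
    have : u - V u = orbitMap W M hW hM z := by
      ext t
      rw [BoundedContinuousFunction.sub_apply, h t, orbitMap_apply, volterra_apply]
      abel
    rw [ContinuousLinearMap.comp_apply, ← this, h1]
  · rintro rfl t
    have := congrArg (fun f : ℝ →ᵇ E => f t) (h2 (orbitMap W M hW hM z))
    rw [BoundedContinuousFunction.sub_apply, sub_eq_iff_eq_add] at this
    exact this

/-- If `h` is continuous at the origin then `t⁻¹ ∫₀ᵗ h(t, s) ds → h(0, 0)`. -/
lemma tendsto_average_zero {h : ℝ → ℝ → E} (hc : Continuous fun p : ℝ × ℝ => h p.1 p.2) :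
    Tendsto (fun t : ℝ => ((t : ℂ)⁻¹) • ∫ s in (0 : ℝ)..t, h t s) (𝓝[>] 0) (𝓝 (h 0 0)) := by
  rw [Metric.tendsto_nhds]
  intro ε hε
  obtain ⟨δ, hδ, H⟩ := Metric.continuousAt_iff.1 (hc.continuousAt (x := ((0 : ℝ), (0 : ℝ))))
    (ε / 2) (half_pos hε)
  filter_upwards [Ioo_mem_nhdsGT hδ] with t ht
  have h1 : (t : ℂ)⁻¹ • (∫ s in (0 : ℝ)..t, h t s) - h 0 0 =
      (t : ℂ)⁻¹ • ∫ s in (0 : ℝ)..t, (h t s - h 0 0) := by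
    have : IntervalIntegrable (fun s => h t s) volume 0 t :=
      (hc.comp (Continuous.prodMk_right t)).intervalIntegrable _ _
    rw [intervalIntegral.integral_sub this (by simp), intervalIntegral.integral_const, smul_sub,
      sub_zero, ← Complex.coe_smul t (h 0 0), smul_smul, inv_mul_cancel₀, one_smul]
    exact_mod_cast ht.1.ne'
  rw [dist_eq_norm, h1, norm_smul, norm_inv, Complex.norm_real, Real.norm_of_nonneg ht.1.le]
  have h2 : ‖∫ s in (0 : ℝ)..t, (h t s - h 0 0)‖ ≤ ε / 2 * |t - 0| := by
    refine intervalIntegral.norm_integral_le_of_norm_le_const fun s hs => ?_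
    rw [Set.uIoc_of_le ht.1.le] at hs
    rw [← dist_eq_norm]
    refine (H (x := (t, s)) ?_).le
    rw [Prod.dist_eq, max_lt_iff]
    simp only [Real.dist_eq, sub_zero, abs_of_pos ht.1, abs_of_pos hs.1]
    exact ⟨ht.2, hs.2.trans_lt ht.2⟩
  rw [sub_zero, abs_of_pos ht.1] at h2
  calc t⁻¹ * _ ≤ t⁻¹ * (ε / 2 * t) := by have := ht.1; gcongr
    _ = ε / 2 := by have := ht.1.ne'; field_simp
    _ < ε := half_lt_self hε

/-- Bounded perturbation theorem for bounded `C⁰` semigroups. -/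
theorem exists_semigroup_vadd {G : E →ₗ.[ℂ] E} {T : ℝ → E →L[ℂ] E} {M : ℝ}
    (hT : IsC0Semigroup T) (hM : ∀ t, 0 ≤ t → ‖T t‖ ≤ M) (hG : IsGenerator G T) (P : E →L[ℂ] E) :
    ∃ S : ℝ → E →L[ℂ] E, IsC0Semigroup S ∧ IsGenerator ((P : E →ₗ[ℂ] E) +ᵥ G) S := by
  have hM0 : 0 ≤ M := (norm_nonneg _).trans (hM 0 le_rfl)
  -- Any `β > M ‖P‖` would do: it makes the rescaled family `W(t) = e^{-βt} T(t)` satisfy the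
  -- smallness condition of the Volterra equation.
  set β := M * ‖P‖ + 1 with hβd
  have hβ : 0 < β := by positivity
  set W : ℝ → E →L[ℂ] E := fun t => ((Real.exp (-β * max t 0) : ℝ) : ℂ) • T (max t 0) with hWd
  have hW (z : E) : Continuous fun t => W t z := by
    have : Continuous fun t : ℝ => T (max t 0) z :=
      (hT.continuous z).comp_continuous (by fun_prop) fun t => le_max_right t 0
    simp only [hWd, _root_.smul_apply]
    exact Continuous.smul (Complex.continuous_ofReal.comp (by fun_prop)) this
  have hexp (t : ℝ) (ht : 0 ≤ t) : ‖W t‖ ≤ M * Real.exp (-β * t) := by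
    simp only [hWd, max_eq_left ht]
    rw [norm_smul, Complex.norm_real, Real.norm_of_nonneg (Real.exp_pos _).le, mul_comm]
    gcongr
    exact hM t ht
  have hWM (t : ℝ) : ‖W t‖ ≤ M := by
    have e : W t = W (max t 0) := by simp [hWd]
    rw [e]
    refine (hexp _ (le_max_right _ _)).trans (mul_le_of_le_one_right hM0 ?_)
    rw [Real.exp_le_one_iff]
    have := le_max_right t 0
    nlinarith
  have hWadd (s t : ℝ) (hs : 0 ≤ s) (ht : 0 ≤ t) (z : E) : W (s + t) z = W s (W t z) := by
    simp only [hWd, max_eq_left hs, max_eq_left ht, max_eq_left (add_nonneg hs ht),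
      _root_.smul_apply, hT.add s t hs ht, ContinuousLinearMap.comp_apply,
      map_smul, smul_smul]
    rw [← Complex.ofReal_mul, ← Real.exp_add]
    ring_nf
  have hW0 (z : E) : W 0 z = z := by simp [hWd, hT.zero]
  obtain ⟨Z, hZ⟩ := exists_volterra_solution hβ hW hWM hexp P (by linarith)
  have hsol (z : E) := (hZ z (Z z)).2 rfl
  have hsol0 (z : E) {t : ℝ} (ht : 0 ≤ t) :
      Z z t = W t z + ∫ s in (0 : ℝ)..t, W s (P (Z z (t - s))) := by
    have := hsol z t
    rwa [max_eq_left ht] at this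
  have hcont (z : E) : Continuous fun p : ℝ × ℝ => W p.2 (P (Z z (p.1 - p.2))) :=
    (continuous_uncurry_of_bounded hWM hW).comp
      (Continuous.prodMk (by fun_prop)
        (P.continuous.comp ((Z z).continuous.comp (by fun_prop))))
  have hadd (z : E) (t₀ : ℝ) (ht₀ : 0 ≤ t₀) (t : ℝ) (ht : 0 ≤ t) :
      Z (Z z t₀) t = Z z (t₀ + t) := by
    -- Semigroup law by uniqueness: the orbit of `z` delayed by `t₀` solves the Volterra equation
    -- with initial datum `Z z t₀`.
    set v : ℝ →ᵇ E := (Z z).compContinuous ⟨fun t => t₀ + max t 0, by fun_prop⟩ with hv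
    have hv' (t : ℝ) : v t = Z z (t₀ + max t 0) := rfl
    have hint (r p q : ℝ) :
        IntervalIntegrable (fun s => W s (P (Z z (r - s)))) volume p q :=
      ((hcont z).comp (Continuous.prodMk_right r)).intervalIntegrable _ _
    have := (hZ (Z z t₀) v).1 fun t => by
      have key : ∀ t : ℝ, 0 ≤ t → Z z (t₀ + t) = W t (Z z t₀) +
          ∫ s in (0 : ℝ)..t, W s (P (v (t - s))) := by
        intro t ht
        -- Split the integral over `[0, t₀ + t]` at `t`. On the second piece shift by `t` and pull
        -- out `W t`, using `W (t + s) = W t W s`; this completes `W t (Z z t₀)`.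
        rw [hsol0 z (add_nonneg ht₀ ht), hsol0 z ht₀, map_add, ← hWadd t t₀ ht ht₀, add_comm t t₀,
          ← intervalIntegral.integral_add_adjacent_intervals (hint _ 0 t) (hint _ t (t₀ + t)),
          add_assoc]
        congr 1
        rw [add_comm]
        congr 1
        · rw [← (W t).intervalIntegral_comp_comm (hint _ _ _)]
          have := intervalIntegral.integral_comp_add_right (a := 0) (b := t₀)
            (fun s => W s (P (Z z (t₀ + t - s)))) t
          rw [zero_add] at this
          rw [← this]
          refine intervalIntegral.integral_congr fun s hs => ?_
          rw [Set.uIcc_of_le ht₀] at hs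
          rw [add_comm s t, hWadd t s ht hs.1]
          congr 4
          ring
        · refine intervalIntegral.integral_congr fun s hs => ?_
          rw [Set.uIcc_of_le ht] at hs
          simp only [hv', max_eq_left (sub_nonneg.2 hs.2)]
          congr 3
          ring
      have e : W t (Z z t₀) = W (max t 0) (Z z t₀) := by simp [hWd]
      rw [hv', e]
      exact key _ (le_max_right _ _)
    rw [← this, hv', max_eq_left ht]
  refine ⟨fun t => ((Real.exp (β * t) : ℝ) : ℂ) •
    (BoundedContinuousFunction.evalCLM ℂ t).comp Z, ⟨?_, ?_, ?_⟩, ?_⟩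
  · ext z
    simp [hsol0 z le_rfl, hW0]
  · intro s t hs ht
    ext z
    simp only [_root_.smul_apply, ContinuousLinearMap.comp_apply,
      BoundedContinuousFunction.evalCLM_apply, map_smul, smul_smul]
    rw [hadd z t ht s hs, ← Complex.ofReal_mul, ← Real.exp_add, add_comm t s]
    ring_nf
  · intro z
    refine Continuous.continuousOn ?_
    simp only [_root_.smul_apply, ContinuousLinearMap.comp_apply,
      BoundedContinuousFunction.evalCLM_apply]
    exact Continuous.smul (Complex.continuous_ofReal.comp (by fun_prop)) (Z z).continuous
  · intro z w
    have h1 : (z, w) ∈ ((P : E →ₗ[ℂ] E) +ᵥ G).graph ↔ (z, w - P z) ∈ G.graph := by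
      simp only [LinearPMap.mem_graph_iff, LinearPMap.vadd_apply]
      constructor
      · rintro ⟨y, rfl, h⟩
        exact ⟨y, rfl, by rw [← h]; simp⟩
      · rintro ⟨y, rfl, h⟩
        exact ⟨y, rfl, by rw [h]; simp⟩
    rw [h1, hG z (w - P z)]
    -- The Duhamel term contributes exactly `P z` to the difference quotient at time zero, so the
    -- quotient of the new semigroup converges precisely when that of `T` does.
    have h2 : Tendsto (fun t : ℝ => ((Real.exp (β * t) : ℝ) : ℂ) • (((t : ℂ)⁻¹) •
        ∫ s in (0 : ℝ)..t, W s (P (Z z (t - s))))) (𝓝[>] 0) (𝓝 (P z)) := by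
      have e1 := tendsto_average_zero (h := fun t s => W s (P (Z z (t - s)))) (hcont z)
      have e2 : Tendsto (fun t : ℝ => ((Real.exp (β * t) : ℝ) : ℂ)) (𝓝[>] 0) (𝓝 1) := by
        have : Continuous fun t : ℝ => ((Real.exp (β * t) : ℝ) : ℂ) :=
          Complex.continuous_ofReal.comp (by fun_prop)
        simpa using (this.tendsto 0).mono_left nhdsWithin_le_nhds
      have e3 := e2.smul e1
      simpa [hW0, hsol0 z le_rfl] using e3
    have h3 : ∀ᶠ t : ℝ in 𝓝[>] 0, ((t : ℂ)⁻¹) • (((((Real.exp (β * t) : ℝ) : ℂ) •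
        (BoundedContinuousFunction.evalCLM ℂ t).comp Z) z) - z) =
        ((t : ℂ)⁻¹) • (T t z - z) + ((Real.exp (β * t) : ℝ) : ℂ) • (((t : ℂ)⁻¹) •
        ∫ s in (0 : ℝ)..t, W s (P (Z z (t - s)))) := by
      filter_upwards [self_mem_nhdsWithin] with t ht
      have ht' : (0 : ℝ) ≤ t := le_of_lt ht
      simp only [_root_.smul_apply, ContinuousLinearMap.comp_apply,
        BoundedContinuousFunction.evalCLM_apply]
      rw [hsol0 z ht']
      have : ((Real.exp (β * t) : ℝ) : ℂ) • W t z = T t z := by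
        simp only [hWd, max_eq_left ht', _root_.smul_apply, smul_smul]
        rw [← Complex.ofReal_mul, ← Real.exp_add]
        simp
      rw [smul_add, this, smul_comm _ ((t : ℂ)⁻¹), ← smul_add]
      congr 1
      abel
    rw [tendsto_congr' h3]
    constructor
    · intro h
      simpa using h.add h2
    · intro h
      simpa using h.sub h2

end Perturbation

end BenneyLuke

namespace BenneyLuke

/-! ### Compact perturbations of the identity depending analytically on a parameter. -/

section Fredholm

variable {E : Type*} [NormedAddCommGroup E]

/-- A compact operator into a Hilbert space is a norm limit of operators factoring through some
`ℂⁿ`. -/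
lemma exists_finiteRank_norm_sub_lt [InnerProductSpace ℂ E] {K : E →L[ℂ] E}
    (hK : IsCompactOperator K) {ε : ℝ} (hε : 0 < ε) :
    ∃ (n : ℕ) (p : E →L[ℂ] (Fin n → ℂ)) (j : (Fin n → ℂ) →L[ℂ] E), ‖K - j.comp p‖ < ε := by
  have htb : TotallyBounded (K '' Metric.closedBall 0 1) :=
    (hK.isCompact_closure_image_closedBall (f := (K : E →ₗ[ℂ] E)) 1).totallyBounded.subset
      subset_closure
  -- A finite `ε / 2`-net of the image of the unit ball spans `V`. The orthogonal projection of `K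
  -- x` on `V` is at least as close to `K x` as the nearest point of the net.
  obtain ⟨t, ht, hcov⟩ := Metric.totallyBounded_iff.1 htb (ε / 2) (half_pos hε)
  set V : Submodule ℂ E := Submodule.span ℂ t
  have : FiniteDimensional ℂ V := FiniteDimensional.span_of_finite ℂ ht
  let e : V ≃L[ℂ] (Fin (Module.finrank ℂ V) → ℂ) :=
    ContinuousLinearEquiv.ofFinrankEq (by simp)
  refine ⟨Module.finrank ℂ V, (e : V →L[ℂ] _).comp (V.orthogonalProjectionOnto.comp K),
    V.subtypeL.comp (e.symm : _ →L[ℂ] V), ?_⟩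
  refine lt_of_le_of_lt (ContinuousLinearMap.opNorm_le_of_unit_norm (C := ε / 2)
    (half_pos hε).le fun x hx => ?_) (half_lt_self hε)
  have hx' : K x ∈ K '' Metric.closedBall 0 1 := ⟨x, by simp [hx], rfl⟩
  obtain ⟨y, hy, hxy⟩ := Set.mem_iUnion₂.1 (hcov hx')
  have h1 : (K - (V.subtypeL.comp e.symm.toContinuousLinearMap).comp
      (e.toContinuousLinearMap.comp (V.orthogonalProjectionOnto.comp K))) x =
      K x - V.starProjection (K x) := by
    change K x - ((e.symm (e (V.orthogonalProjectionOnto (K x))) : V) : E) = _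
    rw [e.symm_apply_apply]
    rfl
  rw [h1]
  have h2 := V.starProjection_minimal (K x)
  rw [h2]
  refine (ciInf_le ⟨0, ?_⟩ (⟨y, Submodule.subset_span hy⟩ : V)).trans ?_
  · rintro _ ⟨z, rfl⟩
    exact norm_nonneg _
  · rw [Metric.mem_ball, dist_eq_norm] at hxy
    exact hxy.le

variable [NormedSpace ℂ E] [CompleteSpace E]

/-- Near a point where it is a compact perturbation of the identity, an analytic family
`1 - A(lam)` is invertible exactly where a scalar analytic function does not vanish. -/
lemma exists_analytic_determinant {A : ℂ → E →L[ℂ] E} {l₀ : ℂ} (hA : AnalyticAt ℂ A l₀) {n : ℕ}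
    {p : E →L[ℂ] (Fin n → ℂ)} {j : (Fin n → ℂ) →L[ℂ] E} (hF : ‖A l₀ - j.comp p‖ < 1) :
    ∃ (g : ℂ → ℂ) (J : ℂ → E →L[ℂ] E) (C : ℝ), AnalyticAt ℂ g l₀ ∧ 0 ≤ C ∧
      ∀ᶠ l in 𝓝 l₀,
        (g l ≠ 0 → (1 - A l) * J l = 1 ∧ J l * (1 - A l) = 1 ∧ ‖J l‖ ≤ C * (1 + ‖g l‖⁻¹)) ∧
        (g l = 0 → ∃ x, x ≠ 0 ∧ (1 - A l) x = 0) := by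
  -- Here `1 - A = G - j p` with `G` invertible near `l₀`. With `X = G⁻¹` this is `G (1 - X j p)`,
  -- and `1 - X j p` is invertible exactly when the `n × n` matrix `N = 1 - p X j` is.
  set G : ℂ → E →L[ℂ] E := fun l => 1 - (A l - j.comp p) with hGd
  have hG : AnalyticAt ℂ G l₀ := analyticAt_const.sub (hA.sub analyticAt_const)
  have hGu : IsUnit (G l₀) := (Units.oneSub _ hF).isUnit
  set X : ℂ → E →L[ℂ] E := fun l => Ring.inverse (G l) with hXd
  have hX : AnalyticAt ℂ X l₀ := by
    obtain ⟨u, hu⟩ := hGu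
    have := analyticAt_inverse (𝕜 := ℂ) u
    rw [hu] at this
    exact this.comp hG
  set N : ℂ → Matrix (Fin n) (Fin n) ℂ := fun l =>
    1 - Matrix.of fun i k => p (X l (j (Pi.single k 1))) i with hNd
  have hNi (i k : Fin n) : AnalyticAt ℂ (fun l => N l i k) l₀ := by
    simp only [hNd, Matrix.sub_apply, Matrix.of_apply]
    refine analyticAt_const.sub ?_
    let ev : (E →L[ℂ] E) →L[ℂ] ℂ := ((ContinuousLinearMap.proj (R := ℂ) (φ := fun _ => ℂ) i).comp
      p).comp (ContinuousLinearMap.apply ℂ E (j (Pi.single k 1)))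
    exact (ev.analyticAt _).comp hX
  have hdet (N' : ℂ → Matrix (Fin n) (Fin n) ℂ) (h : ∀ i k, AnalyticAt ℂ (fun l => N' l i k) l₀) :
      AnalyticAt ℂ (fun l => (N' l).det) l₀ := by
    simp only [Matrix.det_apply]
    refine Finset.analyticAt_fun_sum _ fun σ _ => ?_
    simp only [Units.smul_def, zsmul_eq_mul]
    exact analyticAt_const.mul (Finset.analyticAt_fun_prod _ fun i _ => h _ _)
  set g : ℂ → ℂ := fun l => (N l).det with hgd
  have hadj (i k : Fin n) : AnalyticAt ℂ (fun l => (N l).adjugate i k) l₀ := by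
    simp only [Matrix.adjugate_apply]
    refine hdet _ fun i' k' => ?_
    by_cases h : i' = k
    · subst h
      simp only [Matrix.updateRow_self]
      exact analyticAt_const
    · simp only [Matrix.updateRow_ne h]
      exact hNi _ _
  have hNact (l : ℂ) (v : Fin n → ℂ) : Matrix.mulVec (N l) v = v - p (X l (j v)) := by
    ext i
    have : p (X l (j v)) = ∑ k, v k • p (X l (j (Pi.single k 1))) := by
      conv_lhs => rw [← Finset.univ_sum_single v]
      simp only [map_sum]
      refine Finset.sum_congr rfl fun k _ => ?_
      rw [← map_smul, ← map_smul, ← map_smul]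
      congr 3
      ext i
      simp [Pi.single_apply]
    rw [this]
    simp only [hNd, Matrix.sub_mulVec, Matrix.one_mulVec, Pi.sub_apply, Finset.sum_apply,
      Pi.smul_apply, smul_eq_mul]
    congr 1
    simp [Matrix.mulVec, dotProduct, mul_comm]
  let q : ℂ → (Fin n → ℂ) →L[ℂ] (Fin n → ℂ) := fun l =>
    LinearMap.toContinuousLinearMap (Matrix.mulVecLin (N l).adjugate)
  have hq : ContinuousAt q l₀ := by
    have h1 : ContinuousAt (fun l => (N l).adjugate) l₀ :=
      continuousAt_pi.2 fun i => continuousAt_pi.2 fun k => (hadj i k).continuousAt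
    let Λ : Matrix (Fin n) (Fin n) ℂ →ₗ[ℂ] ((Fin n → ℂ) →L[ℂ] (Fin n → ℂ)) :=
      (LinearMap.toContinuousLinearMap : ((Fin n → ℂ) →ₗ[ℂ] (Fin n → ℂ)) ≃ₗ[ℂ] _).toLinearMap ∘ₗ
        Matrix.mulVecBilin ℂ ℂ
    exact (Λ.continuous_of_finiteDimensional.tendsto (N l₀).adjugate).comp h1
  set Y : ℂ → E →L[ℂ] E := fun l => (X l).comp (j.comp ((q l).comp (p.comp (X l)))) with hYd
  have hY : ContinuousAt Y l₀ := by
    have hXc := hX.continuousAt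
    exact hXc.clm_comp (continuousAt_const.clm_comp (hq.clm_comp (continuousAt_const.clm_comp hXc)))
  -- The Woodbury formula `X + X j N⁻¹ p X` for the inverse. Writing `N⁻¹` as the adjugate over the
  -- determinant confines the singularity to the scalar factor `1 / g`; `X` and `Y` are continuous
  -- at `l₀`, hence bounded nearby.
  refine ⟨g, fun l => X l + (g l)⁻¹ • Y l, max (‖X l₀‖ + 1) (‖Y l₀‖ + 1), hdet _ hNi,
    (by positivity : (0 : ℝ) ≤ ‖X l₀‖ + 1).trans (le_max_left _ _), ?_⟩
  have e1 : ∀ᶠ l in 𝓝 l₀, IsUnit (G l) :=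
    hG.continuousAt.eventually (Units.isOpen.mem_nhds hGu)
  have e2 : ∀ᶠ l in 𝓝 l₀, ‖X l‖ < ‖X l₀‖ + 1 :=
    hX.continuousAt.norm.eventually (gt_mem_nhds (lt_add_one _))
  have e3 : ∀ᶠ l in 𝓝 l₀, ‖Y l‖ < ‖Y l₀‖ + 1 :=
    hY.norm.eventually (gt_mem_nhds (lt_add_one _))
  filter_upwards [e1, e2, e3] with l h1 h2 h3
  have hXG (x : E) : X l (G l x) = x :=
    congrArg (fun B : E →L[ℂ] E => B x) (Ring.inverse_mul_cancel _ h1)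
  have hGX (x : E) : G l (X l x) = x :=
    congrArg (fun B : E →L[ℂ] E => B x) (Ring.mul_inverse_cancel _ h1)
  have hAG (x : E) : (1 - A l) x = G l x - j (p x) := by
    simp only [hGd, _root_.sub_apply, ContinuousLinearMap.comp_apply, one_apply_eq_self]
    abel
  constructor
  · intro hg
    have ha1 (v : Fin n → ℂ) : q l (v - p (X l (j v))) = g l • v := by
      rw [← hNact]
      change Matrix.mulVec (N l).adjugate (Matrix.mulVec (N l) v) = _
      rw [Matrix.mulVec_mulVec, Matrix.adjugate_mul, Matrix.smul_mulVec, Matrix.one_mulVec]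
    have ha2 (v : Fin n → ℂ) : q l v - p (X l (j (q l v))) = g l • v := by
      rw [← hNact]
      change Matrix.mulVec (N l) (Matrix.mulVec (N l).adjugate v) = _
      rw [Matrix.mulVec_mulVec, Matrix.mul_adjugate, Matrix.smul_mulVec, Matrix.one_mulVec]
    refine ⟨?_, ?_, ?_⟩
    · ext x
      change (1 - A l) (X l x + (g l)⁻¹ • X l (j (q l (p (X l x))))) = x
      rw [hAG, map_add, hGX, map_smul, hGX, map_add, map_smul, map_add, map_smul]
      have := ha2 (p (X l x))
      have h4 : q l (p (X l x)) = g l • p (X l x) + p (X l (j (q l (p (X l x))))) := by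
        rw [← this]; abel
      have h5 : (g l)⁻¹ • j (q l (p (X l x))) =
          j (p (X l x)) + (g l)⁻¹ • j (p (X l (j (q l (p (X l x)))))) := by
        conv_lhs => rw [h4]
        rw [map_add, map_smul, smul_add, smul_smul, inv_mul_cancel₀ hg, one_smul]
      rw [h5]
      abel
    · ext x
      change X l ((1 - A l) x) + (g l)⁻¹ • X l (j (q l (p (X l ((1 - A l) x))))) = x
      have h4 : X l ((1 - A l) x) = x - X l (j (p x)) := by rw [hAG, map_sub, hXG]
      rw [h4, map_sub p, ha1, map_smul, map_smul, smul_smul, inv_mul_cancel₀ hg, one_smul]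
      abel
    · refine (norm_add_le _ _).trans ?_
      rw [norm_smul, norm_inv, mul_add, mul_one]
      rw [mul_comm _ ‖(g l)‖⁻¹]
      gcongr
      · exact h2.le.trans (le_max_left _ _)
      · exact h3.le.trans (le_max_right _ _)
  · intro hg
    obtain ⟨v, hv, hv0⟩ := Matrix.exists_mulVec_eq_zero_iff.2 hg
    rw [hNact, sub_eq_zero] at hv0
    -- A null vector `v` of `N` satisfies `v = p (X (j v))`, so `X (j v)` is nonzero and is killed
    -- by `G - j p`.
    refine ⟨X l (j v), fun h => hv ?_, ?_⟩
    · rw [hv0, h, map_zero]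
    · rw [hAG, hGX, ← hv0, sub_self]

/-- If `1 - A` differs from an invertible operator by one of finite rank then its range is closed
and its kernel is finite dimensional. -/
lemma isClosed_range_one_sub {A : E →L[ℂ] E} {n : ℕ} {p : E →L[ℂ] (Fin n → ℂ)}
    {j : (Fin n → ℂ) →L[ℂ] E} (hF : ‖A - j.comp p‖ < 1) :
    IsClosed (Set.range (1 - A : E →L[ℂ] E)) ∧
      FiniteDimensional ℂ (LinearMap.ker ((1 - A : E →L[ℂ] E) : E →ₗ[ℂ] E)) := by
  set N := Units.oneSub _ hF
  have hN (x : E) : (1 - A) x = (N : E →L[ℂ] E) x - j (p x) := by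
    have : (N : E →L[ℂ] E) = 1 - (A - j.comp p) := Units.val_oneSub _ hF
    rw [this]
    simp only [_root_.sub_apply, ContinuousLinearMap.comp_apply, one_apply_eq_self]
    abel
  have hNi (x : E) : (↑N⁻¹ : E →L[ℂ] E) ((N : E →L[ℂ] E) x) = x :=
    congrArg (fun B : E →L[ℂ] E => B x) N.inv_mul
  have hiN (x : E) : (N : E →L[ℂ] E) ((↑N⁻¹ : E →L[ℂ] E) x) = x :=
    congrArg (fun B : E →L[ℂ] E => B x) N.mul_inv
  constructor
  -- `P` is the image of `ker p` under `N`, on which `1 - A` and `N` agree. It is closed and of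
  -- finite codimension, so every subspace containing it is closed.
  · set P : Submodule ℂ E := (LinearMap.ker (p : E →ₗ[ℂ] (Fin n → ℂ))).comap
      ((↑N⁻¹ : E →L[ℂ] E) : E →ₗ[ℂ] E)
    have hP : IsClosed (P : Set E) := by
      have : (P : Set E) = (p.comp (↑N⁻¹ : E →L[ℂ] E)) ⁻¹' {0} := by
        ext x; simp [P]
      rw [this]
      exact isClosed_singleton.preimage (ContinuousLinearMap.continuous _)
    have hle : P ≤ LinearMap.range ((1 - A : E →L[ℂ] E) : E →ₗ[ℂ] E) := by
      intro y hy
      refine ⟨(↑N⁻¹ : E →L[ℂ] E) y, ?_⟩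
      have : p ((↑N⁻¹ : E →L[ℂ] E) y) = 0 := hy
      change (1 - A) _ = y
      rw [hN, hiN, this, map_zero, sub_zero]
    have : FiniteDimensional ℂ (E ⧸ P) := by
      have e : P = LinearMap.ker ((p.comp (↑N⁻¹ : E →L[ℂ] E) : E →L[ℂ] (Fin n → ℂ)) :
          E →ₗ[ℂ] (Fin n → ℂ)) := rfl
      rw [e]
      exact (LinearMap.quotKerEquivRange _).symm.finiteDimensional
    have := Submodule.isClosed_mono_of_finiteDimensional_quotient hP hle
    exact this
  · have hle : LinearMap.ker ((1 - A : E →L[ℂ] E) : E →ₗ[ℂ] E) ≤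
        LinearMap.range (((↑N⁻¹ : E →L[ℂ] E).comp j : (Fin n → ℂ) →L[ℂ] E) :
          (Fin n → ℂ) →ₗ[ℂ] E) := by
      intro x hx
      have hx' : (1 - A) x = 0 := hx
      rw [hN, sub_eq_zero] at hx'
      refine ⟨p x, ?_⟩
      change (↑N⁻¹ : E →L[ℂ] E) (j (p x)) = x
      rw [← hx', hNi]
    exact Submodule.finiteDimensional_of_le hle

end Fredholm

end BenneyLuke

namespace BenneyLuke

/-! ### Resolvents, generalized eigenspaces and stability of the essential spectrum. -/

section EssentialSpectrum

variable {E : Type*} [NormedAddCommGroup E]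

section Normed

variable [NormedSpace ℂ E]

/-- `R` is the resolvent `(lam - T)⁻¹`. -/
def IsResolventAt (T : E →ₗ.[ℂ] E) (lam : ℂ) (R : E →L[ℂ] E) : Prop :=
  (∀ z : T.domain, R (shifted T lam z) = z) ∧
    ∀ w : E, ∃ h : R w ∈ T.domain, shifted T lam ⟨R w, h⟩ = w

lemma shifted_apply (T : E →ₗ.[ℂ] E) (lam : ℂ) (z : T.domain) :
    shifted T lam z = lam • (z : E) - T z := rfl

lemma mem_kerPow_succ {T : E →ₗ.[ℂ] E} {lam : ℂ} {n : ℕ} {z : E} :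
    z ∈ kerPow T lam (n + 1) ↔ ∃ h : z ∈ T.domain, shifted T lam ⟨z, h⟩ ∈ kerPow T lam n := by
  constructor
  · rintro ⟨y, hy, rfl⟩
    exact ⟨y.2, hy⟩
  · rintro ⟨h, hz⟩
    exact ⟨⟨z, h⟩, hz, rfl⟩

lemma kerPow_le_succ (T : E →ₗ.[ℂ] E) (lam : ℂ) (n : ℕ) :
    kerPow T lam n ≤ kerPow T lam (n + 1) := by
  induction n with
  | zero => exact bot_le
  | succ n ih =>
    intro z hz
    obtain ⟨h, hz⟩ := mem_kerPow_succ.1 hz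
    exact mem_kerPow_succ.2 ⟨h, ih hz⟩

/-- Once two consecutive kernels coincide the whole chain is stationary, so the union is attained at
a finite stage. -/
lemma genEigenspace_eq_kerPow {T : E →ₗ.[ℂ] E} {lam : ℂ} {m : ℕ}
    (h : kerPow T lam (m + 1) ≤ kerPow T lam m) : genEigenspace T lam = kerPow T lam m := by
  have h1 (k : ℕ) : kerPow T lam (m + k) ≤ kerPow T lam m := by
    induction k with
    | zero => exact le_rfl
    | succ k ih =>
      intro z hz
      obtain ⟨hd, hz⟩ := mem_kerPow_succ.1 hz
      exact h (mem_kerPow_succ.2 ⟨hd, ih hz⟩)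
  refine le_antisymm (iSup_le fun n => ?_) (le_iSup (fun n => kerPow T lam n) m)
  exact (monotone_nat_of_le_succ (kerPow_le_succ T lam) (Nat.le_add_left n m)).trans (h1 n)

/-- By induction: `lam - T` maps each kernel of the chain into the previous one, and its fibres are
translates of the finite-dimensional `ker (lam - T)`. -/
lemma finiteDimensional_kerPow {T : E →ₗ.[ℂ] E} {lam : ℂ}
    (h : FiniteDimensional ℂ (LinearMap.ker (shifted T lam))) (n : ℕ) :
    FiniteDimensional ℂ (kerPow T lam n) := by
  induction n with
  | zero => exact inferInstanceAs (FiniteDimensional ℂ (⊥ : Submodule ℂ E))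
  | succ n ih =>
    have : FiniteDimensional ℂ ((kerPow T lam n).comap (shifted T lam)) := by
      set f := (shifted T lam).restrict (p := (kerPow T lam n).comap (shifted T lam))
        (q := kerPow T lam n) fun x hx => hx with hf
      have hker : FiniteDimensional ℂ (LinearMap.ker f) := by
        have hmem (x : LinearMap.ker f) : ((x : (kerPow T lam n).comap (shifted T lam)) : T.domain) ∈
            LinearMap.ker (shifted T lam) := by
          have := x.2
          rw [LinearMap.mem_ker] at this ⊢
          exact congrArg Subtype.val this
        let φ : LinearMap.ker f →ₗ[ℂ] LinearMap.ker (shifted T lam) :=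
          LinearMap.codRestrict _ ((Submodule.subtype _).comp (Submodule.subtype _)) hmem
        refine FiniteDimensional.of_injective φ fun x y hxy => ?_
        have := congrArg Subtype.val hxy
        exact Subtype.ext (Subtype.ext this)
      have : FiniteDimensional ℂ (((kerPow T lam n).comap (shifted T lam)) ⧸ LinearMap.ker f) :=
        f.quotKerEquivRange.symm.finiteDimensional
      exact Module.Finite.of_submodule_quotient (LinearMap.ker f)
    exact inferInstanceAs (FiniteDimensional ℂ
      (((kerPow T lam n).comap (shifted T lam)).map T.domain.subtype))

/-- If the resolvent has a pole of order at most `m` at `l₀` then the chain of the kernels of the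
powers of `l₀ - T` is stationary from `m` on. -/
lemma kerPow_succ_le_of_pole {T : E →ₗ.[ℂ] E} {l₀ : ℂ} {m : ℕ} {C : ℝ} {R : ℂ → E →L[ℂ] E}
    (hR : ∀ᶠ l in 𝓝[≠] l₀, IsResolventAt T l (R l) ∧ ‖R l‖ * ‖l - l₀‖ ^ m ≤ C) :
    kerPow T l₀ (m + 1) ≤ kerPow T l₀ m := by
  have key : ∀ (n : ℕ) (z : E), z ∈ kerPow T l₀ (n + 1) →
      Tendsto (fun l => (l - l₀) ^ (n + 1) • R l z) (𝓝[≠] l₀) (𝓝 0) → z ∈ kerPow T l₀ n := by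
    intro n
    -- Apply `R l` to `(l - T) z = (l - l₀) z + (l₀ - T) z`. Each step down the kernel chain
    -- therefore trades one factor `l - l₀` for one application of `l₀ - T`.
    have hrec (z : E) (h : z ∈ T.domain) : ∀ᶠ l in 𝓝[≠] l₀,
        (l - l₀) • R l z + R l (shifted T l₀ ⟨z, h⟩) = z := by
      filter_upwards [hR] with l hl
      have := hl.1.1 ⟨z, h⟩
      rw [← map_smul, ← map_add]
      convert this using 2
      simp only [shifted_apply, sub_smul]
      abel
    induction n with
    | zero =>
      intro z hz hlim
      obtain ⟨h, hz⟩ := mem_kerPow_succ.1 hz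
      have hz : shifted T l₀ ⟨z, h⟩ = 0 := hz
      have e : ∀ᶠ l in 𝓝[≠] l₀, (l - l₀) ^ (0 + 1) • R l z = z := by
        filter_upwards [hrec z h] with l hl
        rw [hz, map_zero, add_zero] at hl
        simpa using hl
      have h1 : Tendsto (fun _ : ℂ => z) (𝓝[≠] l₀) (𝓝 0) := hlim.congr' e
      exact tendsto_nhds_unique tendsto_const_nhds h1
    | succ n ih =>
      intro z hz hlim
      obtain ⟨h, hz⟩ := mem_kerPow_succ.1 hz
      refine mem_kerPow_succ.2 ⟨h, ih _ hz ?_⟩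
      have e : ∀ᶠ l in 𝓝[≠] l₀, (l - l₀) ^ (n + 1) • z - (l - l₀) ^ (n + 1 + 1) • R l z =
          (l - l₀) ^ (n + 1) • R l (shifted T l₀ ⟨z, h⟩) := by
        filter_upwards [hrec z h] with l hl
        nth_rewrite 1 [← hl]
        rw [smul_add, smul_smul, ← pow_succ, add_sub_cancel_left]
      refine Tendsto.congr' e ?_
      have h0 : Tendsto (fun l : ℂ => (l - l₀) ^ (n + 1) • z) (𝓝[≠] l₀) (𝓝 0) := by
        have : Continuous fun l : ℂ => (l - l₀) ^ (n + 1) • z := by fun_prop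
        simpa using (this.tendsto l₀).mono_left nhdsWithin_le_nhds
      simpa using h0.sub hlim
  intro z hz
  refine key m z hz (squeeze_zero_norm' (a := fun l => ‖l - l₀‖ * (C * ‖z‖)) ?_ ?_)
  · filter_upwards [hR] with l hl
    rw [norm_smul, norm_pow, pow_succ']
    calc ‖l - l₀‖ * ‖l - l₀‖ ^ m * ‖R l z‖ ≤ ‖l - l₀‖ * ‖l - l₀‖ ^ m * (‖R l‖ * ‖z‖) := by
          gcongr; exact (R l).le_opNorm z
      _ = ‖l - l₀‖ * ((‖R l‖ * ‖l - l₀‖ ^ m) * ‖z‖) := by ring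
      _ ≤ _ := by gcongr; exact hl.2
  · have : Continuous fun l : ℂ => ‖l - l₀‖ * (C * ‖z‖) := by fun_prop
    simpa using (this.tendsto l₀).mono_left nhdsWithin_le_nhds

lemma IsResolventAt.injective_shifted {T : E →ₗ.[ℂ] E} {lam : ℂ} {R : E →L[ℂ] E}
    (hR : IsResolventAt T lam R) : Function.Injective (shifted T lam) := fun x y h =>
  Subtype.ext (by rw [← hR.1 x, ← hR.1 y, h])

/-- The resolvent is an analytic function. -/
lemma analyticAt_resolvent [CompleteSpace E] {T : E →ₗ.[ℂ] E} {R : ℂ → E →L[ℂ] E} {l₀ : ℂ}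
    (hR : ∀ᶠ l in 𝓝 l₀, IsResolventAt T l (R l)) : AnalyticAt ℂ R l₀ := by
  set G : ℂ → E →L[ℂ] E := fun l => 1 + (l - l₀) • R l₀
  have hG : AnalyticAt ℂ G l₀ :=
    analyticAt_const.add ((analyticAt_id.sub analyticAt_const).smul analyticAt_const)
  have hG0 : G l₀ = (1 : (E →L[ℂ] E)ˣ) := by simp [G]
  have hGi : AnalyticAt ℂ (fun l => R l₀ * Ring.inverse (G l)) l₀ := by
    have := analyticAt_inverse (𝕜 := ℂ) (1 : (E →L[ℂ] E)ˣ)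
    rw [← hG0] at this
    exact analyticAt_const.mul (this.comp hG)
  refine hGi.congr ?_
  have e1 : ∀ᶠ l in 𝓝 l₀, IsUnit (G l) :=
    hG.continuousAt.eventually (Units.isOpen.mem_nhds (by
      change IsUnit (G l₀); rw [hG0]; exact Units.isUnit _))
  have h0 := hR.self_of_nhds
  filter_upwards [hR, e1] with l hl hu
  -- The resolvent identity; it expresses `R l` through the fixed operator `R l₀` and the inverse of
  -- `G l`, which is analytic in `l`.
  have h1 : R l * G l = R l₀ := by
    ext x
    obtain ⟨hx, hx'⟩ := h0.2 x
    have := hl.1 ⟨R l₀ x, hx⟩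
    change R l (G l x) = _
    refine Eq.trans (congrArg _ ?_) this
    simp only [G, _root_.add_apply, _root_.smul_apply, one_apply_eq_self]
    nth_rewrite 1 [← hx']
    simp only [shifted_apply, sub_smul]
    abel
  rw [← h1, mul_assoc, Ring.mul_inverse_cancel _ hu, mul_one]

end Normed

variable [InnerProductSpace ℂ E] [CompleteSpace E]

/-- A compact perturbation of an operator whose resolvent set contains the region `Ω` has no
essential spectrum in `Ω`, provided that some point of `Ω` is in the resolvent set of the
perturbed operator. -/
theorem notMem_essSpectrum_of_compact_perturbation {T₀ : E →ₗ.[ℂ] E} {K : E →L[ℂ] E}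
    (hK : IsCompactOperator K) {Ω : Set ℂ} (hΩ : IsOpen Ω) (hΩc : IsPreconnected Ω)
    {R : ℂ → E →L[ℂ] E} (hR : ∀ l ∈ Ω, IsResolventAt T₀ l (R l)) {μ : ℂ} (hμ : μ ∈ Ω)
    (hμK : ‖K.comp (R μ)‖ < 1) {l₀ : ℂ} (hl₀ : l₀ ∈ Ω) :
    l₀ ∉ essSpectrum ((K : E →ₗ[ℂ] E) +ᵥ T₀) := by
  set T : E →ₗ.[ℂ] E := (K : E →ₗ[ℂ] E) +ᵥ T₀ with hT
  set A : ℂ → E →L[ℂ] E := fun l => K.comp (R l) with hA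
  have hAan (l : ℂ) (hl : l ∈ Ω) : AnalyticAt ℂ A l := by
    have h1 : AnalyticAt ℂ R l :=
      analyticAt_resolvent (T := T₀) (by filter_upwards [hΩ.mem_nhds hl] with l' hl' using hR l' hl')
    have h2 : AnalyticAt ℂ (fun l => K * R l) l := analyticAt_const.mul h1
    exact h2
  -- The factorization `l - T = (1 - K R(l)) (l - T₀)`; on `Ω` everything reduces to the compact
  -- perturbation `1 - A l` of the identity.
  have hfac (l : ℂ) (hl : l ∈ Ω) (z : T₀.domain) :
      shifted T l z = (1 - A l) (shifted T₀ l z) := by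
    have := (hR l hl).1 z
    simp only [hA, _root_.sub_apply, one_apply_eq_self, ContinuousLinearMap.comp_apply, this]
    have e : T z = K z + T₀ z := LinearPMap.vadd_apply _ _ _
    rw [shifted_apply, shifted_apply, e]
    abel
  have hcomp (l : ℂ) : IsCompactOperator (A l) := hK.comp_clm (R l)
  have hres (l : ℂ) (hl : l ∈ Ω) (J : E →L[ℂ] E) (h1 : (1 - A l) * J = 1)
      (h2 : J * (1 - A l) = 1) : IsResolventAt T l ((R l).comp J) := by
    have h1' (x : E) : (1 - A l) (J x) = x := congrArg (fun B : E →L[ℂ] E => B x) h1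
    have h2' (x : E) : J ((1 - A l) x) = x := congrArg (fun B : E →L[ℂ] E => B x) h2
    constructor
    · intro z
      rw [hfac l hl z, ContinuousLinearMap.comp_apply, h2', (hR l hl).1 z]
    · intro w
      obtain ⟨h, hw⟩ := (hR l hl).2 (J w)
      refine ⟨h, ?_⟩
      have := hfac l hl ⟨R l (J w), h⟩
      rw [hw, h1'] at this
      exact this
  have hloc (l₁ : ℂ) (hl₁ : l₁ ∈ Ω) : ∃ (g : ℂ → ℂ) (J : ℂ → E →L[ℂ] E) (C : ℝ),
      AnalyticAt ℂ g l₁ ∧ 0 ≤ C ∧ ∀ᶠ l in 𝓝 l₁,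
        (g l ≠ 0 → IsResolventAt T l (J l) ∧ ‖J l‖ ≤ C * (1 + ‖g l‖⁻¹)) ∧
        (g l = 0 → l ∈ opSpectrum T) := by
    obtain ⟨n, p, j, hF⟩ := exists_finiteRank_norm_sub_lt (hcomp l₁) one_pos
    obtain ⟨g, J, C, hg, hC, hev⟩ := exists_analytic_determinant (hAan l₁ hl₁) hF
    have hRb : ∀ᶠ l in 𝓝 l₁, ‖R l‖ < ‖R l₁‖ + 1 := by
      have h1 : AnalyticAt ℂ R l₁ := analyticAt_resolvent (T := T₀)
        (by filter_upwards [hΩ.mem_nhds hl₁] with l' hl' using hR l' hl')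
      exact h1.continuousAt.norm.eventually (gt_mem_nhds (lt_add_one _))
    refine ⟨g, fun l => (R l).comp (J l), (‖R l₁‖ + 1) * C, hg, by positivity, ?_⟩
    filter_upwards [hev, hRb, hΩ.mem_nhds hl₁] with l hl hRl hlΩ
    refine ⟨fun h0 => ?_, fun h0 => ?_⟩
    · obtain ⟨h1, h2, h3⟩ := hl.1 h0
      refine ⟨hres l hlΩ _ h1 h2, (ContinuousLinearMap.opNorm_comp_le _ _).trans ?_⟩
      rw [mul_assoc]
      gcongr
    · obtain ⟨x, hx, hx0⟩ := hl.2 h0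
      rintro ⟨R', hR'⟩
      obtain ⟨h, hw⟩ := (hR l hlΩ).2 x
      have e := hfac l hlΩ ⟨R l x, h⟩
      rw [hw, hx0] at e
      have h3 := hR'.1 ⟨R l x, h⟩
      rw [e, map_zero] at h3
      have h4 := hfac l hlΩ ⟨R l x, h⟩
      have h5 : (⟨R l x, h⟩ : T₀.domain) = 0 := Subtype.ext h3.symm
      rw [h5, map_zero] at hw
      exact hx hw.symm
  -- The analytic alternative: near any point of `Ω` the determinant vanishes identically, and then
  -- a neighbourhood lies in the spectrum (`V`), or has at most an isolated zero (`U`). Both sets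
  -- are open and they are disjoint, so connectedness of `Ω` and the point `μ` exclude `V`.
  set U : Set ℂ := {l | l ∈ Ω ∧ ∀ᶠ l' in 𝓝[≠] l, l' ∉ opSpectrum T} with hU
  set V : Set ℂ := {l | ∀ᶠ l' in 𝓝 l, l' ∈ opSpectrum T} with hV
  have hcover (l : ℂ) (hl : l ∈ Ω) : l ∈ U ∨ l ∈ V := by
    obtain ⟨g, J, C, hg, -, hev⟩ := hloc l hl
    rcases hg.eventually_eq_zero_or_eventually_ne_zero with h | h
    · right
      filter_upwards [h, hev] with l' h1 h2 using h2.2 h1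
    · left
      refine ⟨hl, ?_⟩
      filter_upwards [h, hev.filter_mono nhdsWithin_le_nhds] with l' h1 h2 h3
      exact h3 ⟨_, (h2.1 h1).1⟩
  have hUo : IsOpen U := by
    rw [isOpen_iff_eventually]
    rintro l ⟨hl, hl'⟩
    refine (hΩ.eventually_mem hl).and ?_
    rw [← eventually_eventually_nhdsWithin, eventually_nhdsWithin_iff] at hl'
    filter_upwards [hl'] with y hy
    by_cases hyl : y = l
    · subst hyl
      rwa [← eventually_eventually_nhdsWithin, eventually_nhdsWithin_iff]
    · have h1 := hy hyl
      have h2 : 𝓝[≠] y ≤ 𝓝[≠] l ⊔ 𝓝[≠] y := le_sup_right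
      rw [IsOpen.nhdsWithin_eq isOpen_compl_singleton hyl] at h1
      exact h1.filter_mono nhdsWithin_le_nhds
  have hVo : IsOpen V := by
    rw [isOpen_iff_eventually]
    intro l hl
    exact eventually_eventually_nhds.2 hl
  have hdisj : Disjoint U V := by
    rw [Set.disjoint_left]
    rintro l ⟨-, h1⟩ h2
    obtain ⟨l', h3, h4⟩ := (h1.and (Eventually.filter_mono nhdsWithin_le_nhds h2)).exists
    exact h3 h4
  have hμU : μ ∈ U := by
    refine (hcover μ hμ).resolve_right fun h => ?_
    have h1 : μ ∈ opSpectrum T := h.self_of_nhds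
    refine h1 ⟨_, hres μ hμ (↑(Units.oneSub (A μ) hμK)⁻¹ : E →L[ℂ] E) ?_ ?_⟩
    · have := (Units.oneSub (A μ) hμK).mul_inv
      rwa [Units.val_oneSub] at this
    · have := (Units.oneSub (A μ) hμK).inv_mul
      rwa [Units.val_oneSub] at this
  have hall : Ω ⊆ U := hΩc.subset_left_of_subset_union hUo hVo hdisj hcover ⟨μ, hμ, hμU⟩
  have hiso := (hall hl₀).2
  obtain ⟨n, p, j, hF⟩ := exists_finiteRank_norm_sub_lt (hcomp l₀) one_pos
  obtain ⟨hclosed, hfin⟩ := isClosed_range_one_sub hF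
  rintro (h | h | h)
  · refine h ?_
    have : Set.range (shifted T l₀) = Set.range (1 - A l₀ : E →L[ℂ] E) := by
      ext y
      constructor
      · rintro ⟨z, rfl⟩
        exact ⟨_, (hfac l₀ hl₀ z).symm⟩
      · rintro ⟨x, rfl⟩
        obtain ⟨h, hw⟩ := (hR l₀ hl₀).2 x
        exact ⟨⟨R l₀ x, h⟩, (hfac l₀ hl₀ ⟨R l₀ x, h⟩).trans (congrArg _ hw)⟩
    rw [this]
    exact hclosed
  · rw [accPt_iff_frequently] at h
    rw [eventually_nhdsWithin_iff] at hiso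
    obtain ⟨l, h1, h2⟩ := (h.and_eventually hiso).exists
    exact h2 h1.1 h1.2
  · refine h ?_
    obtain ⟨g, J, C, hg, hC, hev⟩ := hloc l₀ hl₀
    have hg0 : ¬ ∀ᶠ l in 𝓝 l₀, g l = 0 := by
      intro h0
      have : ∀ᶠ l in 𝓝 l₀, l ∈ opSpectrum T := by
        filter_upwards [h0, hev] with l h1 h2 using h2.2 h1
      exact Set.disjoint_left.1 hdisj (hall hl₀) this
    -- The order `m` of the zero of the determinant bounds the order of the pole of the resolvent,
    -- which makes the kernel chain stationary from `m` on. The constant below comes from `g = (l -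
    -- l₀)^m q` and `‖q l‖ > ‖q l₀‖ / 2` near `l₀`.
    obtain ⟨m, q, hq, hq0, hgq⟩ := hg.exists_eventuallyEq_pow_smul_nonzero_iff.2 hg0
    have hstat : kerPow T l₀ (m + 1) ≤ kerPow T l₀ m := by
      refine kerPow_succ_le_of_pole (R := J) (C := C * (1 + 2 * ‖q l₀‖⁻¹)) ?_
      have hqb : ∀ᶠ l in 𝓝 l₀, ‖q l₀‖ / 2 < ‖q l‖ :=
        hq.continuousAt.norm.eventually (lt_mem_nhds (half_lt_self (norm_pos_iff.2 hq0)))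
      have hsm : ∀ᶠ l in 𝓝 l₀, ‖l - l₀‖ < 1 := by
        filter_upwards [Metric.ball_mem_nhds l₀ one_pos] with l hl
        rwa [Metric.mem_ball, dist_eq_norm] at hl
      filter_upwards [(hev.and (hgq.and (hqb.and hsm))).filter_mono nhdsWithin_le_nhds,
        self_mem_nhdsWithin] with l ⟨h1, h2, h3, h4⟩ h5
      have hq0' : 0 < ‖q l₀‖ := norm_pos_iff.2 hq0
      have hql : 0 < ‖q l‖ := by linarith
      have hll : 0 < ‖l - l₀‖ := norm_pos_iff.2 (sub_ne_zero.2 h5)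
      have hgl : g l ≠ 0 := by
        rw [h2]
        exact smul_ne_zero (pow_ne_zero _ (norm_pos_iff.1 hll)) (norm_pos_iff.1 hql)
      obtain ⟨h6, h7⟩ := h1.1 hgl
      refine ⟨h6, ?_⟩
      have e : ‖g l‖ = ‖l - l₀‖ ^ m * ‖q l‖ := by rw [h2, norm_smul, norm_pow]
      have hp : ‖l - l₀‖ ^ m ≤ 1 := pow_le_one₀ (norm_nonneg _) h4.le
      have hp0 : 0 < ‖l - l₀‖ ^ m := by positivity
      calc ‖J l‖ * ‖l - l₀‖ ^ m ≤ C * (1 + ‖g l‖⁻¹) * ‖l - l₀‖ ^ m := by gcongr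
        _ = C * (‖l - l₀‖ ^ m + ‖q l‖⁻¹) := by rw [e]; field_simp
        _ ≤ C * (1 + 2 * ‖q l₀‖⁻¹) := by
            gcongr
            rw [← div_eq_mul_inv, inv_le_comm₀ hql (by positivity), inv_div]
            exact h3.le
    rw [genEigenspace_eq_kerPow hstat]
    refine finiteDimensional_kerPow ?_ m
    have hmem (z : LinearMap.ker (shifted T l₀)) : shifted T₀ l₀ (z : T₀.domain) ∈
        LinearMap.ker ((1 - A l₀ : E →L[ℂ] E) : E →ₗ[ℂ] E) := by
      have h1 := z.2
      rw [LinearMap.mem_ker] at h1 ⊢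
      have h2 := hfac l₀ hl₀ z
      exact h2.symm.trans h1
    let φ : LinearMap.ker (shifted T l₀) →ₗ[ℂ]
        LinearMap.ker ((1 - A l₀ : E →L[ℂ] E) : E →ₗ[ℂ] E) :=
      LinearMap.codRestrict _ ((shifted T₀ l₀).comp (Submodule.subtype _)) hmem
    refine FiniteDimensional.of_injective φ fun x y hxy => ?_
    have := congrArg Subtype.val hxy
    exact Subtype.ext ((hR l₀ hl₀).injective_shifted this)

end EssentialSpectrum

end BenneyLuke

namespace BenneyLuke

/-! ### Calculus of weak derivatives. -/

section WeakDerivatives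

/-! ### Test functions -/

lemma IsTest.sub {φ ψ : ℝ → ℝ} (hφ : IsTest φ) (hψ : IsTest ψ) : IsTest fun x => φ x - ψ x :=
  ⟨hφ.1.sub hψ.1, hφ.2.sub hψ.2⟩

lemma IsTest.smooth_mul {φ e : ℝ → ℝ} (he : ContDiff ℝ ∞ e) (hφ : IsTest φ) :
    IsTest fun x => e x * φ x :=
  ⟨he.mul hφ.1, hφ.2.mul_left (f := e)⟩

lemma IsTest.const_mul {φ : ℝ → ℝ} (k : ℝ) (hφ : IsTest φ) : IsTest fun x => k * φ x :=
  hφ.smooth_mul contDiff_const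

lemma IsTest.hasDerivAt {φ : ℝ → ℝ} (hφ : IsTest φ) (x : ℝ) : HasDerivAt φ (_root_.deriv φ x) x :=
  (hφ.1.differentiable (by simp) x).hasDerivAt

lemma IsTest.comp_sub {φ : ℝ → ℝ} (hφ : IsTest φ) (n : ℝ) : IsTest fun x => φ (x - n) := by
  refine ⟨hφ.1.comp (contDiff_id.sub contDiff_const), ?_⟩
  exact hφ.2.comp_homeomorph (Homeomorph.subRight n)

lemma IsTest.integrable {φ : ℝ → ℝ} (hφ : IsTest φ) : Integrable φ :=
  hφ.continuous.integrable_of_hasCompactSupport hφ.2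

lemma IsTest.integrable_smul {φ : ℝ → ℝ} (hφ : IsTest φ) {f : ℝ → ℂ} (hf : LocallyIntegrable f) :
    Integrable fun x => φ x • f x :=
  hf.integrable_smul_left_of_hasCompactSupport hφ.continuous hφ.2

lemma exists_isTest_nonneg : ∃ φ : ℝ → ℝ, IsTest φ ∧ (∀ x, 0 ≤ φ x) ∧ ∫ x, φ x = 1 := by
  let b : ContDiffBump (0 : ℝ) := ⟨1, 2, one_pos, one_lt_two⟩
  refine ⟨b.normed volume, ⟨b.contDiff_normed, b.hasCompactSupport_normed⟩,
    fun x => b.nonneg_normed x, b.integral_normed⟩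

/-- A test function of zero mean is the derivative of a test function. -/
lemma IsTest.exists_primitive {φ : ℝ → ℝ} (hφ : IsTest φ) (h0 : ∫ x, φ x = 0) :
    ∃ ψ, IsTest ψ ∧ _root_.deriv ψ = φ := by
  obtain ⟨N, hN⟩ := hφ.2.isCompact.isBounded.subset_closedBall (0 : ℝ)
  have hz (x : ℝ) (hx : φ x ≠ 0) : |x| < |N| + 1 := by
    have := hN (subset_tsupport φ hx)
    rw [Metric.mem_closedBall, Real.dist_eq, sub_zero] at this
    linarith [le_abs_self N]
  set ψ : ℝ → ℝ := fun x => ∫ t in (-(|N| + 1))..x, φ t with hψ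
  have hd (x : ℝ) : HasDerivAt ψ (φ x) x :=
    intervalIntegral.integral_hasDerivAt_right (hφ.continuous.intervalIntegrable _ _)
      (hφ.continuous.stronglyMeasurableAtFilter _ _) hφ.continuous.continuousAt
  have hder : _root_.deriv ψ = φ := funext fun x => (hd x).deriv
  refine ⟨ψ, ⟨?_, ?_⟩, hder⟩
  · rw [contDiff_infty_iff_deriv, hder]
    exact ⟨fun x => (hd x).differentiableAt, hφ.1⟩
  · refine HasCompactSupport.intro (isCompact_Icc (a := -(|N| + 1)) (b := |N| + 1))
      fun x hx => ?_
    rw [Set.mem_Icc, not_and_or, not_le, not_le] at hx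
    rcases hx with hx | hx
    · simp only [hψ]
      rw [intervalIntegral.integral_symm, neg_eq_zero]
      refine intervalIntegral.integral_zero_ae (Eventually.of_forall fun t ht => ?_)
      rw [Set.uIoc_of_le hx.le] at ht
      by_contra hcon
      linarith [(abs_lt.1 (hz t hcon)).1, ht.2]
    · simp only [hψ]
      rw [intervalIntegral.integral_eq_integral_of_support_subset, h0]
      intro t ht
      have := abs_lt.1 (hz t ht)
      exact ⟨this.1, by linarith [this.2]⟩

/-- If `(F' - G)' = 0` in the sense of distributions then `F' = G + C`. -/
lemma exists_hasWeakDeriv_add_const {F G : ℝ → ℂ} (hF : LocallyIntegrable F)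
    (hG : LocallyIntegrable G)
    (h : ∀ φ, IsTest φ → (∫ x, deriv (deriv φ) x • F x) + ∫ x, deriv φ x • G x = 0) :
    ∃ C : ℂ, HasWeakDeriv F fun x => G x + C := by
  obtain ⟨φ₀, h₀, -, h₁⟩ := exists_isTest_nonneg
  set C : ℂ := -((∫ x, deriv φ₀ x • F x) + ∫ x, φ₀ x • G x) with hC
  refine ⟨C, hF, hG.add (continuous_const.locallyIntegrable), fun φ hφ => ?_⟩
  -- Subtracting `(∫ φ) φ₀` makes the mean zero, so that the difference is the derivative of a test
  -- function and the hypothesis applies; `C` collects the contribution of `φ₀`.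
  have hη := hφ.sub (h₀.const_mul (∫ x, φ x))
  obtain ⟨ψ, hψ, hψd⟩ := hη.exists_primitive (by
    rw [integral_sub hφ.integrable (h₀.const_mul _).integrable, integral_const_mul, h₁, mul_one,
      sub_self])
  have key := h ψ hψ
  rw [hψd] at key
  have hd : deriv (fun x => φ x - (∫ x, φ x) * φ₀ x) =
      fun x => deriv φ x - (∫ x, φ x) * deriv φ₀ x := by
    funext x
    exact ((hφ.hasDerivAt x).sub ((h₀.hasDerivAt x).const_mul _)).deriv
  rw [hd] at key
  simp only [sub_smul, mul_smul] at key
  have i1 : Integrable fun x => (∫ x, φ x) • deriv φ₀ x • F x :=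
    (h₀.deriv.integrable_smul hF).smul (∫ x, φ x)
  have i2 : Integrable fun x => (∫ x, φ x) • φ₀ x • G x :=
    (h₀.integrable_smul hG).smul (∫ x, φ x)
  rw [integral_sub (hφ.deriv.integrable_smul hF) i1, integral_sub (hφ.integrable_smul hG) i2,
    integral_smul, integral_smul] at key
  have e : ∫ x, φ x • (G x + C) = (∫ x, φ x • G x) + (∫ x, φ x) • C := by
    simp only [smul_add]
    rw [integral_add (hφ.integrable_smul hG) (hφ.integrable.smul_const C), integral_smul_const]
  rw [e, hC]
  simp only [Complex.real_smul] at key ⊢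
  linear_combination key

lemma HasWeakDeriv.unique {f g g' : ℝ → ℂ} (h : HasWeakDeriv f g) (h' : HasWeakDeriv f g') :
    g =ᵐ[volume] g' :=
  ae_eq_of_integral_contDiff_smul_eq h.2.1 h'.2.1 fun φ h1 h2 => by
    have e1 := h.2.2 φ ⟨h1, h2⟩
    have e2 := h'.2.2 φ ⟨h1, h2⟩
    rw [e1] at e2
    exact neg_injective e2

lemma hasWeakDeriv_congr {f f' g g' : ℝ → ℂ} (hf : f =ᵐ[volume] f') (hg : g =ᵐ[volume] g')
    (h : HasWeakDeriv f g) : HasWeakDeriv f' g' := by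
  refine ⟨h.1.congr hf, h.2.1.congr hg, fun φ hφ => ?_⟩
  have e1 : ∫ x, deriv φ x • f x = ∫ x, deriv φ x • f' x :=
    integral_congr_ae (hf.mono fun x hx => by simp only [hx])
  have e2 : ∫ x, φ x • g x = ∫ x, φ x • g' x :=
    integral_congr_ae (hg.mono fun x hx => by simp only [hx])
  rw [← e1, ← e2]
  exact h.2.2 φ hφ

lemma HasWeakDeriv.add {f g f' g' : ℝ → ℂ} (h : HasWeakDeriv f g) (h' : HasWeakDeriv f' g') :
    HasWeakDeriv (fun x => f x + f' x) fun x => g x + g' x := by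
  refine ⟨h.1.add h'.1, h.2.1.add h'.2.1, fun φ hφ => ?_⟩
  simp only [smul_add]
  rw [integral_add (hφ.deriv.integrable_smul h.1) (hφ.deriv.integrable_smul h'.1),
    integral_add (hφ.integrable_smul h.2.1) (hφ.integrable_smul h'.2.1), h.2.2 φ hφ,
    h'.2.2 φ hφ, neg_add]

lemma HasWeakDeriv.const_mul {f g : ℝ → ℂ} (k : ℂ) (h : HasWeakDeriv f g) :
    HasWeakDeriv (fun x => k * f x) fun x => k * g x := by
  refine ⟨h.1.smul k, h.2.1.smul k, fun φ hφ => ?_⟩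
  have e (f : ℝ → ℂ) (ψ : ℝ → ℝ) : ∫ x, ψ x • (k * f x) = k * ∫ x, ψ x • f x := by
    rw [← integral_const_mul]
    simp only [Complex.real_smul]
    congr 1
    funext x
    ring
  rw [e, e, h.2.2 φ hφ, mul_neg]

lemma HasWeakDeriv.sub {f g f' g' : ℝ → ℂ} (h : HasWeakDeriv f g) (h' : HasWeakDeriv f' g') :
    HasWeakDeriv (fun x => f x - f' x) fun x => g x - g' x := by
  have := h.add (h'.const_mul (-1))
  simpa only [neg_mul, one_mul, ← sub_eq_add_neg] using this

lemma locallyIntegrable_continuous_smul {e : ℝ → ℝ} (he : Continuous e) {f : ℝ → ℂ}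
    (hf : LocallyIntegrable f) : LocallyIntegrable fun x => e x • f x := by
  rw [locallyIntegrable_iff] at hf ⊢
  exact fun K hK => (hf K hK).continuousOn_smul he.continuousOn hK

/-- Product rule for a weakly differentiable function and a smooth function. -/
lemma HasWeakDeriv.smooth_smul {f g : ℝ → ℂ} {e : ℝ → ℝ} (he : ContDiff ℝ ∞ e)
    (h : HasWeakDeriv f g) :
    HasWeakDeriv (fun x => e x • f x) fun x => e x • g x + deriv e x • f x := by
  have hd := (contDiff_infty_iff_deriv.1 he).2
  have hi1 := locallyIntegrable_continuous_smul he.continuous h.2.1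
  have hi2 := locallyIntegrable_continuous_smul hd.continuous h.1
  refine ⟨locallyIntegrable_continuous_smul he.continuous h.1, hi1.add hi2, fun φ hφ => ?_⟩
  have key := h.2.2 _ (hφ.smooth_mul he)
  have hder : deriv (fun x => e x * φ x) = fun x => deriv e x * φ x + e x * deriv φ x := by
    funext x
    exact (((contDiff_infty_iff_deriv.1 he).1 x).hasDerivAt.mul (hφ.hasDerivAt x)).deriv
  rw [hder] at key
  have e1 : ∫ x, (deriv e x * φ x + e x * deriv φ x) • f x =
      (∫ x, φ x • (deriv e x • f x)) + ∫ x, deriv φ x • (e x • f x) := by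
    rw [← integral_add (hφ.integrable_smul hi2) (hφ.deriv.integrable_smul
      (locallyIntegrable_continuous_smul he.continuous h.1))]
    congr 1
    funext x
    rw [add_smul, smul_smul, smul_smul, mul_comm (e x), mul_comm (deriv e x)]
  have e2 : ∫ x, φ x • (e x • g x + deriv e x • f x) =
      (∫ x, (e x * φ x) • g x) + ∫ x, φ x • (deriv e x • f x) := by
    rw [← integral_add ((hφ.smooth_mul he).integrable_smul h.2.1) (hφ.integrable_smul hi2)]
    congr 1
    funext x
    rw [smul_add, smul_smul, mul_comm (e x)]
  rw [e2]
  rw [e1] at key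
  linear_combination key

/-- A function with vanishing weak derivative is constant. -/
lemma HasWeakDeriv.ae_eq_const {f : ℝ → ℂ} (h : HasWeakDeriv f fun _ => 0) :
    ∃ C : ℂ, f =ᵐ[volume] fun _ => C := by
  -- With `F = 0` the conclusion says that `f + C` is the weak derivative of zero, so `f = -C`.
  obtain ⟨C, hC⟩ := exists_hasWeakDeriv_add_const (F := fun _ => 0) (G := f)
    continuous_const.locallyIntegrable h.1 fun φ hφ => by
      rw [h.2.2 φ hφ]
      simp
  have h0 : HasWeakDeriv (fun _ => (0 : ℂ)) fun _ => 0 :=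
    ⟨continuous_const.locallyIntegrable, continuous_const.locallyIntegrable, by simp⟩
  refine ⟨-C, (hC.unique h0).mono fun x hx => ?_⟩
  exact eq_neg_of_add_eq_zero_left hx

/-- The only solutions of `f' = s f` are the multiples of `e^{sx}`. -/
lemma HasWeakDeriv.ae_eq_exp {f : ℝ → ℂ} {s : ℝ} (h : HasWeakDeriv f fun x => (s : ℂ) * f x) :
    ∃ C : ℂ, f =ᵐ[volume] fun x => Real.exp (s * x) • C := by
  have he : ContDiff ℝ ∞ fun x : ℝ => Real.exp (-s * x) := by fun_prop
  have hd (x : ℝ) : deriv (fun x : ℝ => Real.exp (-s * x)) x = -s * Real.exp (-s * x) := by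
    have := ((hasDerivAt_id x).const_mul (-s)).exp.deriv
    simpa [mul_comm] using this
  have h1 := h.smooth_smul he
  have h2 : HasWeakDeriv (fun x => Real.exp (-s * x) • f x) fun _ => 0 := by
    refine hasWeakDeriv_congr EventuallyEq.rfl (Eventually.of_forall fun x => ?_) h1
    simp only [hd, Complex.real_smul]
    push_cast
    ring
  obtain ⟨C, hC⟩ := h2.ae_eq_const
  refine ⟨C, hC.mono fun x hx => ?_⟩
  simp only at hx ⊢
  rw [← hx, smul_smul, ← Real.exp_add]
  simp

/-- A classical derivative is a weak derivative. -/
lemma hasWeakDeriv_of_hasDerivAt {f g : ℝ → ℂ} (h : ∀ x, HasDerivAt f (g x) x)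
    (hg : Continuous g) : HasWeakDeriv f g := by
  have hf : Continuous f := continuous_iff_continuousAt.2 fun x => (h x).continuousAt
  refine ⟨hf.locallyIntegrable, hg.locallyIntegrable, fun φ hφ => ?_⟩
  have key : ∫ x, (φ x • g x + deriv φ x • f x) = 0 := by
    refine integral_eq_zero_of_hasDerivAt_of_integrable (f := fun x => φ x • f x)
      (fun x => (hφ.hasDerivAt x).smul (h x)) ?_ ?_
    · exact (hφ.integrable_smul hg.locallyIntegrable).add
        (hφ.deriv.integrable_smul hf.locallyIntegrable)
    · exact hφ.integrable_smul hf.locallyIntegrable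
  rw [integral_add (hφ.integrable_smul hg.locallyIntegrable)
    (hφ.deriv.integrable_smul hf.locallyIntegrable)] at key
  linear_combination key

end WeakDerivatives

end BenneyLuke

namespace BenneyLuke

/-! ### Multiplication operators on `L²`. -/

section Multiplication

variable {X : Type*} [MeasurableSpace X]

/-- Bounded measurable functions. -/
def IsBddMeas (m : X → ℂ) : Prop := Measurable m ∧ ∃ C, ∀ x, ‖m x‖ ≤ C

lemma IsBddMeas.mul {m n : X → ℂ} (hm : IsBddMeas m) (hn : IsBddMeas n) :
    IsBddMeas fun x => m x * n x := by
  obtain ⟨h1, C, hC⟩ := hm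
  obtain ⟨h2, D, hD⟩ := hn
  refine ⟨h1.mul h2, C * D, fun x => ?_⟩
  rw [norm_mul]
  exact mul_le_mul (hC x) (hD x) (norm_nonneg _) ((norm_nonneg _).trans (hC x))

lemma IsBddMeas.add {m n : X → ℂ} (hm : IsBddMeas m) (hn : IsBddMeas n) :
    IsBddMeas fun x => m x + n x := by
  obtain ⟨h1, C, hC⟩ := hm
  obtain ⟨h2, D, hD⟩ := hn
  exact ⟨h1.add h2, C + D, fun x => (norm_add_le _ _).trans (add_le_add (hC x) (hD x))⟩

lemma IsBddMeas.const (k : ℂ) : IsBddMeas fun _ : X => k :=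
  ⟨measurable_const, ‖k‖, fun _ => le_rfl⟩

lemma IsBddMeas.const_mul {m : X → ℂ} (k : ℂ) (hm : IsBddMeas m) : IsBddMeas fun x => k * m x :=
  (IsBddMeas.const k).mul hm

variable (μ : Measure X)

lemma memLp_mul {m : X → ℂ} (hm : IsBddMeas m) {f : X → ℂ} (hf : MemLp f 2 μ) :
    MemLp (fun x => m x * f x) 2 μ := by
  obtain ⟨h1, C, hC⟩ := hm
  refine hf.of_le_mul (c := C) (h1.aestronglyMeasurable.mul hf.1) (Eventually.of_forall fun x => ?_)
  rw [norm_mul]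
  gcongr
  exact hC x

lemma norm_toLp_mul_le {m : X → ℂ} (hm : IsBddMeas m) {C : ℝ} (hC : ∀ x, ‖m x‖ ≤ C)
    (f : Lp ℂ 2 μ) : ‖(memLp_mul μ hm (Lp.memLp f)).toLp‖ ≤ C * ‖f‖ := by
  refine Lp.norm_le_mul_norm_of_ae_le_mul ?_
  filter_upwards [(memLp_mul μ hm (Lp.memLp f)).coeFn_toLp] with x hx
  rw [hx, norm_mul]
  gcongr
  exact hC x

open Classical in
/-- The operator of multiplication by a bounded measurable function on `L²` (zero for other
functions). -/
def mulOp (m : X → ℂ) : Lp ℂ 2 μ →L[ℂ] Lp ℂ 2 μ :=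
  if hm : IsBddMeas m then
    LinearMap.mkContinuous
      { toFun := fun f => (memLp_mul μ hm (Lp.memLp f)).toLp
        map_add' := fun f g => by
          refine Lp.ext ?_
          filter_upwards [(memLp_mul μ hm (Lp.memLp (f + g))).coeFn_toLp, Lp.coeFn_add f g,
            Lp.coeFn_add ((memLp_mul μ hm (Lp.memLp f)).toLp) ((memLp_mul μ hm (Lp.memLp g)).toLp),
            (memLp_mul μ hm (Lp.memLp f)).coeFn_toLp,
            (memLp_mul μ hm (Lp.memLp g)).coeFn_toLp] with x h1 h2 h3 h4 h5
          rw [h1, h2, h3, Pi.add_apply, Pi.add_apply, h4, h5, mul_add]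
        map_smul' := fun k f => by
          refine Lp.ext ?_
          filter_upwards [(memLp_mul μ hm (Lp.memLp (k • f))).coeFn_toLp, Lp.coeFn_smul k f,
            Lp.coeFn_smul k ((memLp_mul μ hm (Lp.memLp f)).toLp),
            (memLp_mul μ hm (Lp.memLp f)).coeFn_toLp] with x h1 h2 h3 h4
          rw [h1, h2, RingHom.id_apply, h3, Pi.smul_apply, Pi.smul_apply, h4, smul_eq_mul,
            smul_eq_mul]
          ring }
      hm.2.choose fun f => norm_toLp_mul_le μ hm hm.2.choose_spec f
  else 0

lemma mulOp_coe {m : X → ℂ} (hm : IsBddMeas m) (f : Lp ℂ 2 μ) :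
    mulOp μ m f =ᵐ[μ] fun x => m x * f x := by
  rw [mulOp, dif_pos hm]
  exact (memLp_mul μ hm (Lp.memLp f)).coeFn_toLp

lemma norm_mulOp_le {m : X → ℂ} (hm : Measurable m) {C : ℝ} (hC0 : 0 ≤ C) (hC : ∀ x, ‖m x‖ ≤ C) :
    ‖mulOp μ m‖ ≤ C := by
  refine ContinuousLinearMap.opNorm_le_bound _ hC0 fun f => ?_
  rw [mulOp, dif_pos ⟨hm, C, hC⟩]
  exact norm_toLp_mul_le μ ⟨hm, C, hC⟩ hC f

lemma mulOp_apply_eq_iff {m : X → ℂ} (hm : IsBddMeas m) (f g : Lp ℂ 2 μ) :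
    mulOp μ m f = g ↔ ∀ᵐ x ∂μ, g x = m x * f x := by
  constructor
  · rintro rfl
    exact mulOp_coe μ hm f
  · intro h
    refine Lp.ext ?_
    filter_upwards [mulOp_coe μ hm f, h] with x h1 h2
    rw [h1, h2]

lemma mulOp_mulOp {m n : X → ℂ} (hm : IsBddMeas m) (hn : IsBddMeas n) (f : Lp ℂ 2 μ) :
    mulOp μ m (mulOp μ n f) = mulOp μ (fun x => m x * n x) f := by
  rw [mulOp_apply_eq_iff μ hm]
  filter_upwards [mulOp_coe μ hn f, mulOp_coe μ (hm.mul hn) f] with x h1 h2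
  rw [h1, h2, mul_assoc]

lemma mulOp_one (f : Lp ℂ 2 μ) : mulOp μ (fun _ => 1) f = f := by
  rw [mulOp_apply_eq_iff μ (IsBddMeas.const 1)]
  simp

/-- Strong continuity of multiplication operators under bounded pointwise convergence. -/
lemma tendsto_mulOp_of_bounded {ι : Type*} {l : Filter ι} [l.IsCountablyGenerated]
    {m : ι → X → ℂ} {m₀ : X → ℂ} {C : ℝ} (hm : ∀ i, Measurable (m i)) (hm₀ : Measurable m₀)
    (hC : ∀ᶠ i in l, ∀ x, ‖m i x‖ ≤ C) (hC₀ : ∀ x, ‖m₀ x‖ ≤ C)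
    (hlim : ∀ x, Tendsto (fun i => m i x) l (𝓝 (m₀ x))) (f : Lp ℂ 2 μ) {g : ι → Lp ℂ 2 μ}
    {g₀ : Lp ℂ 2 μ} (hg : ∀ᶠ i in l, ∀ᵐ x ∂μ, g i x = m i x * f x)
    (hg₀ : ∀ᵐ x ∂μ, g₀ x = m₀ x * f x) : Tendsto g l (𝓝 g₀) := by
  rw [tendsto_iff_norm_sub_tendsto_zero]
  have hnorm (h : Lp ℂ 2 μ) : ‖h‖ = √(∫ x, ‖h x‖ ^ 2 ∂μ) := by
    rw [norm_eq_sqrt_re_inner (𝕜 := ℂ) h, L2.inner_def]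
    congr 1
    have : (fun x => inner ℂ (h x) (h x)) = fun x => ((‖h x‖ ^ 2 : ℝ) : ℂ) := by
      funext x
      rw [inner_self_eq_norm_sq_to_K]
      norm_cast
    rw [this, integral_complex_ofReal]
    simp
  have key : Tendsto (fun i => ∫ x, ‖(m i x - m₀ x) * f x‖ ^ 2 ∂μ) l (𝓝 (∫ _, (0 : ℝ) ∂μ)) := by
    refine tendsto_integral_filter_of_dominated_convergence
      (fun x => (2 * C) ^ 2 * ‖f x‖ ^ 2) ?_ ?_ ?_ ?_
    · refine Eventually.of_forall fun i => ?_
      exact ((((hm i).sub hm₀).aestronglyMeasurable.mul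
        (Lp.memLp f).1).norm.aemeasurable.pow_const 2).aestronglyMeasurable
    · filter_upwards [hC] with i hi
      refine Eventually.of_forall fun x => ?_
      rw [Real.norm_of_nonneg (by positivity), norm_mul, mul_pow]
      gcongr
      calc ‖m i x - m₀ x‖ ≤ ‖m i x‖ + ‖m₀ x‖ := norm_sub_le _ _
        _ ≤ 2 * C := by linarith [hi x, hC₀ x]
    · exact ((Lp.memLp f).integrable_norm_pow (by norm_num)).const_mul _
    · refine Eventually.of_forall fun x => ?_
      have := (((hlim x).sub_const (m₀ x)).mul_const (f x)).norm.pow 2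
      simpa using this
  rw [integral_zero] at key
  have h2 := (Real.continuous_sqrt.tendsto 0).comp key
  rw [Real.sqrt_zero] at h2
  refine h2.congr' ?_
  filter_upwards [hg] with i hi
  rw [Function.comp_apply, hnorm]
  congr 1
  refine integral_congr_ae ?_
  filter_upwards [hi, hg₀, Lp.coeFn_sub (g i) g₀] with x h1 h2 h3
  rw [h3, Pi.sub_apply, h1, h2, sub_mul]

end Multiplication

/-! ### The weighted space, and the exponentials that it excludes. -/

section Weighted

/-! ### The space `L²_α` and the unweighted `L²` -/

lemma weight_ac (α : ℝ) : weight α ≪ (volume : Measure ℝ) := withDensity_absolutelyContinuous _ _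

lemma ae_weight_iff {α : ℝ} {p : ℝ → Prop} :
    (∀ᵐ x ∂weight α, p x) ↔ ∀ᵐ x ∂(volume : Measure ℝ), p x :=
  ⟨fun h => (ac_weight α).ae_le h, fun h => (weight_ac α).ae_le h⟩

lemma eLpNorm_weight (α : ℝ) (f : ℝ → ℂ) :
    eLpNorm f 2 (weight α) = eLpNorm (fun x => Real.exp (α * x) • f x) 2 volume := by
  rw [eLpNorm_eq_lintegral_rpow_enorm_toReal (by norm_num) (by norm_num),
    eLpNorm_eq_lintegral_rpow_enorm_toReal (by norm_num) (by norm_num), weight,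
    lintegral_withDensity_eq_lintegral_mul_non_measurable _ (measurable_density α)
      (Eventually.of_forall fun x => ENNReal.ofReal_lt_top)]
  congr 1
  refine lintegral_congr fun x => ?_
  rw [Pi.mul_apply, enorm_smul, ENNReal.mul_rpow_of_nonneg _ _ (by norm_num)]
  congr 1
  rw [Real.enorm_eq_ofReal (Real.exp_pos _).le, ENNReal.toReal_ofNat,
    ENNReal.ofReal_rpow_of_nonneg (Real.exp_pos _).le (by norm_num)]
  norm_num

lemma memLp_weight_iff {α : ℝ} {f : ℝ → ℂ} :
    MemLp f 2 (weight α) ↔ MemLp (fun x => Real.exp (α * x) • f x) 2 volume := by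
  unfold MemLp
  rw [eLpNorm_weight]
  refine and_congr_left fun _ => ⟨fun h => ?_, fun h => ?_⟩
  · have hc : Continuous fun x : ℝ => Real.exp (α * x) := by fun_prop
    exact hc.aestronglyMeasurable.smul (h.mono_ac (ac_weight α))
  · have hc : Continuous fun x : ℝ => Real.exp (-α * x) := by fun_prop
    have h1 : AEStronglyMeasurable (fun x => Real.exp (-α * x) • (Real.exp (α * x) • f x)) volume :=
      hc.aestronglyMeasurable.smul h
    refine AEStronglyMeasurable.mono_ac (weight_ac α) (h1.congr (Eventually.of_forall fun x => ?_))
    simp only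
    rw [smul_smul, ← Real.exp_add]
    simp

lemma memLp_exp_smul {α : ℝ} (f : L2w α) :
    MemLp (fun x => Real.exp (α * x) • f x) 2 volume := memLp_weight_iff.1 (Lp.memLp f)

lemma memLp_exp_neg_smul (α : ℝ) (g : Lp ℂ 2 (volume : Measure ℝ)) :
    MemLp (fun x => Real.exp (-α * x) • g x) 2 (weight α) := by
  rw [memLp_weight_iff]
  refine (memLp_congr_ae (Eventually.of_forall fun x => ?_)).1 (Lp.memLp g)
  rw [smul_smul, ← Real.exp_add]
  simp

/-- The isometry `f ↦ e^{αx} f` of `L²_α` onto `L²`. -/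
def toL2 (α : ℝ) : L2w α ≃ₗᵢ[ℂ] Lp ℂ 2 (volume : Measure ℝ) where
  toFun f := (memLp_exp_smul f).toLp
  invFun g := (memLp_exp_neg_smul α g).toLp
  map_add' f g := by
    refine Lp.ext ?_
    filter_upwards [(memLp_exp_smul (f + g)).coeFn_toLp, (ac_weight α).ae_le (Lp.coeFn_add f g),
      Lp.coeFn_add (memLp_exp_smul f).toLp (memLp_exp_smul g).toLp,
      (memLp_exp_smul f).coeFn_toLp, (memLp_exp_smul g).coeFn_toLp] with x h1 h2 h3 h4 h5
    rw [h1, h2, h3, Pi.add_apply, Pi.add_apply, h4, h5, smul_add]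
  map_smul' k f := by
    refine Lp.ext ?_
    filter_upwards [(memLp_exp_smul (k • f)).coeFn_toLp, (ac_weight α).ae_le (Lp.coeFn_smul k f),
      Lp.coeFn_smul k (memLp_exp_smul f).toLp, (memLp_exp_smul f).coeFn_toLp] with x h1 h2 h3 h4
    rw [h1, h2, RingHom.id_apply, h3, Pi.smul_apply, Pi.smul_apply, h4, smul_comm]
  left_inv f := by
    refine Lp.ext ?_
    filter_upwards [(memLp_exp_neg_smul α (memLp_exp_smul f).toLp).coeFn_toLp,
      (weight_ac α).ae_le (memLp_exp_smul f).coeFn_toLp] with x h1 h2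
    rw [h1, h2, smul_smul, ← Real.exp_add]
    simp
  right_inv g := by
    refine Lp.ext ?_
    filter_upwards [(memLp_exp_smul (memLp_exp_neg_smul α g).toLp).coeFn_toLp,
      (ac_weight α).ae_le (memLp_exp_neg_smul α g).coeFn_toLp] with x h1 h2
    rw [h1, h2, smul_smul, ← Real.exp_add]
    simp
  norm_map' f := by
    change ‖(memLp_exp_smul f).toLp‖ = ‖f‖
    rw [Lp.norm_toLp, Lp.norm_def, eLpNorm_weight]

lemma toL2_coe {α : ℝ} (f : L2w α) :
    toL2 α f =ᵐ[volume] fun x => Real.exp (α * x) • f x := (memLp_exp_smul f).coeFn_toLp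

lemma L2w_ext {α : ℝ} {f g : L2w α} (h : f =ᵐ[volume] g) : f = g := Lp.ext ((weight_ac α).ae_le h)

lemma coeFn_add_volume {α : ℝ} (f g : L2w α) : (f + g : L2w α) =ᵐ[volume] fun x => f x + g x :=
  (ac_weight α).ae_le (Lp.coeFn_add f g)

lemma coeFn_sub_volume {α : ℝ} (f g : L2w α) : (f - g : L2w α) =ᵐ[volume] fun x => f x - g x :=
  (ac_weight α).ae_le (Lp.coeFn_sub f g)

lemma coeFn_smul_volume {α : ℝ} (k : ℂ) (f : L2w α) :
    (k • f : L2w α) =ᵐ[volume] fun x => k * f x :=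
  (ac_weight α).ae_le (Lp.coeFn_smul k f)

lemma coeFn_zero_volume (α : ℝ) : (0 : L2w α) =ᵐ[volume] fun _ => 0 :=
  (ac_weight α).ae_le (Lp.coeFn_zero _ _ _)

/-- Translated test functions see no mass of an element of `L²` far out. -/
lemma tendsto_integral_translate {η : ℝ → ℝ} (hη : IsTest η) {F : ℝ → ℂ} (hF : MemLp F 2 volume)
    {ι : Type*} {l : Filter ι} [l.IsCountablyGenerated] {n : ι → ℝ}
    (hn : Tendsto (fun i => |n i|) l atTop) :
    Tendsto (fun i => ∫ x, η (x - n i) • F x) l (𝓝 0) := by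
  obtain ⟨D, hD⟩ := hη.2.exists_bound_of_continuous hη.continuous
  obtain ⟨N, hN⟩ := hη.2.isCompact.isBounded.subset_closedBall (0 : ℝ)
  have hD0 : 0 ≤ D := (norm_nonneg _).trans (hD 0)
  have hz (x : ℝ) (hx : N < |x|) : η x = 0 := by
    by_contra h
    have := hN (subset_tsupport η h)
    rw [Metric.mem_closedBall, Real.dist_eq, sub_zero] at this
    linarith
  have hF2 : Integrable fun x => ‖F x‖ ^ 2 := hF.integrable_norm_pow (by norm_num)
  have hsq : Tendsto (fun i => ∫ x, |η (x - n i)| * ‖F x‖ ^ 2) l (𝓝 (∫ _ : ℝ, (0 : ℝ))) := by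
    refine tendsto_integral_filter_of_dominated_convergence (fun x => D * ‖F x‖ ^ 2) ?_ ?_ ?_ ?_
    · refine Eventually.of_forall fun i => ?_
      exact (hη.continuous.comp (by fun_prop)).abs.aestronglyMeasurable.mul hF2.1
    · refine Eventually.of_forall fun i => Eventually.of_forall fun x => ?_
      rw [norm_mul, Real.norm_eq_abs, abs_abs, Real.norm_of_nonneg (by positivity)]
      gcongr
      exact hD _
    · exact hF2.const_mul D
    · refine Eventually.of_forall fun x => ?_
      refine tendsto_const_nhds.congr' ?_
      filter_upwards [hn.eventually_gt_atTop (N + |x|)] with i hi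
      rw [hz (x - n i), abs_zero, zero_mul]
      have := abs_sub_abs_le_abs_sub (n i) x
      rw [abs_sub_comm] at this
      linarith
  rw [integral_zero] at hsq
  have hloc : LocallyIntegrable F := hF.locallyIntegrable (by norm_num)
  rw [Metric.tendsto_nhds]
  intro ε hε
  set I : ℝ := ∫ x, |η x| with hI
  have hI0 : 0 ≤ I := integral_nonneg fun x => abs_nonneg _
  -- From `‖F‖ ≤ s + s⁻¹ ‖F‖²` the integral is at most `s I` plus `s⁻¹` times an integral tending to
  -- zero; this `s` makes the first term at most `ε / 2`.
  set s : ℝ := ε / (2 * (I + 1)) with hs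
  have hs0 : 0 < s := by positivity
  filter_upwards [(tendsto_order.1 (hsq.const_mul s⁻¹)).2 (ε / 2) (by simp [hε])] with i hi
  rw [dist_zero_right]
  have hint1 : Integrable fun x => |η (x - n i)| := (hη.comp_sub (n i)).integrable.abs
  have hint2 : Integrable fun x => |η (x - n i)| * ‖F x‖ ^ 2 := by
    refine (hF2.const_mul D).mono' ?_ (Eventually.of_forall fun x => ?_)
    · exact (hη.continuous.comp (by fun_prop)).abs.aestronglyMeasurable.mul hF2.1
    · rw [norm_mul, Real.norm_eq_abs, abs_abs, Real.norm_of_nonneg (by positivity)]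
      gcongr
      exact hD _
  calc ‖∫ x, η (x - n i) • F x‖ ≤ ∫ x, ‖η (x - n i) • F x‖ := norm_integral_le_integral_norm _
    _ ≤ ∫ x, (s * |η (x - n i)| + s⁻¹ * (|η (x - n i)| * ‖F x‖ ^ 2)) := by
        refine integral_mono ((hη.comp_sub (n i)).integrable_smul hloc).norm
          ((hint1.const_mul s).add (hint2.const_mul _)) fun x => ?_
        simp only
        rw [norm_smul, Real.norm_eq_abs]
        have h1 : ‖F x‖ ≤ s + s⁻¹ * ‖F x‖ ^ 2 := by
          have : 0 ≤ s⁻¹ * (s - ‖F x‖) ^ 2 := by positivity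
          have e : s⁻¹ * (s - ‖F x‖) ^ 2 = s - 2 * ‖F x‖ + s⁻¹ * ‖F x‖ ^ 2 := by
            field_simp
            ring
          linarith [norm_nonneg (F x)]
        calc _ ≤ |η (x - n i)| * (s + s⁻¹ * ‖F x‖ ^ 2) := by gcongr
          _ = _ := by ring
    _ = s * I + s⁻¹ * ∫ x, |η (x - n i)| * ‖F x‖ ^ 2 := by
        rw [integral_add (hint1.const_mul s) (hint2.const_mul _), integral_const_mul,
          integral_const_mul, integral_sub_right_eq_self (fun x => |η x|)]
    _ < ε := by
        have : s * I ≤ ε / 2 := by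
          rw [hs, div_mul_eq_mul_div, div_le_iff₀ (by positivity)]
          nlinarith
        linarith

/-- Exponentials do not decay in the `L²` sense. -/
lemma integral_translate_exp (η : ℝ → ℝ) (s n : ℝ) (C : ℂ) :
    ∫ x, η (x - n) • (Real.exp (s * x) • C) =
      Real.exp (s * n) • ((∫ x, η x * Real.exp (s * x)) • C) := by
  rw [← integral_smul_const, ← integral_smul,
    ← integral_sub_right_eq_self (fun x => Real.exp (s * n) • ((η x * Real.exp (s * x)) • C)) n]
  congr 1
  funext x
  simp only [smul_smul]
  congr 1
  have : Real.exp (s * x) = Real.exp (s * n) * Real.exp (s * (x - n)) := by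
    rw [← Real.exp_add]; ring_nf
  rw [this]
  ring

lemma integral_isTest_mul_exp_pos {η : ℝ → ℝ} (hη : IsTest η) (h0 : ∀ x, 0 ≤ η x)
    (h1 : ∫ x, η x = 1) (s : ℝ) : 0 < ∫ x, η x * Real.exp (s * x) := by
  have hc : Continuous fun x => η x * Real.exp (s * x) := hη.continuous.mul (by fun_prop)
  have hx : ∃ x, η x ≠ 0 := by
    by_contra! h
    simp [h] at h1
  obtain ⟨x, hx⟩ := hx
  exact hc.integral_pos_of_hasCompactSupport_nonneg_nonzero hη.2.mul_right
    (fun x => mul_nonneg (h0 x) (Real.exp_pos _).le) (mul_ne_zero hx (Real.exp_pos _).ne')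

/-- A combination of a growing and a decaying exponential is in `L²` only if it vanishes. -/
lemma eq_zero_of_memLp_exp {s t : ℝ} (hs : 0 ≤ s) (ht : t < 0) {C D : ℂ}
    (h : MemLp (fun x : ℝ => Real.exp (s * x) • C + Real.exp (t * x) • D) 2 volume) :
    C = 0 ∧ D = 0 := by
  obtain ⟨η, hη, hη0, hη1⟩ := exists_isTest_nonneg
  have hi (r : ℝ) (E : ℂ) (n : ℝ) : Integrable fun x => η (x - n) • (Real.exp (r * x) • E) :=
    (hη.comp_sub n).integrable_smul (Continuous.locallyIntegrable (by fun_prop))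
  have e (n : ℝ) : ∫ x, η (x - n) • (Real.exp (s * x) • C + Real.exp (t * x) • D) =
      Real.exp (s * n) • ((∫ x, η x * Real.exp (s * x)) • C) +
      Real.exp (t * n) • ((∫ x, η x * Real.exp (t * x)) • D) := by
    simp only [smul_add]
    rw [integral_add (hi _ _ _) (hi _ _ _), integral_translate_exp, integral_translate_exp]
  have p1 := integral_isTest_mul_exp_pos hη hη0 hη1 s
  have p2 := integral_isTest_mul_exp_pos hη hη0 hη1 t
  -- Test with bumps translated to `+∞`: the decaying exponential drops out, while the coefficient
  -- of `C` is at least a fixed positive number. The other constant is then handled by translating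
  -- to `-∞`.
  have hC : C = 0 := by
    have h1 := tendsto_integral_translate hη h (n := fun i : ℝ => i) tendsto_abs_atTop_atTop
    simp only [e] at h1
    have h2 : Tendsto (fun n : ℝ => Real.exp (t * n) • ((∫ x, η x * Real.exp (t * x)) • D)) atTop
        (𝓝 0) := by
      have : Tendsto (fun n : ℝ => Real.exp (t * n)) atTop (𝓝 0) :=
        Real.tendsto_exp_atBot.comp (tendsto_id.const_mul_atTop_of_neg ht)
      simpa using this.smul_const ((∫ x, η x * Real.exp (t * x)) • D)
    have h3 := h1.sub h2
    simp only [add_sub_cancel_right, sub_zero] at h3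
    have h4 : (∫ x, η x * Real.exp (s * x)) • C = 0 := by
      rw [← norm_le_zero_iff]
      refine ge_of_tendsto' (x := atTop)
        (f := fun n : ℝ => ‖Real.exp (s * |n|) • ((∫ x, η x * Real.exp (s * x)) • C)‖) ?_
        fun n => ?_
      · have := (h3.comp tendsto_abs_atTop_atTop).norm
        simpa using this
      · rw [norm_smul (Real.exp _), Real.norm_of_nonneg (Real.exp_pos _).le]
        exact le_mul_of_one_le_left (norm_nonneg _)
          (Real.one_le_exp (mul_nonneg hs (abs_nonneg n)))
    exact (smul_eq_zero.1 h4).resolve_left p1.ne'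
  refine ⟨hC, ?_⟩
  have h1 := tendsto_integral_translate hη h (n := fun i : ℝ => -|i|)
    (by simpa using tendsto_abs_atTop_atTop)
  simp only [e] at h1
  simp only [hC, smul_zero, zero_add] at h1
  have h4 : (∫ x, η x * Real.exp (t * x)) • D = 0 := by
    rw [← norm_le_zero_iff]
    have h2 := h1.norm
    rw [norm_zero] at h2
    refine ge_of_tendsto' h2 fun n => ?_
    rw [norm_smul (Real.exp _), Real.norm_of_nonneg (Real.exp_pos _).le]
    exact le_mul_of_one_le_left (norm_nonneg _)
      (Real.one_le_exp (by nlinarith [abs_nonneg n]))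
  exact (smul_eq_zero.1 h4).resolve_left p2.ne'

/-- The function `e^{αx} f` is a multiple of `e^{(s + α)x}`, which does not decay at `+∞`. The
decaying exponential in the preceding criterion is a dummy with zero coefficient. -/
lemma eq_zero_of_ae_eq_exp {α : ℝ} {f : L2w α} {s : ℝ} (hs : 0 ≤ s + α) {C : ℂ}
    (h : f =ᵐ[volume] fun x => Real.exp (s * x) • C) : f = 0 := by
  have h1 : MemLp (fun x : ℝ => Real.exp ((s + α) * x) • C + Real.exp (-1 * x) • (0 : ℂ)) 2
      volume := by
    refine (memLp_congr_ae ?_).1 (memLp_exp_smul f)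
    filter_upwards [h] with x hx
    rw [hx, smul_smul, ← Real.exp_add, smul_zero, add_zero]
    ring_nf
  have h2 := (eq_zero_of_memLp_exp hs (by norm_num) h1).1
  subst h2
  refine L2w_ext (h.trans ?_)
  filter_upwards [coeFn_zero_volume α] with x hx
  rw [hx, smul_zero]

lemma eq_zero_of_ae_eq_const {α : ℝ} (hα : 0 ≤ α) {f : L2w α} {C : ℂ}
    (h : f =ᵐ[volume] fun _ => C) : f = 0 :=
  eq_zero_of_ae_eq_exp (s := 0) (by simpa)
    (C := C) (h.trans (Eventually.of_forall fun x => by simp))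

/-- If two elements of `L²_α` satisfy `f' = g + C` weakly then `C = 0`. -/
lemma const_eq_zero_of_hasWeakDeriv {α : ℝ} (hα : 0 ≤ α) {f g : L2w α} {C : ℂ}
    (h : HasWeakDeriv f fun x => g x + C) : C = 0 := by
  obtain ⟨η, hη, hη0, hη1⟩ := exists_isTest_nonneg
  have hlim (ψ : ℝ → ℝ) (hψ : IsTest ψ) (f : L2w α) :
      Tendsto (fun n : ℝ => ∫ x, ψ (x - n) • f x) atTop (𝓝 0) := by
    -- The weight is absorbed in the test function, at the price of a factor `e^{αn}`. Since `α ≥ 0`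
    -- this factor is at least `1` for `n ≥ 0`, so the unweighted pairings also tend to zero at
    -- `+∞`.
    have h1 := tendsto_integral_translate (hψ.smooth_mul (e := fun x => Real.exp (-α * x))
      (by fun_prop)) (memLp_exp_smul f) (n := fun i : ℝ => i) tendsto_abs_atTop_atTop
    have e (n : ℝ) : ∫ x, (Real.exp (-α * (x - n)) * ψ (x - n)) • Real.exp (α * x) • f x =
        Real.exp (α * n) • ∫ x, ψ (x - n) • f x := by
      rw [← integral_smul]
      congr 1
      funext x
      simp only [smul_smul]
      congr 1
      have : Real.exp (-α * (x - n)) * Real.exp (α * x) = Real.exp (α * n) := by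
        rw [← Real.exp_add]; ring_nf
      rw [← this]
      ring
    simp only [e] at h1
    refine squeeze_zero_norm' ?_ (tendsto_zero_iff_norm_tendsto_zero.1 h1)
    filter_upwards [eventually_ge_atTop 0] with n hn
    rw [norm_smul, Real.norm_of_nonneg (Real.exp_pos _).le]
    exact le_mul_of_one_le_left (norm_nonneg _) (Real.one_le_exp (by positivity))
  have key (n : ℝ) : C = -(∫ x, deriv η (x - n) • f x) - ∫ x, η (x - n) • g x := by
    have h1 := h.2.2 _ (hη.comp_sub n)
    have hd : deriv (fun x => η (x - n)) = fun x => deriv η (x - n) := by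
      funext x
      simpa using deriv_comp_sub_const η n x
    rw [hd] at h1
    have e : ∫ x, η (x - n) • (g x + C) = (∫ x, η (x - n) • g x) + C := by
      simp only [smul_add]
      rw [integral_add ((hη.comp_sub n).integrable_smul (locInt g))
        ((hη.comp_sub n).integrable.smul_const C), integral_smul_const,
        integral_sub_right_eq_self (fun x => η x), hη1, one_smul]
    rw [e] at h1
    rw [h1]
    ring
  have h2 := ((hlim _ hη.deriv f).neg).sub (hlim _ hη g)
  simp only [neg_zero, sub_zero] at h2
  exact tendsto_nhds_unique (tendsto_const_nhds.congr key) h2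

end Weighted

end BenneyLuke

namespace BenneyLuke

/-! ### Fourier multipliers in the weighted space. -/

section Fourier

open FourierTransform
open scoped ComplexConjugate

/-- The Fourier transform of `e^{αx} f`. -/
def ft (α : ℝ) : L2w α ≃ₗᵢ[ℂ] Lp ℂ 2 (volume : Measure ℝ) :=
  (toL2 α).trans (Lp.fourierTransformₗᵢ ℝ ℂ)

/-- The symbol of `∂` in `L²_α`. -/
def dsym (α : ℝ) (ξ : ℝ) : ℂ := 2 * Real.pi * Complex.I * ξ - α

lemma continuous_dsym (α : ℝ) : Continuous (dsym α) := by unfold dsym; fun_prop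

lemma dsym_re (α ξ : ℝ) : (dsym α ξ).re = -α := by simp [dsym]

lemma dsym_im (α ξ : ℝ) : (dsym α ξ).im = 2 * Real.pi * ξ := by simp [dsym]

/-- The pairing with a test function on the Fourier side. -/
lemma pair_eq_integral_fourier {α : ℝ} {φ : ℝ → ℝ} (hφ : IsTest φ) (f : L2w α) :
    pair φ f = ∫ ξ, ft α f ξ * conj (𝓕 (fun x : ℝ => ((Real.exp (-α * x) * φ x : ℝ) : ℂ)) ξ) := by
  have hψ : IsTest fun x => Real.exp (-α * x) * φ x := hφ.smooth_mul (by fun_prop)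
  have hsm : ContDiff ℝ ∞ fun x : ℝ => ((Real.exp (-α * x) * φ x : ℝ) : ℂ) :=
    Complex.ofRealCLM.contDiff.comp hψ.1
  have hcs : HasCompactSupport fun x : ℝ => ((Real.exp (-α * x) * φ x : ℝ) : ℂ) :=
    hψ.2.comp_left (g := fun r : ℝ => (r : ℂ)) Complex.ofReal_zero
  set S : SchwartzMap ℝ ℂ := hcs.toSchwartzMap hsm with hS
  have hSc (x : ℝ) : S x = ((Real.exp (-α * x) * φ x : ℝ) : ℂ) := rfl
  have h1 := Lp.inner_fourier_eq (S.toLp 2) (toL2 α f)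
  rw [SchwartzMap.toLp_fourier_eq, L2.inner_def, L2.inner_def] at h1
  have e1 : ∫ x, inner ℂ (S.toLp 2 volume x) (toL2 α f x) = pair φ f := by
    refine integral_congr_ae ?_
    filter_upwards [S.coeFn_toLp 2 volume, toL2_coe f] with x h2 h3
    rw [h2, h3, hSc, RCLike.inner_apply, Complex.conj_ofReal]
    simp only [Complex.real_smul]
    have : Real.exp (α * x) * Real.exp (-α * x) = 1 := by rw [← Real.exp_add]; simp
    have h4 : ((Real.exp (α * x) : ℝ) : ℂ) * ((Real.exp (-α * x) : ℝ) : ℂ) = 1 := by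
      exact_mod_cast this
    push_cast at h4 ⊢
    linear_combination (φ x * f x) * h4
  rw [← e1, ← h1]
  refine integral_congr_ae ?_
  filter_upwards [(𝓕 S).coeFn_toLp 2 volume] with ξ h2
  rw [h2, RCLike.inner_apply]
  rfl

/-- From `(e^{-αx} φ)' = e^{-αx} φ' - α e^{-αx} φ` the factor is `2πiξ + α`, which is `-conj d`: the
operators `∂` and `-∂` are dual under the unweighted pairing. -/
lemma fourier_exp_mul_deriv {α : ℝ} {φ : ℝ → ℝ} (hφ : IsTest φ) (ξ : ℝ) :
    𝓕 (fun x : ℝ => ((Real.exp (-α * x) * deriv φ x : ℝ) : ℂ)) ξ =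
      -conj (dsym α ξ) * 𝓕 (fun x : ℝ => ((Real.exp (-α * x) * φ x : ℝ) : ℂ)) ξ := by
  have he : ContDiff ℝ ∞ fun x : ℝ => Real.exp (-α * x) := by fun_prop
  have hψ : IsTest fun x => Real.exp (-α * x) * φ x := hφ.smooth_mul he
  have hd (x : ℝ) : HasDerivAt (fun x : ℝ => ((Real.exp (-α * x) * φ x : ℝ) : ℂ))
      (((Real.exp (-α * x) * deriv φ x : ℝ) : ℂ) -
        (α : ℂ) * ((Real.exp (-α * x) * φ x : ℝ) : ℂ)) x := by
    have h1 : HasDerivAt (fun x : ℝ => Real.exp (-α * x)) (Real.exp (-α * x) * -α) x := by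
      simpa using ((hasDerivAt_id x).const_mul (-α)).exp
    refine (h1.mul (hφ.hasDerivAt x)).ofReal_comp.congr_deriv ?_
    push_cast
    ring
  have hi0 : Integrable fun x : ℝ => ((Real.exp (-α * x) * φ x : ℝ) : ℂ) := hψ.integrable.ofReal
  have hi1 : Integrable fun x : ℝ => ((Real.exp (-α * x) * deriv φ x : ℝ) : ℂ) :=
    (hφ.deriv.smooth_mul he).integrable.ofReal
  have hder : deriv (fun x : ℝ => ((Real.exp (-α * x) * φ x : ℝ) : ℂ)) = fun x : ℝ =>
      ((Real.exp (-α * x) * deriv φ x : ℝ) : ℂ) -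
        (α : ℂ) * ((Real.exp (-α * x) * φ x : ℝ) : ℂ) := funext fun x => (hd x).deriv
  have key := congrFun (Real.fourier_deriv hi0 (fun x => (hd x).differentiableAt)
    (by rw [hder]; exact hi1.sub (hi0.const_mul _))) ξ
  rw [hder] at key
  have e : 𝓕 (fun x : ℝ => ((Real.exp (-α * x) * deriv φ x : ℝ) : ℂ) -
        (α : ℂ) * ((Real.exp (-α * x) * φ x : ℝ) : ℂ)) ξ =
      𝓕 (fun x : ℝ => ((Real.exp (-α * x) * deriv φ x : ℝ) : ℂ)) ξ -
        α * 𝓕 (fun x : ℝ => ((Real.exp (-α * x) * φ x : ℝ) : ℂ)) ξ := by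
    simp only [Real.fourier_eq]
    have hm {F : ℝ → ℂ} (hF : Integrable F) :
        Integrable fun v => Real.fourierChar (-inner ℝ v ξ) • F v :=
      (Real.fourierIntegral_convergent_iff ξ).2 hF
    rw [← integral_const_mul, ← integral_sub (hm hi1) ((hm hi0).const_mul _)]
    congr 1
    funext v
    rw [smul_sub, mul_smul_comm]
  rw [e] at key
  have hc : conj (dsym α ξ) = -(2 * Real.pi * Complex.I * ξ) - α := by
    have h2 : conj (2 : ℂ) = 2 := Complex.conj_ofReal 2
    simp only [dsym, map_sub, map_mul, Complex.conj_ofReal, Complex.conj_I, h2]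
    ring
  rw [hc]
  rw [smul_eq_mul] at key
  linear_combination key

/-- A Fourier-side criterion for weak derivatives in `L²_α`. -/
lemma hasWeakDeriv_of_ft {α : ℝ} {f g : L2w α} (h : ∀ᵐ ξ, ft α g ξ = dsym α ξ * ft α f ξ) :
    HasWeakDeriv f g := by
  rw [hasWeakDeriv_iff]
  intro φ hφ
  rw [pair_eq_integral_fourier hφ, pair_eq_integral_fourier hφ.deriv, ← integral_neg]
  refine integral_congr_ae ?_
  filter_upwards [h] with ξ hξ
  rw [hξ, fourier_exp_mul_deriv hφ, map_mul, map_neg, Complex.conj_conj]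
  ring

/-- The Fourier multiplier with symbol `m` in `L²_α`. -/
def fm (α : ℝ) (m : ℝ → ℂ) : L2w α →L[ℂ] L2w α :=
  ((ft α).symm.toContinuousLinearEquiv : Lp ℂ 2 (volume : Measure ℝ) →L[ℂ] L2w α).comp
    ((mulOp volume m).comp ((ft α).toContinuousLinearEquiv : L2w α →L[ℂ] _))

lemma ft_fm (α : ℝ) (m : ℝ → ℂ) (f : L2w α) : ft α (fm α m f) = mulOp volume m (ft α f) :=
  (ft α).apply_symm_apply _

lemma ft_fm_coe (α : ℝ) {m : ℝ → ℂ} (hm : IsBddMeas m) (f : L2w α) :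
    ∀ᵐ ξ, ft α (fm α m f) ξ = m ξ * ft α f ξ := by
  rw [ft_fm]
  exact mulOp_coe _ hm _

lemma ft_add_coe {α : ℝ} (f g : L2w α) : ∀ᵐ ξ, ft α (f + g) ξ = ft α f ξ + ft α g ξ := by
  rw [map_add]
  exact Lp.coeFn_add _ _

lemma ft_sub_coe {α : ℝ} (f g : L2w α) : ∀ᵐ ξ, ft α (f - g) ξ = ft α f ξ - ft α g ξ := by
  rw [map_sub]
  exact Lp.coeFn_sub _ _

lemma ft_smul_coe {α : ℝ} (k : ℂ) (f : L2w α) : ∀ᵐ ξ, ft α (k • f) ξ = k * ft α f ξ := by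
  rw [map_smul]
  exact Lp.coeFn_smul _ _

lemma ft_ext {α : ℝ} {f g : L2w α} (h : ∀ᵐ ξ, ft α f ξ = ft α g ξ) : f = g :=
  (ft α).injective (Lp.ext h)

lemma hasWeakDeriv_fm {α : ℝ} {m n : ℝ → ℂ} (hm : IsBddMeas m) (hn : IsBddMeas n)
    (h : ∀ ξ, n ξ = dsym α ξ * m ξ) (f : L2w α) : HasWeakDeriv (fm α m f) (fm α n f) := by
  refine hasWeakDeriv_of_ft ?_
  filter_upwards [ft_fm_coe α hm f, ft_fm_coe α hn f] with ξ h1 h2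
  rw [h1, h2, h ξ, mul_assoc]

lemma isBddMeas_inv {u : ℝ → ℂ} (hu : Measurable u) {ε : ℝ} (hε : 0 < ε) (h : ∀ ξ, ε ≤ ‖u ξ‖) :
    IsBddMeas fun ξ => (u ξ)⁻¹ := by
  refine ⟨hu.inv, ε⁻¹, fun ξ => ?_⟩
  rw [norm_inv]
  exact inv_anti₀ hε (h ξ)

/-- `g` is the weak derivative of `f` in `L²_α` exactly when `ĝ = d f̂`. -/
theorem hasWeakDeriv_iff_ft {α : ℝ} (hα : 0 ≤ α) (f g : L2w α) :
    HasWeakDeriv f g ↔ ∀ᵐ ξ, ft α g ξ = dsym α ξ * ft α f ξ := by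
  refine ⟨fun h => ?_, hasWeakDeriv_of_ft⟩
  have hre (ξ : ℝ) : (dsym α ξ - 1).re = -α - 1 := by rw [Complex.sub_re, dsym_re]; simp
  have hne (ξ : ℝ) : dsym α ξ - 1 ≠ 0 := fun h0 => by
    have := hre ξ
    rw [h0, Complex.zero_re] at this
    linarith
  -- The operator `∂ - 1` is boundedly invertible because `Re (d - 1) ≤ -1`. With `p = (∂ - 1)⁻¹ (g
  -- - f)`, the difference `f - p` solves `u' = u`, so it is a multiple of `e^x` in `L²_α`, hence
  -- zero; `f = p` is the claim.
  have hm : IsBddMeas fun ξ => (dsym α ξ - 1)⁻¹ := by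
    refine isBddMeas_inv ((continuous_dsym α).measurable.sub_const 1) one_pos fun ξ => ?_
    refine le_trans ?_ (Complex.abs_re_le_norm _)
    rw [hre, abs_of_neg (by linarith)]
    linarith
  have hn : IsBddMeas fun ξ => (dsym α ξ - 1)⁻¹ + 1 := hm.add (IsBddMeas.const 1)
  have hw := hasWeakDeriv_fm hm hn (fun ξ => by have := hne ξ; field_simp; ring) (g - f)
  set p := fm α (fun ξ => (dsym α ξ - 1)⁻¹) (g - f) with hp
  have hp' : fm α (fun ξ => (dsym α ξ - 1)⁻¹ + 1) (g - f) = p + (g - f) := by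
    refine ft_ext ?_
    filter_upwards [ft_fm_coe α hm (g - f), ft_fm_coe α hn (g - f), ft_add_coe p (g - f)]
      with ξ h1 h2 h3
    rw [h2, h3, h1]
    ring
  rw [hp'] at hw
  have hu : HasWeakDeriv (f - p : L2w α) fun x => ((1 : ℝ) : ℂ) * (f - p : L2w α) x := by
    refine hasWeakDeriv_congr ?_ ?_ (h.sub hw)
    · filter_upwards [coeFn_sub_volume f p] with x hx using hx.symm
    · filter_upwards [coeFn_sub_volume f p, coeFn_add_volume p (g - f), coeFn_sub_volume g f]
        with x h1 h2 h3
      rw [h1, h2, h3]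
      push_cast
      ring
  obtain ⟨C, hC⟩ := hu.ae_eq_exp
  have h0 : f - p = 0 := eq_zero_of_ae_eq_exp (by linarith) hC
  have hfp : f = p := sub_eq_zero.1 h0
  filter_upwards [ft_fm_coe α hm (g - f), ft_sub_coe g f] with ξ h1 h2
  rw [← hp, ← hfp, h2] at h1
  have := hne ξ
  rw [inv_mul_eq_div, eq_div_iff this] at h1
  linear_combination -h1

/-! ### Inverting `1 - b ∂²` -/

/-- The symbol of `1 - b ∂²` in `L²_α`. -/
def bsym (b α : ℝ) (ξ : ℝ) : ℂ := 1 - b * dsym α ξ ^ 2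

lemma continuous_bsym (b α : ℝ) : Continuous (bsym b α) := by
  have := continuous_dsym α
  unfold bsym
  fun_prop

lemma bsym_re (b α ξ : ℝ) :
    (bsym b α ξ).re = 1 - b * α ^ 2 + b * (2 * Real.pi * ξ) ^ 2 := by
  simp only [bsym, Complex.sub_re, Complex.one_re, Complex.re_ofReal_mul]
  rw [pow_two, Complex.mul_re, dsym_re, dsym_im]
  ring

lemma bsym_im (b α ξ : ℝ) : (bsym b α ξ).im = 2 * b * α * (2 * Real.pi * ξ) := by
  simp only [bsym, Complex.sub_im, Complex.one_im, Complex.im_ofReal_mul]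
  rw [pow_two, Complex.mul_im, dsym_re, dsym_im]
  ring

/-- The real part of the symbol is `1 - b α² + b (2πξ)²`, so it is smallest at zero frequency. -/
lemma le_norm_bsym {b α : ℝ} (hb : 0 ≤ b) (ξ : ℝ) : 1 - b * α ^ 2 ≤ ‖bsym b α ξ‖ := by
  refine le_trans ?_ (Complex.re_le_norm _)
  rw [bsym_re]
  have : 0 ≤ b * (2 * Real.pi * ξ) ^ 2 := by positivity
  linarith

lemma bsym_ne_zero {b α : ℝ} (hb : 0 ≤ b) (hbα : b * α ^ 2 < 1) (ξ : ℝ) : bsym b α ξ ≠ 0 := by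
  rw [← norm_pos_iff]
  linarith [le_norm_bsym (α := α) hb ξ]

lemma isBddMeas_inv_bsym {b α : ℝ} (hb : 0 ≤ b) (hbα : b * α ^ 2 < 1) :
    IsBddMeas fun ξ => (bsym b α ξ)⁻¹ :=
  isBddMeas_inv (continuous_bsym b α).measurable (by linarith : 0 < 1 - b * α ^ 2)
    (le_norm_bsym hb)

lemma norm_dsym_sq (α ξ : ℝ) : ‖dsym α ξ‖ ^ 2 = α ^ 2 + (2 * Real.pi * ξ) ^ 2 := by
  rw [Complex.sq_norm, Complex.normSq_apply, dsym_re, dsym_im]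
  ring

/-- Ellipticity. In `1 + ‖d‖² = (1 + α²) + (2πξ)²`, the constant is controlled by the lower bound
for the symbol and the quadratic term by its real part. This is the source of all the bounds on `dᵏ
B⁻¹`, `k ≤ 2`, and of their decay for `k ≤ 1`. -/
lemma exists_norm_dsym_sq_le {b α : ℝ} (hb : 0 < b) (hbα : b * α ^ 2 < 1) :
    ∃ C, 0 < C ∧ ∀ ξ, 1 + ‖dsym α ξ‖ ^ 2 ≤ C * ‖bsym b α ξ‖ := by
  refine ⟨(1 + α ^ 2) / (1 - b * α ^ 2) + 1 / b, ?_, fun ξ => ?_⟩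
  · have : 0 < 1 - b * α ^ 2 := by linarith
    positivity
  · have h1 : 0 < 1 - b * α ^ 2 := by linarith
    have h2 := (bsym_re b α ξ).symm.trans_le (Complex.re_le_norm (bsym b α ξ))
    set k := 2 * Real.pi * ξ
    rw [norm_dsym_sq]
    have h3 : 0 ≤ k ^ 2 := sq_nonneg k
    have h4 : 1 + α ^ 2 ≤ (1 + α ^ 2) / (1 - b * α ^ 2) * ‖bsym b α ξ‖ := by
      rw [div_mul_eq_mul_div, le_div_iff₀ h1]
      gcongr
      exact le_norm_bsym hb.le ξ
    have h5 : k ^ 2 ≤ 1 / b * ‖bsym b α ξ‖ := by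
      rw [div_mul_eq_mul_div, le_div_iff₀ hb]
      linarith
    linarith

lemma isBddMeas_dsym_mul_inv_bsym {b α : ℝ} (hb : 0 < b) (hbα : b * α ^ 2 < 1) :
    IsBddMeas fun ξ => dsym α ξ * (bsym b α ξ)⁻¹ := by
  obtain ⟨C, hC, h⟩ := exists_norm_dsym_sq_le hb hbα
  refine ⟨(continuous_dsym α).measurable.mul (continuous_bsym b α).measurable.inv, C, fun ξ => ?_⟩
  have hp : 0 < ‖bsym b α ξ‖ := norm_pos_iff.2 (bsym_ne_zero hb.le hbα ξ)
  rw [norm_mul, norm_inv, ← div_eq_mul_inv, div_le_iff₀ hp]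
  nlinarith [h ξ, sq_nonneg (‖dsym α ξ‖ - 1)]

lemma isBddMeas_dsym_sq_mul_inv_bsym {b α : ℝ} (hb : 0 < b) (hbα : b * α ^ 2 < 1) :
    IsBddMeas fun ξ => dsym α ξ ^ 2 * (bsym b α ξ)⁻¹ := by
  obtain ⟨C, hC, h⟩ := exists_norm_dsym_sq_le hb hbα
  refine ⟨((continuous_dsym α).measurable.pow_const 2).mul (continuous_bsym b α).measurable.inv, C,
    fun ξ => ?_⟩
  have hp : 0 < ‖bsym b α ξ‖ := norm_pos_iff.2 (bsym_ne_zero hb.le hbα ξ)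
  rw [norm_mul, norm_inv, norm_pow, ← div_eq_mul_inv, div_le_iff₀ hp]
  linarith [h ξ]

end Fourier

end BenneyLuke

namespace BenneyLuke

/-! ### Inverting `1 - b ∂²` on distributions in `L²_α`. -/

section Elliptic

lemma IsTest.hasDerivAt_deriv {φ : ℝ → ℝ} (hφ : IsTest φ) (x : ℝ) :
    HasDerivAt (_root_.deriv φ) (_root_.deriv (_root_.deriv φ) x) x := hφ.deriv.hasDerivAt x

lemma IsTest.elliptic {φ : ℝ → ℝ} (hφ : IsTest φ) (b : ℝ) :
    IsTest fun x => φ x - b * _root_.deriv (_root_.deriv φ) x :=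
  hφ.sub (hφ.deriv.deriv.const_mul b)

lemma pair_sub {α : ℝ} {ψ : ℝ → ℝ} (hψ : IsTest ψ) (f g : L2w α) :
    pair ψ (f - g) = pair ψ f - pair ψ g := by
  have h := pair_add hψ.continuous hψ.2 f ((-1 : ℂ) • g)
  rw [pair_smul] at h
  rw [sub_eq_add_neg, ← neg_one_smul ℂ g, h]
  ring

lemma pair_elliptic {α : ℝ} (b : ℝ) {φ : ℝ → ℝ} (hφ : IsTest φ) (f : L2w α) :
    pair (fun x => φ x - b * deriv (deriv φ) x) f =
      pair φ f - b * pair (deriv (deriv φ)) f := by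
  unfold pair
  have i1 : Integrable fun x => φ x • f x := hφ.integrable_smul (locInt f)
  have i2 : Integrable fun x => (b : ℂ) * (deriv (deriv φ) x • f x) :=
    (hφ.deriv.deriv.integrable_smul (locInt f)).const_mul _
  rw [← integral_const_mul, ← integral_sub i1 i2]
  congr 1
  funext x
  simp only [Complex.real_smul]
  push_cast
  ring

lemma pair_mul_eq {α : ℝ} {R : ℝ → ℝ} (hR : IsBddMeas fun x => (R x : ℂ)) (φ : ℝ → ℝ)
    (f : L2w α) :
    pair (fun x => R x * φ x) f = pair φ (mulOp (weight α) (fun x => (R x : ℂ)) f) := by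
  refine integral_congr_ae ?_
  filter_upwards [(ac_weight α).ae_le (mulOp_coe (weight α) hR f)] with x hx
  simp only [hx, Complex.real_smul]
  push_cast
  ring

/-- `1 - b ∂²` is injective on `L²_α`. -/
lemma eq_zero_of_elliptic {α b : ℝ} (hα : 0 ≤ α) (hb : 0 < b) (hbα : b * α ^ 2 < 1) {u : L2w α}
    (h : ∀ φ, IsTest φ → pair (fun x => φ x - b * deriv (deriv φ) x) u = 0) : u = 0 := by
  set s : ℝ := (√b)⁻¹ with hs
  have hsb : 0 < √b := Real.sqrt_pos.2 hb
  have hs0 : 0 < s := by positivity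
  have hs2 : b * s ^ 2 = 1 := by
    rw [hs, inv_pow, Real.sq_sqrt hb.le, mul_inv_cancel₀ hb.ne']
  have hαs : α < s := by
    by_contra! hcon
    have : s ^ 2 ≤ α ^ 2 := pow_le_pow_left₀ hs0.le hcon 2
    nlinarith
  have he (r : ℝ) : ContDiff ℝ ∞ fun x : ℝ => Real.exp (r * x) := by fun_prop
  have hed (r x : ℝ) : HasDerivAt (fun x : ℝ => Real.exp (r * x)) (Real.exp (r * x) * r) x := by
    simpa using ((hasDerivAt_id x).const_mul r).exp
  have hg : LocallyIntegrable fun x => Real.exp (s * x) • u x :=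
    locallyIntegrable_continuous_smul (he s).continuous (locInt u)
  -- With `b s² = 1` the equation is `u'' = s² u`. For `g = e^{sx} u` it becomes `(g' - 2s g)' = 0`,
  -- which is obtained by testing with `e^{sx} χ`; one integration leaves the constant `C`.
  obtain ⟨C, hC⟩ := exists_hasWeakDeriv_add_const hg
    (G := fun x => ((2 * s : ℝ) : ℂ) * (Real.exp (s * x) • u x)) (hg.smul ((2 * s : ℝ) : ℂ))
    fun χ hχ => by
      have h1 := h _ (hχ.smooth_mul (he s))
      have d1 : deriv (fun x => Real.exp (s * x) * χ x) =
          fun x => Real.exp (s * x) * s * χ x + Real.exp (s * x) * deriv χ x :=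
        funext fun x => ((hed s x).mul (hχ.hasDerivAt x)).deriv
      have d2 : deriv (fun x => Real.exp (s * x) * s * χ x + Real.exp (s * x) * deriv χ x) =
          fun x => (Real.exp (s * x) * s * s * χ x + Real.exp (s * x) * s * deriv χ x) +
            (Real.exp (s * x) * s * deriv χ x + Real.exp (s * x) * deriv (deriv χ) x) :=
        funext fun x => (((((hed s x).mul_const s).mul (hχ.hasDerivAt x))).add
          ((hed s x).mul (hχ.hasDerivAt_deriv x))).deriv
      rw [d1, d2] at h1
      have hg2 : LocallyIntegrable fun x => ((2 * s : ℝ) : ℂ) * (Real.exp (s * x) • u x) :=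
        hg.smul ((2 * s : ℝ) : ℂ)
      rw [← integral_add (hχ.deriv.deriv.integrable_smul hg) (hχ.deriv.integrable_smul hg2)]
      have e : ∫ x, (deriv (deriv χ) x • (Real.exp (s * x) • u x) +
          deriv χ x • (((2 * s : ℝ) : ℂ) * (Real.exp (s * x) • u x))) =
          ((-s ^ 2 : ℝ) : ℂ) * pair (fun x => Real.exp (s * x) * χ x -
            b * ((Real.exp (s * x) * s * s * χ x + Real.exp (s * x) * s * deriv χ x) +
            (Real.exp (s * x) * s * deriv χ x + Real.exp (s * x) * deriv (deriv χ) x))) u := by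
        unfold pair
        rw [← integral_const_mul]
        congr 1
        funext x
        simp only [Complex.real_smul]
        have hs2' : (b : ℂ) * (s : ℂ) ^ 2 = 1 := by exact_mod_cast hs2
        push_cast
        linear_combination (-(s : ℂ) ^ 2 * Complex.exp (s * x) * χ x * u x -
          2 * s * Complex.exp (s * x) * (deriv χ x : ℝ) * u x -
          Complex.exp (s * x) * (deriv (deriv χ) x : ℝ) * u x) * hs2'
      rw [e, h1, mul_zero]
  have hu := hC.smooth_smul (he (-s))
  have hexp : HasWeakDeriv (fun x : ℝ => Real.exp (-s * x) • (C / (2 * s)))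
      fun x => Real.exp (-s * x) • (-C / 2) := by
    refine hasWeakDeriv_of_hasDerivAt (fun x => ?_) (by fun_prop)
    refine ((hed (-s) x).smul_const (C / (2 * s))).congr_deriv ?_
    have : (s : ℂ) ≠ 0 := by exact_mod_cast hs0.ne'
    simp only [Complex.real_smul]
    push_cast
    field_simp
  have hcancel (x : ℝ) : ((Real.exp (-s * x) : ℝ) : ℂ) * ((Real.exp (s * x) : ℝ) : ℂ) = 1 := by
    rw [← Complex.ofReal_mul, ← Real.exp_add]
    simp
  -- Now `u' = s u + C e^{-sx}`. Adding the particular term `(C / 2s) e^{-sx}` gives a solution of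
  -- `v' = s v`, so `u` is a combination of `e^{±sx}`. After weighting the exponents are `s + α > 0`
  -- and `α - s < 0`, and `e^{αx} u` is in `L²` only if both coefficients vanish.
  have hv : HasWeakDeriv (fun x => u x + Real.exp (-s * x) • (C / (2 * s)))
      fun x => (s : ℂ) * (u x + Real.exp (-s * x) • (C / (2 * s))) := by
    refine hasWeakDeriv_congr ?_ ?_ (hu.add hexp)
    · refine Eventually.of_forall fun x => ?_
      simp only [Complex.real_smul]
      linear_combination u x * hcancel x
    · refine Eventually.of_forall fun x => ?_
      have : (s : ℂ) ≠ 0 := by exact_mod_cast hs0.ne'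
      simp only [(hed (-s) x).deriv, Complex.real_smul]
      have := hcancel x
      simp only [Complex.ofReal_mul, Complex.ofReal_neg, Complex.ofReal_ofNat]
      generalize ((Real.exp (-s * x) : ℝ) : ℂ) = E₁ at this ⊢
      generalize ((Real.exp (s * x) : ℝ) : ℂ) = E₂ at this ⊢
      field_simp
      linear_combination (2 * (s : ℂ) * u x) * this
  obtain ⟨D, hD⟩ := hv.ae_eq_exp
  have hmem : MemLp (fun x : ℝ => Real.exp ((s + α) * x) • D +
      Real.exp ((α - s) * x) • (-(C / (2 * s)))) 2 volume := by
    refine (memLp_congr_ae ?_).1 (memLp_exp_smul u)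
    filter_upwards [hD] with x hx
    have : u x = Real.exp (s * x) • D - Real.exp (-s * x) • (C / (2 * s)) := by
      rw [← hx]; ring
    rw [this, smul_sub, smul_smul, smul_smul, ← Real.exp_add, ← Real.exp_add, smul_neg,
      ← sub_eq_add_neg]
    ring_nf
  obtain ⟨h1, h2⟩ := eq_zero_of_memLp_exp (by positivity) (by linarith) hmem
  refine L2w_ext ?_
  filter_upwards [hD, coeFn_zero_volume α] with x hx h0
  rw [neg_eq_zero] at h2
  rw [h1, h2] at hx
  rw [h0]
  simpa using hx

/-- Solution of `(1 - b ∂²) v = (1 - a ∂²) p - h` in the sense of distributions. -/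
theorem elliptic_iff {α a b : ℝ} (hα : 0 ≤ α) (hb : 0 < b) (hbα : b * α ^ 2 < 1)
    (v p h : L2w α) :
    (∀ φ, IsTest φ → pair (fun x => φ x - b * deriv (deriv φ) x) v =
      pair (fun x => φ x - a * deriv (deriv φ) x) p - pair φ h) ↔
    v = fm α (fun ξ => bsym a α ξ * (bsym b α ξ)⁻¹) p - fm α (fun ξ => (bsym b α ξ)⁻¹) h := by
  have hB := isBddMeas_inv_bsym hb.le hbα
  have hdB := isBddMeas_dsym_mul_inv_bsym hb hbα
  have hddB := isBddMeas_dsym_sq_mul_inv_bsym hb hbα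
  have hne := bsym_ne_zero (α := α) hb.le hbα
  have hAB : IsBddMeas fun ξ => bsym a α ξ * (bsym b α ξ)⁻¹ := by
    convert hB.add (hddB.const_mul (-a)) using 2 with ξ
    simp only [bsym]
    ring
  have hbC : (b : ℂ) ≠ 0 := by exact_mod_cast hb.ne'
  have hinv (f : L2w α) (φ : ℝ → ℝ) (hφ : IsTest φ) :
      pair (fun x => φ x - b * deriv (deriv φ) x) (fm α (fun ξ => (bsym b α ξ)⁻¹) f) =
        pair φ f := by
    have w1 := (hasWeakDeriv_iff _ _).1 (hasWeakDeriv_fm hB hdB (fun ξ => rfl) f)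
    have w2 := (hasWeakDeriv_iff _ _).1 (hasWeakDeriv_fm hdB hddB (fun ξ => by ring) f)
    rw [pair_elliptic b hφ, w1 _ hφ.deriv, w2 _ hφ, neg_neg, ← pair_smul, ← pair_sub hφ]
    congr 1
    refine ft_ext ?_
    filter_upwards [ft_sub_coe (fm α (fun ξ => (bsym b α ξ)⁻¹) f)
        ((b : ℂ) • fm α (fun ξ => dsym α ξ ^ 2 * (bsym b α ξ)⁻¹) f),
      ft_smul_coe (b : ℂ) (fm α (fun ξ => dsym α ξ ^ 2 * (bsym b α ξ)⁻¹) f),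
      ft_fm_coe α hB f, ft_fm_coe α hddB f] with ξ h1 h2 h3 h4
    rw [h1, h2, h3, h4]
    have := hne ξ
    field_simp
    simp only [bsym]
    ring
  have hsol (φ : ℝ → ℝ) (hφ : IsTest φ) : pair (fun x => φ x - b * deriv (deriv φ) x)
      (fm α (fun ξ => bsym a α ξ * (bsym b α ξ)⁻¹) p - fm α (fun ξ => (bsym b α ξ)⁻¹) h) =
      pair (fun x => φ x - a * deriv (deriv φ) x) p - pair φ h := by
    -- The identity `A / B = a / b + (1 - a / b) / B` reduces the action of `B⁻¹ A` on distributions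
    -- to that of `B⁻¹`.
    have e : fm α (fun ξ => bsym a α ξ * (bsym b α ξ)⁻¹) p =
        ((a / b : ℝ) : ℂ) • p + ((1 - a / b : ℝ) : ℂ) • fm α (fun ξ => (bsym b α ξ)⁻¹) p := by
      refine ft_ext ?_
      filter_upwards [ft_fm_coe α hAB p, ft_fm_coe α hB p,
        ft_add_coe (((a / b : ℝ) : ℂ) • p) (((1 - a / b : ℝ) : ℂ) •
          fm α (fun ξ => (bsym b α ξ)⁻¹) p), ft_smul_coe ((a / b : ℝ) : ℂ) p,
        ft_smul_coe ((1 - a / b : ℝ) : ℂ) (fm α (fun ξ => (bsym b α ξ)⁻¹) p)] with ξ h1 h2 h3 h4 h5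
      rw [h1, h3, h4, h5, h2]
      have := hne ξ
      push_cast
      field_simp
      simp only [bsym]
      ring
    rw [pair_sub (hφ.elliptic b), hinv h φ hφ, e,
      pair_add (hφ.elliptic b).continuous (hφ.elliptic b).2, pair_smul, pair_smul, hinv p φ hφ,
      pair_elliptic b hφ, pair_elliptic a hφ]
    push_cast
    field_simp
    ring
  constructor
  · intro hv
    rw [← sub_eq_zero]
    refine eq_zero_of_elliptic hα hb hbα fun φ hφ => ?_
    rw [pair_sub (hφ.elliptic b), hv φ hφ, hsol φ hφ, sub_self]
  · rintro rfl φ hφ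
    exact hsol φ hφ

/-- Because `(e^{αx} f)' = e^{αx} (f' + α f)`, the condition that `e^{αx} f` is in `H¹` amounts to
`f'` being in `L²_α`. -/
lemma memH1w_iff {α : ℝ} (f : L2w α) : MemH1w α f ↔ ∃ g : L2w α, HasWeakDeriv f g := by
  have he (r : ℝ) : ContDiff ℝ ∞ fun x : ℝ => Real.exp (r * x) := by fun_prop
  have hed (r x : ℝ) : deriv (fun x : ℝ => Real.exp (r * x)) x = Real.exp (r * x) * r := by
    simpa using ((hasDerivAt_id x).const_mul r).exp.deriv
  constructor
  · rintro ⟨-, g, hg, h⟩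
    have hm : MemLp (fun x => Real.exp (-α * x) • g x - (α : ℂ) * f x) 2 (weight α) := by
      rw [memLp_weight_iff]
      refine (memLp_congr_ae (Eventually.of_forall fun x => ?_)).1
        (hg.sub ((memLp_exp_smul f).const_mul (α : ℂ)))
      have : ((Real.exp (α * x) : ℝ) : ℂ) * ((Real.exp (-α * x) : ℝ) : ℂ) = 1 := by
        rw [← Complex.ofReal_mul, ← Real.exp_add]
        simp
      simp only [Pi.sub_apply, Complex.real_smul]
      linear_combination -g x * this
    refine ⟨hm.toLp, ?_⟩
    refine hasWeakDeriv_congr ?_ ?_ (h.smooth_smul (he (-α)))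
    · refine Eventually.of_forall fun x => ?_
      simp only [smul_smul, ← Real.exp_add]
      simp
    · filter_upwards [(ac_weight α).ae_le hm.coeFn_toLp] with x hx
      have : ((Real.exp (-α * x) : ℝ) : ℂ) * ((Real.exp (α * x) : ℝ) : ℂ) = 1 := by
        rw [← Complex.ofReal_mul, ← Real.exp_add]
        simp
      rw [hx, hed]
      simp only [Complex.real_smul]
      push_cast at this ⊢
      linear_combination (-(α : ℂ) * f x) * this
  · rintro ⟨g, h⟩
    refine ⟨memLp_exp_smul f, _, ?_, h.smooth_smul (he α)⟩
    refine (memLp_congr_ae (Eventually.of_forall fun x => ?_)).1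
      ((memLp_exp_smul g).add ((memLp_exp_smul f).const_mul (α : ℂ)))
    rw [hed]
    simp only [Pi.add_apply, Complex.real_smul]
    push_cast
    ring

end Elliptic

end BenneyLuke

namespace BenneyLuke

/-! ### Semigroups of multiplication operators and their generators. -/

section MultiplicationSemigroup

variable {X : Type*} [MeasurableSpace X] (μ : Measure X)

lemma norm_exp_sub_one_le_of_re_nonpos {z : ℂ} (hz : z.re ≤ 0) : ‖Complex.exp z - 1‖ ≤ 2 * ‖z‖ := by
  rcases le_total ‖z‖ 1 with h | h
  · exact Complex.norm_exp_sub_one_le h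
  · calc ‖Complex.exp z - 1‖ ≤ ‖Complex.exp z‖ + ‖(1 : ℂ)‖ := norm_sub_le _ _
      _ ≤ 1 + 1 := by
          rw [Complex.norm_exp, norm_one]
          gcongr
          exact Real.exp_le_one_iff.2 hz
      _ ≤ 2 * ‖z‖ := by linarith

lemma isBddMeas_exp {ν : X → ℂ} (hν : Measurable ν) (hre : ∀ x, (ν x).re ≤ 0) {t : ℝ}
    (ht : 0 ≤ t) : IsBddMeas fun x => Complex.exp (t * ν x) := by
  refine ⟨(hν.const_mul _).cexp, 1, fun x => ?_⟩
  rw [Complex.norm_exp, Complex.re_ofReal_mul]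
  exact Real.exp_le_one_iff.2 (mul_nonpos_of_nonneg_of_nonpos ht (hre x))

/-- The multiplication operators `e^{tν}` form a `C⁰` semigroup. -/
lemma isC0Semigroup_mulOp {ν : X → ℂ} (hν : Measurable ν) (hre : ∀ x, (ν x).re ≤ 0) :
    IsC0Semigroup fun t : ℝ => mulOp μ fun x => Complex.exp (t * ν x) := by
  refine ⟨?_, fun s t hs ht => ?_, fun f t ht => ?_⟩
  · ext1 f
    simpa using mulOp_one μ f
  · ext1 f
    rw [ContinuousLinearMap.comp_apply,
      mulOp_mulOp μ (isBddMeas_exp hν hre hs) (isBddMeas_exp hν hre ht)]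
    congr 2
    funext x
    rw [← Complex.exp_add]
    push_cast
    ring_nf
  · have hb (s : ℝ) (hs : 0 ≤ s) (x : X) : ‖Complex.exp (s * ν x)‖ ≤ 1 := by
      rw [Complex.norm_exp, Complex.re_ofReal_mul]
      exact Real.exp_le_one_iff.2 (mul_nonpos_of_nonneg_of_nonpos hs (hre x))
    refine tendsto_mulOp_of_bounded μ (m := fun (s : ℝ) x => Complex.exp (s * ν x))
      (m₀ := fun x => Complex.exp (t * ν x)) (C := 1) (fun s => (hν.const_mul _).cexp)
      (hν.const_mul _).cexp ?_ (hb t ht) (fun x => ?_) f ?_ (mulOp_coe μ (isBddMeas_exp hν hre ht) f)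
    · filter_upwards [self_mem_nhdsWithin] with s hs using hb s hs
    · have : Continuous fun s : ℝ => Complex.exp (s * ν x) := by fun_prop
      exact (this.tendsto t).mono_left nhdsWithin_le_nhds
    · filter_upwards [self_mem_nhdsWithin] with s hs using mulOp_coe μ (isBddMeas_exp hν hre hs) f

/-- The generator of the multiplication semigroup `e^{tν}` is the multiplication by `ν` with its
maximal domain. -/
lemma tendsto_mulOp_exp_iff {ν : X → ℂ} (hν : Measurable ν) (hre : ∀ x, (ν x).re < 0)
    (f g : Lp ℂ 2 μ) :
    Tendsto (fun t : ℝ => ((t : ℂ)⁻¹) • (mulOp μ (fun x => Complex.exp (t * ν x)) f - f))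
      (𝓝[>] 0) (𝓝 g) ↔ ∀ᵐ x ∂μ, g x = ν x * f x := by
  have hν0 (x : X) : ν x ≠ 0 := fun h => by have := hre x; rw [h] at this; simp at this
  -- The difference quotient of `e^{tν}` is `m t * ν`, where `m t` is bounded by `2` and tends to
  -- `1` pointwise.
  set m : ℝ → X → ℂ := fun t x => (Complex.exp (t * ν x) - 1) / (t * ν x) with hm
  have hmm (t : ℝ) : Measurable (m t) :=
    ((hν.const_mul _).cexp.sub_const 1).div (hν.const_mul _)
  have hb (t : ℝ) (ht : 0 < t) (x : X) : ‖m t x‖ ≤ 2 := by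
    have h0 : (t : ℂ) * ν x ≠ 0 := mul_ne_zero (by exact_mod_cast ht.ne') (hν0 x)
    rw [hm, norm_div, div_le_iff₀ (norm_pos_iff.2 h0)]
    refine norm_exp_sub_one_le_of_re_nonpos ?_
    rw [Complex.re_ofReal_mul]
    exact mul_nonpos_of_nonneg_of_nonpos ht.le (hre x).le
  have hlim (x : X) : Tendsto (fun t : ℝ => m t x) (𝓝[>] 0) (𝓝 1) := by
    have h1 : HasDerivAt (fun t : ℝ => Complex.exp (t * ν x)) (ν x) 0 := by
      have := ((Complex.ofRealCLM.hasDerivAt (x := (0 : ℝ))).mul_const (ν x)).cexp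
      simpa using this
    have h2 := h1.tendsto_slope.mono_left (nhdsWithin_mono (0 : ℝ)
      (fun t (ht : t ∈ Set.Ioi (0 : ℝ)) => ne_of_gt ht))
    have h3 := h2.mul_const (ν x)⁻¹
    rw [mul_inv_cancel₀ (hν0 x)] at h3
    refine h3.congr fun t => ?_
    simp only [slope, hm, vsub_eq_sub, sub_zero, Complex.ofReal_zero, zero_mul, Complex.exp_zero,
      Complex.real_smul, Complex.ofReal_inv]
    rw [div_eq_mul_inv, mul_inv]
    ring
  have hquot (t : ℝ) (ht : 0 < t) (f : Lp ℂ 2 μ) : ∀ᵐ x ∂μ,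
      (((t : ℂ)⁻¹) • (mulOp μ (fun x => Complex.exp (t * ν x)) f - f)) x =
        m t x * (ν x * f x) := by
    filter_upwards [Lp.coeFn_smul ((t : ℂ)⁻¹) (mulOp μ (fun x => Complex.exp (t * ν x)) f - f),
      Lp.coeFn_sub (mulOp μ (fun x => Complex.exp (t * ν x)) f) f,
      mulOp_coe μ (isBddMeas_exp hν (fun x => (hre x).le) ht.le) f] with x h1 h2 h3
    rw [h1, Pi.smul_apply, h2, Pi.sub_apply, h3, smul_eq_mul, hm]
    have : (t : ℂ) ≠ 0 := by exact_mod_cast ht.ne'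
    have := hν0 x
    field_simp
  constructor
  · intro h
    -- As `ν` may be unbounded, `ν f` is not known to be in `L²` here. Multiplying by the bounded
    -- function `(1 - ν)⁻¹` makes the limit computable, and this factor is cancelled pointwise at
    -- the end.
    have hw0 (x : X) : 1 - ν x ≠ 0 := fun h => by
      have h1 := hre x
      rw [← sub_eq_zero.1 h] at h1
      simp at h1
      linarith
    have hw1 (x : X) : 1 ≤ ‖1 - ν x‖ := by
      refine le_trans ?_ (Complex.re_le_norm _)
      rw [Complex.sub_re, Complex.one_re]
      linarith [hre x]
    have hn1 : IsBddMeas fun x => (1 - ν x)⁻¹ := by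
      refine ⟨(hν.const_sub 1).inv, 1, fun x => ?_⟩
      rw [norm_inv]
      exact inv_le_one_of_one_le₀ (hw1 x)
    have hn2 : IsBddMeas fun x => ν x * (1 - ν x)⁻¹ := by
      convert hn1.add (IsBddMeas.const (-1)) using 2 with x
      have := hw0 x
      field_simp
      ring
    have h1 := ((mulOp μ fun x => (1 - ν x)⁻¹).continuous.tendsto g).comp h
    have h2 : Tendsto ((mulOp μ fun x => (1 - ν x)⁻¹) ∘
        fun t : ℝ => ((t : ℂ)⁻¹) • (mulOp μ (fun x => Complex.exp (t * ν x)) f - f))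
        (𝓝[>] 0) (𝓝 (mulOp μ (fun x => ν x * (1 - ν x)⁻¹) f)) := by
      refine tendsto_mulOp_of_bounded μ (m := m) (m₀ := fun _ => 1) (C := 2) hmm
        measurable_const ?_ (by simp) hlim (mulOp μ (fun x => ν x * (1 - ν x)⁻¹) f) ?_ (by simp)
      · filter_upwards [self_mem_nhdsWithin] with t ht using hb t ht
      · filter_upwards [self_mem_nhdsWithin] with t ht
        filter_upwards [mulOp_coe μ hn1 (((t : ℂ)⁻¹) • (mulOp μ (fun x => Complex.exp (t * ν x)) f - f)),
          hquot t ht f, mulOp_coe μ hn2 f] with x h1 h2 h3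
        rw [Function.comp_apply, h1, h2, h3]
        ring
    have h3 := tendsto_nhds_unique h1 h2
    filter_upwards [(mulOp_apply_eq_iff μ hn1 g _).1 h3, mulOp_coe μ hn2 f] with x h4 h5
    rw [h5, mul_comm (ν x), mul_assoc] at h4
    exact (mul_left_cancel₀ (inv_ne_zero (hw0 x)) h4).symm
  · intro h
    refine tendsto_mulOp_of_bounded μ (m := m) (m₀ := fun _ => 1) (C := 2) hmm
      measurable_const ?_ (by simp) hlim g ?_ (by simp)
    · filter_upwards [self_mem_nhdsWithin] with t ht using hb t ht
    · filter_upwards [self_mem_nhdsWithin] with t ht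
      filter_upwards [hquot t ht f, h] with x h1 h2
      rw [h1, h2]

end MultiplicationSemigroup

/-! ### The key estimate on the dispersion relation. -/

section Symbols

variable {a b c α : ℝ}

lemma abs_add_le_of_mul_nonpos {x y m : ℝ} (hxy : x * y ≤ 0) (hx : |x| ≤ m) (hy : |y| ≤ m) :
    |x + y| ≤ m := by
  rw [abs_le] at *
  rcases le_total 0 x with h | h
  · rcases eq_or_lt_of_le h with h0 | h0
    · subst h0; simpa using hy
    · have : y ≤ 0 := by by_contra! hc; nlinarith
      constructor <;> linarith
  · rcases eq_or_lt_of_le h with h0 | h0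
    · subst h0; simpa using hy
    · have : 0 ≤ y := by by_contra! hc; nlinarith
      constructor <;> linarith

/-- In the application `x + iy` is the square root of `A / B`, `Br` is the real part of `B`, `P =
|B|²`, `θ = 1 - a / b`, and `e = 1 - b α²`. The product `x y` is known exactly, so `(k y)² x²`
equals `θ² α² (b k²)² / P²`. This is at most `α²` times the product of the given lower bounds for
`s` and `x²`. -/
lemma sq_mul_sq_le_of_mul_eq {θ b α k x y s e Br P : ℝ} (hθ : 0 < θ) (hb : 0 < b)
    (h : 2 * (x * y) = -θ * (2 * b * α * k / P)) (hx : θ * (Br / P) ≤ x ^ 2)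
    (hs : θ * (1 / e) ≤ s) (he : 0 < e) (heB : e ≤ Br) (hk : b * k ^ 2 ≤ Br) (hP : Br ^ 2 ≤ P) :
    (k * y) ^ 2 * x ^ 2 ≤ α ^ 2 * s * x ^ 2 := by
  have hBr : 0 < Br := he.trans_le heB
  have hP0 : 0 < P := lt_of_lt_of_le (by positivity) hP
  have h1 : (k * y) ^ 2 * x ^ 2 = θ ^ 2 * α ^ 2 * ((b * k ^ 2) ^ 2 / P ^ 2) := by
    have : (k * y) ^ 2 * x ^ 2 = (k * (2 * (x * y)) / 2) ^ 2 := by ring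
    rw [this, h]
    ring
  have h2 : (b * k ^ 2) ^ 2 / P ^ 2 ≤ (1 / e) * (Br / P) := by
    rw [one_div_mul_eq_div, div_div, div_le_div_iff₀ (by positivity) (by positivity)]
    have h4 : (b * k ^ 2) ^ 2 ≤ P := le_trans (by gcongr) hP
    calc (b * k ^ 2) ^ 2 * (P * e) ≤ P * (P * Br) := by gcongr
      _ = Br * P ^ 2 := by ring
  have hs0 : 0 ≤ s := le_trans (by positivity) hs
  rw [h1]
  calc θ ^ 2 * α ^ 2 * ((b * k ^ 2) ^ 2 / P ^ 2)
      ≤ θ ^ 2 * α ^ 2 * ((1 / e) * (Br / P)) := by gcongr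
    _ = α ^ 2 * (θ * (1 / e)) * (θ * (Br / P)) := by ring
    _ ≤ α ^ 2 * s * x ^ 2 := by gcongr

/-- The growth rate of the two branches of the symbol of `[[0, ∂], [B⁻¹A∂, 0]]` in `L²_α`
is largest at zero frequency. -/
lemma abs_re_dsym_mul_le (ha : 0 < a) (hab : a < b) (hα : 0 < α) (hbα : b * α ^ 2 < 1) {ξ : ℝ}
    {S : ℂ} (hS : S ^ 2 * bsym b α ξ = bsym a α ξ) :
    |(dsym α ξ * S).re| ≤ α * √((1 - a * α ^ 2) / (1 - b * α ^ 2)) := by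
  have hb : 0 < b := ha.trans hab
  set k := 2 * Real.pi * ξ with hk
  set σ₁ := S.re
  set σ₂ := S.im
  have e1 : 0 < 1 - b * α ^ 2 := by linarith
  have hY : 0 ≤ k ^ 2 := sq_nonneg k
  set Br := 1 - b * α ^ 2 + b * k ^ 2 with hBr
  set Bi := 2 * b * α * k with hBi
  have hBr0 : 0 < Br := by positivity
  set P := Br ^ 2 + Bi ^ 2 with hP
  have hP0 : 0 < P := by positivity
  set s2 := (1 - a * α ^ 2) / (1 - b * α ^ 2) with hs2
  have hs2e : s2 = a / b + (1 - a / b) * (1 / (1 - b * α ^ 2)) := by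
    have e1' : 1 - b * α ^ 2 ≠ 0 := e1.ne'
    rw [hs2, eq_comm, eq_div_iff e1', add_mul, mul_assoc, one_div, inv_mul_cancel₀ e1']
    field_simp
    ring
  have hρ : 0 < a / b := by positivity
  have hθ : 0 < 1 - a / b := by rw [sub_pos, div_lt_one hb]; exact hab
  have hs20 : 0 < s2 := by rw [hs2e]; positivity
  -- real and imaginary parts of `S² = A / B`
  have hre := congrArg Complex.re hS
  have him := congrArg Complex.im hS
  rw [pow_two, Complex.mul_re, Complex.mul_re, Complex.mul_im, bsym_re, bsym_im, bsym_re] at hre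
  rw [pow_two, Complex.mul_im, Complex.mul_re, Complex.mul_im, bsym_re, bsym_im, bsym_im] at him
  rw [← hk] at hre him
  -- Real and imaginary parts of `S² = a / b + (1 - a / b) / B`, with `1 / B = (Br - i Bi) / P`.
  have g1 : σ₁ ^ 2 - σ₂ ^ 2 = a / b + (1 - a / b) * (Br / P) := by
    have : (σ₁ ^ 2 - σ₂ ^ 2) * P = (a / b) * P + (1 - a / b) * Br := by
      have hA : a / b * b = a := by field_simp
      rw [hP]
      linear_combination Br * hre + Bi * him - (k ^ 2 * Br - α ^ 2 * Br + 2 * α * k * Bi) * hA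
    field_simp at this ⊢
    linarith
  have g2 : 2 * (σ₁ * σ₂) = -(1 - a / b) * (Bi / P) := by
    have : 2 * (σ₁ * σ₂) * P = -(1 - a / b) * Bi := by
      have hA : a / b * b = a := by field_simp
      rw [hP]
      linear_combination Br * him - Bi * hre + (k ^ 2 * Bi - α ^ 2 * Bi - 2 * α * k * Br) * hA
    field_simp at this ⊢
    linarith
  have hσ : (1 - a / b) * (Br / P) ≤ σ₁ ^ 2 := by nlinarith [sq_nonneg σ₂]
  have hσ0 : 0 < σ₁ ^ 2 := lt_of_lt_of_le (by positivity) hσ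
  -- The two terms of `-Re (d S) = α σ₁ + k σ₂` have opposite signs, so it is enough to bound each
  -- of them by the value at zero frequency. For `α σ₁` this follows from `|A / B| ≤ a / b + (1 - a
  -- / b) / (1 - b α²)`; for `k σ₂` the crude bound by `|k S|` is useless and the exact value of `σ₁
  -- σ₂` is needed.
  have hprod : (α * σ₁) * (k * σ₂) ≤ 0 := by
    have : (α * σ₁) * (k * σ₂) = -((1 - a / b) * (b * α ^ 2 * k ^ 2 / P)) := by
      have e : (α * σ₁) * (k * σ₂) = α * k * (2 * (σ₁ * σ₂)) / 2 := by ring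
      rw [e, g2, hBi]
      ring
    rw [this, neg_nonpos]
    positivity
  have hx : |α * σ₁| ≤ α * √s2 := by
    rw [abs_mul, abs_of_pos hα]
    gcongr
    refine Real.abs_le_sqrt ?_
    have h1 : ‖S‖ ^ 2 = σ₁ ^ 2 + σ₂ ^ 2 := by
      rw [Complex.sq_norm, Complex.normSq_apply]; ring
    have hBne := bsym_ne_zero (α := α) hb.le hbα ξ
    have h2 : S ^ 2 = ((a / b : ℝ) : ℂ) + ((1 - a / b : ℝ) : ℂ) * (bsym b α ξ)⁻¹ := by
      rw [← eq_div_iff hBne] at hS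
      rw [hS]
      have : (b : ℂ) ≠ 0 := by exact_mod_cast hb.ne'
      push_cast
      field_simp
      simp only [bsym]
      ring
    have h3 : ‖S‖ ^ 2 ≤ s2 := by
      rw [← norm_pow, h2, hs2e]
      refine (norm_add_le _ _).trans ?_
      rw [norm_mul, Complex.norm_real, Complex.norm_real, Real.norm_of_nonneg hρ.le,
        Real.norm_of_nonneg hθ.le, norm_inv, ← one_div]
      gcongr
      exact le_norm_bsym hb.le ξ
    linarith [sq_nonneg σ₂]
  have hy : |k * σ₂| ≤ α * √s2 := by
    have h1 : (k * σ₂) ^ 2 * σ₁ ^ 2 ≤ α ^ 2 * s2 * σ₁ ^ 2 := by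
      refine sq_mul_sq_le_of_mul_eq hθ hb g2 hσ (hs2e ▸ by linarith) e1 ?_ ?_ ?_
      · have : 0 ≤ b * k ^ 2 := by positivity
        rw [hBr]; linarith
      · rw [hBr]; linarith
      · rw [hP]; linarith [sq_nonneg Bi]
    have h2 : (k * σ₂) ^ 2 ≤ α ^ 2 * s2 := le_of_mul_le_mul_right h1 hσ0
    have h3 := Real.abs_le_sqrt h2
    rwa [Real.sqrt_mul (sq_nonneg α), Real.sqrt_sq hα.le] at h3
  have hfin : (dsym α ξ * S).re = -(α * σ₁ + k * σ₂) := by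
    rw [Complex.mul_re, dsym_re, dsym_im]
    ring
  rw [hfin, abs_neg]
  exact abs_add_le_of_mul_nonpos hprod hx hy

end Symbols

end BenneyLuke

namespace BenneyLuke

/-! ### Admissible parameters and the spectral gap of the free operator. -/

section DispersionRelation

/-- The range of parameters: the solitary wave of speed `c` exists and `0 < α < α_c`. -/
structure Admissible (a b c α : ℝ) : Prop where
  a_pos : 0 < a
  a_lt : a < b
  one_lt : 1 < c
  α_pos : 0 < α
  lt_alphaC : α ^ 2 * (b * c ^ 2 - a) < c ^ 2 - 1

variable {a b c α : ℝ}

namespace Admissible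

variable (h : Admissible a b c α)
include h

lemma b_pos : 0 < b := h.a_pos.trans h.a_lt

lemma c_pos : 0 < c := zero_lt_one.trans h.one_lt

lemma sq_sub_one_pos : 0 < c ^ 2 - 1 := by nlinarith [h.one_lt]

lemma γ_pos : 0 < b * c ^ 2 - a := by nlinarith [h.a_lt, h.b_pos, h.sq_sub_one_pos]

/-- Since `a < b`, one has `b (c² - 1) ≤ b c² - a`, hence `α² b (c² - 1) < c² - 1`. -/
lemma b_mul_sq_lt : b * α ^ 2 < 1 := by
  have h1 : b * (c ^ 2 - 1) ≤ b * c ^ 2 - a := by linarith [h.a_lt]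
  have h2 : α ^ 2 * (b * (c ^ 2 - 1)) ≤ α ^ 2 * (b * c ^ 2 - a) := by gcongr
  have h3 := h.sq_sub_one_pos
  by_contra! hc
  nlinarith [h.lt_alphaC]

lemma a_mul_sq_lt : a * α ^ 2 < 1 := by
  have : a * α ^ 2 ≤ b * α ^ 2 := by gcongr; exact h.a_lt.le
  linarith [h.b_mul_sq_lt]

/-- Squared and cleared of denominators, this is the inequality `α² (b c² - a) < c² - 1` itself. It
is here that `α < α_c` produces the spectral gap. -/
lemma sqrt_lt : √((1 - a * α ^ 2) / (1 - b * α ^ 2)) < c := by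
  have h1 := h.b_mul_sq_lt
  rw [Real.sqrt_lt' h.c_pos, div_lt_iff₀ (by linarith)]
  nlinarith [h.lt_alphaC]

end Admissible

lemma isBddMeas_bsym_mul_inv_bsym {a b α : ℝ} (hb : 0 < b) (hbα : b * α ^ 2 < 1) :
    IsBddMeas fun ξ => bsym a α ξ * (bsym b α ξ)⁻¹ := by
  have h := (isBddMeas_inv_bsym hb.le hbα).add
    ((isBddMeas_dsym_sq_mul_inv_bsym hb hbα).const_mul (-a : ℂ))
  convert h using 2 with ξ
  simp only [bsym]
  ring

/-- The square root of the symbol of `B⁻¹A`. -/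
def ssym (a b α : ℝ) (ξ : ℝ) : ℂ := (bsym a α ξ * (bsym b α ξ)⁻¹) ^ ((2 : ℂ)⁻¹)

lemma ssym_sq (a b α ξ : ℝ) : ssym a b α ξ ^ 2 = bsym a α ξ * (bsym b α ξ)⁻¹ := by
  unfold ssym
  exact Complex.cpow_ofNat_inv_pow _ 2

lemma measurable_ssym (a b α : ℝ) : Measurable (ssym a b α) :=
  ((continuous_bsym a α).measurable.mul (continuous_bsym b α).measurable.inv).pow_const _

lemma isBddMeas_of_sq {u : ℝ → ℂ} (hu : Measurable u) (h : IsBddMeas fun ξ => u ξ ^ 2) :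
    IsBddMeas u := by
  obtain ⟨-, C, hC⟩ := h
  refine ⟨hu, C + 1, fun ξ => ?_⟩
  have := hC ξ
  rw [norm_pow] at this
  nlinarith [sq_nonneg (‖u ξ‖ - 1), norm_nonneg (u ξ)]

variable (h : Admissible a b c α)
include h

lemma ssym_ne_zero (ξ : ℝ) : ssym a b α ξ ≠ 0 := by
  intro h0
  have h1 := ssym_sq a b α ξ
  rw [h0, zero_pow two_ne_zero] at h1
  exact mul_ne_zero (bsym_ne_zero h.a_pos.le h.a_mul_sq_lt ξ)
    (inv_ne_zero (bsym_ne_zero h.b_pos.le h.b_mul_sq_lt ξ)) h1.symm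

lemma isBddMeas_ssym : IsBddMeas (ssym a b α) := by
  refine isBddMeas_of_sq (measurable_ssym a b α) ?_
  simp only [ssym_sq]
  exact isBddMeas_bsym_mul_inv_bsym h.b_pos h.b_mul_sq_lt

lemma isBddMeas_inv_ssym : IsBddMeas fun ξ => (ssym a b α ξ)⁻¹ := by
  refine isBddMeas_of_sq (measurable_ssym a b α).inv ?_
  simp only [inv_pow, ssym_sq, mul_inv, inv_inv]
  simp only [mul_comm]
  exact isBddMeas_bsym_mul_inv_bsym h.a_pos h.a_mul_sq_lt

/-- The left side is the determinant of `[[c, 1], [A / B, c]]`. Its numerator is the symbol of `(c²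
- 1) - (b c² - a) ∂²`, an operator of the same form as `B` with `b` replaced by `1 / α_c²`, so the
bounds for such symbols apply when `α < α_c`. -/
lemma sq_sub_symbol_eq (ξ : ℝ) : (c : ℂ) ^ 2 - bsym a α ξ * (bsym b α ξ)⁻¹ =
    (c ^ 2 - 1 : ℝ) * (bsym ((b * c ^ 2 - a) / (c ^ 2 - 1)) α ξ * (bsym b α ξ)⁻¹) := by
  have h1 := bsym_ne_zero h.b_pos.le h.b_mul_sq_lt ξ
  have h2 : ((c ^ 2 - 1 : ℝ) : ℂ) ≠ 0 := by exact_mod_cast h.sq_sub_one_pos.ne'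
  have h3 : (c : ℂ) ^ 2 * bsym b α ξ - bsym a α ξ =
      (c ^ 2 - 1 : ℝ) * bsym ((b * c ^ 2 - a) / (c ^ 2 - 1)) α ξ := by
    simp only [bsym]
    push_cast at h2 ⊢
    field_simp
    ring
  rw [← mul_assoc, ← h3, sub_mul, mul_assoc, mul_inv_cancel₀ h1, mul_one]

lemma γ_mul_sq_lt : (b * c ^ 2 - a) / (c ^ 2 - 1) * α ^ 2 < 1 := by
  rw [div_mul_eq_mul_div, div_lt_one h.sq_sub_one_pos]
  linarith [h.lt_alphaC]

lemma sq_sub_symbol_ne_zero (ξ : ℝ) : (c : ℂ) ^ 2 - bsym a α ξ * (bsym b α ξ)⁻¹ ≠ 0 := by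
  rw [sq_sub_symbol_eq h]
  refine mul_ne_zero (by exact_mod_cast h.sq_sub_one_pos.ne') (mul_ne_zero ?_ ?_)
  · exact bsym_ne_zero (div_pos h.γ_pos h.sq_sub_one_pos).le (γ_mul_sq_lt h) ξ
  · exact inv_ne_zero (bsym_ne_zero h.b_pos.le h.b_mul_sq_lt ξ)

lemma isBddMeas_inv_sq_sub_symbol :
    IsBddMeas fun ξ => ((c : ℂ) ^ 2 - bsym a α ξ * (bsym b α ξ)⁻¹)⁻¹ := by
  simp only [sq_sub_symbol_eq h, mul_inv, inv_inv]
  refine IsBddMeas.const_mul _ ?_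
  simp only [mul_comm]
  exact isBddMeas_bsym_mul_inv_bsym (div_pos h.γ_pos h.sq_sub_one_pos) (γ_mul_sq_lt h)

omit h in
/-- The two branches of the dispersion relation of `L + c∂` in `L²_α`. -/
def branch (a b c α : ℝ) (σ : ℂ) (ξ : ℝ) : ℂ := dsym α ξ * (c + σ * ssym a b α ξ)

omit h in
lemma measurable_branch (a b c α : ℝ) (σ : ℂ) : Measurable (branch a b c α σ) :=
  (continuous_dsym α).measurable.mul ((measurable_ssym a b α).const_mul σ |>.const_add _)

omit h in
/-- The distance of the spectrum of `L + c∂` in `L²_α` from the imaginary axis. -/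
def gap (a b c α : ℝ) : ℝ := α * (c - √((1 - a * α ^ 2) / (1 - b * α ^ 2)))

lemma gap_pos : 0 < gap a b c α := mul_pos h.α_pos (sub_pos.2 h.sqrt_lt)

/-- The transport part contributes `-α c` to the real part, and the key estimate limits what `± d S`
can give back, whichever sign is chosen. -/
lemma branch_re_le {σ : ℂ} (hσ : σ = 1 ∨ σ = -1) (ξ : ℝ) :
    (branch a b c α σ ξ).re ≤ -gap a b c α := by
  have h1 : |(dsym α ξ * ssym a b α ξ).re| ≤ _ :=
    abs_re_dsym_mul_le h.a_pos h.a_lt h.α_pos h.b_mul_sq_lt (by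
      rw [ssym_sq, mul_assoc, inv_mul_cancel₀ (bsym_ne_zero h.b_pos.le h.b_mul_sq_lt ξ), mul_one])
  rw [abs_le] at h1
  have h2 : (branch a b c α σ ξ).re = -α * c + (σ * (dsym α ξ * ssym a b α ξ)).re := by
    have : branch a b c α σ ξ = c * dsym α ξ + σ * (dsym α ξ * ssym a b α ξ) := by
      unfold branch; ring
    rw [this, Complex.add_re, Complex.re_ofReal_mul, dsym_re]
    ring
  rw [h2, gap]
  rcases hσ with rfl | rfl
  · rw [one_mul]; linarith
  · rw [neg_one_mul, Complex.neg_re]; linarith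

lemma branch_re_neg {σ : ℂ} (hσ : σ = 1 ∨ σ = -1) (ξ : ℝ) : (branch a b c α σ ξ).re < 0 :=
  (branch_re_le h hσ ξ).trans_lt (neg_lt_zero.2 (gap_pos h))

end DispersionRelation

/-! ### Operator calculus of Fourier multipliers and `2 × 2` blocks. -/

section Multipliers

variable {α : ℝ}

lemma fm_fm {m n : ℝ → ℂ} (hm : IsBddMeas m) (hn : IsBddMeas n) (f : L2w α) :
    fm α m (fm α n f) = fm α (fun ξ => m ξ * n ξ) f := by
  refine ft_ext ?_
  filter_upwards [ft_fm_coe α hm (fm α n f), ft_fm_coe α hn f, ft_fm_coe α (hm.mul hn) f]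
    with ξ h1 h2 h3
  rw [h1, h2, h3, mul_assoc]

lemma fm_one (f : L2w α) : fm α (fun _ => 1) f = f := by
  refine ft_ext ?_
  filter_upwards [ft_fm_coe α (IsBddMeas.const 1) f] with ξ h1
  rw [h1, one_mul]

lemma norm_fm_le (α : ℝ) {m : ℝ → ℂ} (hm : Measurable m) {C : ℝ} (hC0 : 0 ≤ C)
    (hC : ∀ ξ, ‖m ξ‖ ≤ C) : ‖fm α m‖ ≤ C := by
  refine ContinuousLinearMap.opNorm_le_bound _ hC0 fun f => ?_
  rw [← (ft α).norm_map, ft_fm, ← (ft α).norm_map f]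
  exact (mulOp volume m).le_of_opNorm_le (norm_mulOp_le volume hm hC0 hC) _

lemma isC0Semigroup_fm {ν : ℝ → ℂ} (hν : Measurable ν) (hre : ∀ x, (ν x).re ≤ 0) :
    IsC0Semigroup fun t : ℝ => fm α fun x => Complex.exp (t * ν x) := by
  have h := isC0Semigroup_mulOp (volume : Measure ℝ) hν hre
  refine ⟨?_, fun s t hs ht => ?_, fun f => ?_⟩
  · ext1 f
    refine (ft α).injective ?_
    rw [ft_fm]
    exact congrArg (fun T => T (ft α f)) h.zero
  · ext1 f
    refine (ft α).injective ?_
    rw [ContinuousLinearMap.comp_apply, ft_fm, ft_fm, ft_fm]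
    exact congrArg (fun T => T (ft α f)) (h.add s t hs ht)
  · exact (ft α).symm.continuous.comp_continuousOn (h.continuous (ft α f))

lemma tendsto_fm_exp_iff {ν : ℝ → ℂ} (hν : Measurable ν) (hre : ∀ x, (ν x).re < 0)
    (f g : L2w α) :
    Tendsto (fun t : ℝ => ((t : ℂ)⁻¹) • (fm α (fun x => Complex.exp (t * ν x)) f - f))
      (𝓝[>] 0) (𝓝 g) ↔ ∀ᵐ x, ft α g x = ν x * ft α f x := by
  rw [← tendsto_mulOp_exp_iff volume hν hre,
    (ft α).isometry.isEmbedding.tendsto_nhds_iff]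
  refine iff_of_eq (congrArg (fun F => Tendsto F _ _) (funext fun t => ?_))
  rw [Function.comp_apply, map_smul, map_sub, ft_fm]

/-- The operator on `L²_α` of pairs given by a `2 × 2` matrix of scalar operators. -/
def blockOp (A B C D : L2w α →L[ℂ] L2w α) : State α →L[ℂ] State α :=
  ((WithLp.prodContinuousLinearEquiv 2 ℂ (L2w α) (L2w α)).symm :
      (L2w α × L2w α) →L[ℂ] State α).comp
    (((A.coprod B).prod (C.coprod D)).comp
      (WithLp.prodContinuousLinearEquiv 2 ℂ (L2w α) (L2w α) : State α →L[ℂ] (L2w α × L2w α)))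

@[simp]
lemma blockOp_fst (A B C D : L2w α →L[ℂ] L2w α) (z : State α) :
    (blockOp A B C D z).fst = A z.fst + B z.snd := rfl

@[simp]
lemma blockOp_snd (A B C D : L2w α →L[ℂ] L2w α) (z : State α) :
    (blockOp A B C D z).snd = C z.fst + D z.snd := rfl

lemma State.ext {z w : State α} (h1 : z.fst = w.fst) (h2 : z.snd = w.snd) : z = w :=
  (WithLp.prodContinuousLinearEquiv 2 ℂ (L2w α) (L2w α)).injective (Prod.ext h1 h2)

lemma State.tendsto_iff {ι : Type*} {l : Filter ι} {z : ι → State α} {w : State α} :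
    Tendsto z l (𝓝 w) ↔ Tendsto (fun i => (z i).fst) l (𝓝 w.fst) ∧
      Tendsto (fun i => (z i).snd) l (𝓝 w.snd) := by
  rw [(WithLp.prodContinuousLinearEquiv 2 ℂ (L2w α) (L2w α)).toHomeomorph.isInducing.tendsto_nhds_iff,
    Prod.tendsto_iff]
  rfl

lemma norm_blockOp_diag_le {A D : L2w α →L[ℂ] L2w α} {C : ℝ} (hA : ‖A‖ ≤ C) (hD : ‖D‖ ≤ C) :
    ‖blockOp A 0 0 D‖ ≤ C := by
  have hC : 0 ≤ C := (norm_nonneg _).trans hA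
  refine ContinuousLinearMap.opNorm_le_bound _ hC fun z => ?_
  rw [← sq_le_sq₀ (norm_nonneg _) (by positivity), mul_pow, WithLp.prod_norm_sq_eq_of_L2,
    WithLp.prod_norm_sq_eq_of_L2, mul_add, ← mul_pow, ← mul_pow]
  simp only [blockOp_fst, blockOp_snd, _root_.zero_apply, add_zero, zero_add]
  gcongr
  · exact A.le_of_opNorm_le hA _
  · exact D.le_of_opNorm_le hD _

end Multipliers

end BenneyLuke

namespace BenneyLuke

/-! ### Domain, resolvent and semigroup of `L + c∂`. -/

section FreeOperator

variable {a b c α : ℝ}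

lemma pair_zero_fun (f : L2w α) : pair (fun _ => 0) f = 0 := by simp [pair]

lemma pair_zero (ψ : ℝ → ℝ) : pair ψ (0 : L2w α) = 0 := by
  simpa using pair_smul ψ 0 (0 : L2w α)

/-- For the zero profile the distributional equation has no source, and `1 - b ∂²` is invertible on
`L²_α`, so it can be solved for the second component. -/
lemma mem_L0Graph_iff (h : Admissible a b c α) (z w : State α) :
    (z, w) ∈ L0Graph a b c α ↔ ∃ dq dr : L2w α, HasWeakDeriv z.fst dq ∧ HasWeakDeriv z.snd dr ∧
      w.fst = (c : ℂ) • dq + dr ∧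
      w.snd = (c : ℂ) • dr + fm α (fun ξ => bsym a α ξ * (bsym b α ξ)⁻¹) dq := by
  refine exists_congr fun dq => exists_congr fun dr => and_congr_right fun _ =>
    and_congr_right fun _ => and_congr_right fun _ => ?_
  have e := elliptic_iff (a := a) h.α_pos.le h.b_pos h.b_mul_sq_lt (w.snd + (-c : ℂ) • dr) dq 0
  simp only [pair_zero, sub_zero, map_zero] at e
  simp only [zero_mul, mul_zero, deriv_const', pair_zero_fun, sub_zero]
  rw [e, neg_smul, ← sub_eq_add_neg, sub_eq_iff_eq_add']

/-- The transformation to Fourier variables diagonalizing `L + c∂`. -/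
def diagonalize (a b α : ℝ) : State α →L[ℂ] State α :=
  blockOp (fm α (ssym a b α)) (.id ℂ _) (-fm α (ssym a b α)) (.id ℂ _)

/-- The inverse of `diagonalize`. -/
def undiagonalize (a b α : ℝ) : State α →L[ℂ] State α :=
  blockOp ((2 : ℂ)⁻¹ • fm α fun ξ => (ssym a b α ξ)⁻¹) (-(2 : ℂ)⁻¹ • fm α fun ξ => (ssym a b α ξ)⁻¹)
    ((2 : ℂ)⁻¹ • .id ℂ _) ((2 : ℂ)⁻¹ • .id ℂ _)

variable (h : Admissible a b c α)
include h

lemma undiagonalize_diagonalize (z : State α) : undiagonalize a b α (diagonalize a b α z) = z := by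
  have e (f : L2w α) : fm α (fun ξ => (ssym a b α ξ)⁻¹) (fm α (ssym a b α) f) = f := by
    rw [fm_fm (isBddMeas_inv_ssym h) (isBddMeas_ssym h)]
    simp only [inv_mul_cancel₀ (ssym_ne_zero h _), fm_one]
  apply State.ext
  · simp only [undiagonalize, diagonalize, blockOp_fst, blockOp_snd, _root_.smul_apply,
      _root_.neg_apply, map_add, map_neg, e, ContinuousLinearMap.id_apply]
    module
  · simp only [undiagonalize, diagonalize, blockOp_fst, blockOp_snd, _root_.smul_apply,
      _root_.neg_apply, ContinuousLinearMap.id_apply]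
    module

lemma diagonalize_undiagonalize (z : State α) : diagonalize a b α (undiagonalize a b α z) = z := by
  have e (f : L2w α) : fm α (ssym a b α) (fm α (fun ξ => (ssym a b α ξ)⁻¹) f) = f := by
    rw [fm_fm (isBddMeas_ssym h) (isBddMeas_inv_ssym h)]
    simp only [mul_inv_cancel₀ (ssym_ne_zero h _), fm_one]
  apply State.ext
  · simp only [undiagonalize, diagonalize, blockOp_fst, blockOp_snd, _root_.smul_apply,
      map_add, map_smul, e, ContinuousLinearMap.id_apply]
    module
  · simp only [undiagonalize, diagonalize, blockOp_fst, blockOp_snd, _root_.smul_apply,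
      _root_.neg_apply, map_add, map_smul, e, ContinuousLinearMap.id_apply]
    module

lemma ft_diagonalize_fst (z : State α) : ∀ᵐ ξ, ft α (diagonalize a b α z).fst ξ =
    ssym a b α ξ * ft α z.fst ξ + ft α z.snd ξ := by
  filter_upwards [ft_add_coe (fm α (ssym a b α) z.fst) z.snd,
    ft_fm_coe α (isBddMeas_ssym h) z.fst] with ξ h1 h2
  rw [← h2, ← h1]
  rfl

lemma ft_diagonalize_snd (z : State α) : ∀ᵐ ξ, ft α (diagonalize a b α z).snd ξ =
    ft α z.snd ξ - ssym a b α ξ * ft α z.fst ξ := by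
  filter_upwards [ft_sub_coe z.snd (fm α (ssym a b α) z.fst),
    ft_fm_coe α (isBddMeas_ssym h) z.fst] with ξ h1 h2
  rw [← h2, ← h1]
  congr 2
  simp only [diagonalize, blockOp_snd, _root_.neg_apply, ContinuousLinearMap.id_apply]
  abel_nf

/-- `L + c∂` is diagonal in the variables given by `diagonalize`. -/
theorem mem_L0Graph_iff_ft (z w : State α) : (z, w) ∈ L0Graph a b c α ↔
    (∀ᵐ ξ, ft α (diagonalize a b α w).fst ξ =
      branch a b c α 1 ξ * ft α (diagonalize a b α z).fst ξ) ∧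
    ∀ᵐ ξ, ft α (diagonalize a b α w).snd ξ =
      branch a b c α (-1) ξ * ft α (diagonalize a b α z).snd ξ := by
  have hAB := isBddMeas_bsym_mul_inv_bsym (a := a) h.b_pos h.b_mul_sq_lt
  rw [mem_L0Graph_iff h]
  simp only [hasWeakDeriv_iff_ft h.α_pos.le]
  constructor
  · rintro ⟨dq, dr, h1, h2, h3, h4⟩
    have k3 : ∀ᵐ ξ, ft α w.fst ξ = c * ft α dq ξ + ft α dr ξ := by
      rw [h3]
      filter_upwards [ft_add_coe ((c : ℂ) • dq) dr, ft_smul_coe (c : ℂ) dq] with ξ e1 e2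
      rw [e1, e2]
    have k4 : ∀ᵐ ξ, ft α w.snd ξ = c * ft α dr ξ + ssym a b α ξ ^ 2 * ft α dq ξ := by
      rw [h4]
      filter_upwards [ft_add_coe ((c : ℂ) • dr) (fm α _ dq), ft_smul_coe (c : ℂ) dr,
        ft_fm_coe α hAB dq] with ξ e1 e2 e3
      rw [e1, e2, e3, ssym_sq]
    constructor
    · filter_upwards [h1, h2, k3, k4, ft_diagonalize_fst h z, ft_diagonalize_fst h w]
        with ξ e1 e2 e3 e4 e5 e6
      rw [e6, e5, e3, e4, e1, e2, branch]
      ring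
    · filter_upwards [h1, h2, k3, k4, ft_diagonalize_snd h z, ft_diagonalize_snd h w]
        with ξ e1 e2 e3 e4 e5 e6
      rw [e6, e5, e3, e4, e1, e2, branch]
      ring
  · rintro ⟨h1, h2⟩
    have k1 : ∀ᵐ ξ, ft α w.fst ξ = dsym α ξ * (c * ft α z.fst ξ + ft α z.snd ξ) := by
      filter_upwards [h1, h2, ft_diagonalize_fst h z, ft_diagonalize_fst h w,
        ft_diagonalize_snd h z, ft_diagonalize_snd h w] with ξ e1 e2 e3 e4 e5 e6
      rw [e3, e4, branch] at e1
      rw [e5, e6, branch] at e2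
      have := ssym_ne_zero h ξ
      refine mul_left_cancel₀ (mul_ne_zero two_ne_zero this) ?_
      linear_combination e1 - e2
    have k2 : ∀ᵐ ξ, ft α w.snd ξ =
        dsym α ξ * (c * ft α z.snd ξ + ssym a b α ξ ^ 2 * ft α z.fst ξ) := by
      filter_upwards [h1, h2, ft_diagonalize_fst h z, ft_diagonalize_fst h w,
        ft_diagonalize_snd h z, ft_diagonalize_snd h w] with ξ e1 e2 e3 e4 e5 e6
      rw [e3, e4, branch] at e1
      rw [e5, e6, branch] at e2
      linear_combination (e1 + e2) / 2
    -- The derivative of `q` must be exhibited as an element of `L²_α`. Eliminating `dr` from the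
    -- two rows gives `c w₁ - w₂ = (c² - A / B) dq`, and the inverse of this factor is a bounded
    -- multiplier.
    set dq := fm α (fun ξ => ((c : ℂ) ^ 2 - bsym a α ξ * (bsym b α ξ)⁻¹)⁻¹)
      ((c : ℂ) • w.fst - w.snd) with hdq
    have k3 : ∀ᵐ ξ, ft α dq ξ = dsym α ξ * ft α z.fst ξ := by
      filter_upwards [k1, k2, ft_fm_coe α (isBddMeas_inv_sq_sub_symbol h) ((c : ℂ) • w.fst - w.snd),
        ft_sub_coe ((c : ℂ) • w.fst) w.snd, ft_smul_coe (c : ℂ) w.fst] with ξ e1 e2 e3 e4 e5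
      rw [hdq, e3, e4, e5, e1, e2, ssym_sq]
      have := sq_sub_symbol_ne_zero h ξ
      rw [inv_mul_eq_iff_eq_mul₀ this]
      ring
    refine ⟨dq, w.fst - (c : ℂ) • dq, k3, ?_, by abel, ?_⟩
    · filter_upwards [k1, k3, ft_sub_coe w.fst ((c : ℂ) • dq), ft_smul_coe (c : ℂ) dq]
        with ξ e1 e2 e3 e4
      rw [e3, e4, e1, e2]
      ring
    · refine ft_ext ?_
      filter_upwards [k1, k2, k3, ft_sub_coe w.fst ((c : ℂ) • dq), ft_smul_coe (c : ℂ) dq,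
        ft_add_coe ((c : ℂ) • (w.fst - (c : ℂ) • dq)) (fm α _ dq),
        ft_smul_coe (c : ℂ) (w.fst - (c : ℂ) • dq), ft_fm_coe α hAB dq]
        with ξ e1 e2 e3 e4 e5 e6 e7 e8
      rw [e6, e7, e8, e4, e5, e1, e2, e3, ssym_sq]
      ring

/-- The relation is single-valued: above `z = 0` the diagonal form forces `diagonalize w = 0`, and
`diagonalize` is injective. -/
lemma L0_graph_eq : (L0 a b c α).graph = L0Graph a b c α := by
  refine Submodule.toLinearPMap_graph_eq _ ?_
  rintro ⟨z, w⟩ hzw hz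
  obtain rfl : z = 0 := hz
  rw [mem_L0Graph_iff_ft h] at hzw
  have h0 : ∀ᵐ ξ, ft α (0 : L2w α) ξ = 0 := by
    rw [map_zero]; exact Lp.coeFn_zero _ _ _
  have hw : diagonalize a b α w = 0 := by
    rw [map_zero] at hzw
    apply State.ext
    · refine ft_ext ?_
      filter_upwards [hzw.1, h0] with ξ e1 e2
      simp only [WithLp.zero_fst] at e1 ⊢
      rw [e1, e2, mul_zero]
    · refine ft_ext ?_
      filter_upwards [hzw.2, h0] with ξ e1 e2
      simp only [WithLp.zero_snd] at e1 ⊢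
      rw [e1, e2, mul_zero]
  have := undiagonalize_diagonalize h w
  rw [hw, map_zero] at this
  exact this.symm

lemma mem_L0_domain_iff (z : State α) : z ∈ (L0 a b c α).domain ↔
    MemH1w α z.fst ∧ MemH1w α z.snd := by
  rw [LinearPMap.mem_domain_iff, L0_graph_eq h]
  simp only [mem_L0Graph_iff h, memH1w_iff]
  constructor
  · rintro ⟨w, dq, dr, h1, h2, -⟩
    exact ⟨⟨dq, h1⟩, ⟨dr, h2⟩⟩
  · rintro ⟨⟨dq, h1⟩, ⟨dr, h2⟩⟩
    exact ⟨WithLp.toLp 2 (_, _), dq, dr, h1, h2, rfl, rfl⟩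

omit h in
lemma isResolventAt_of_graph {E : Type*} [NormedAddCommGroup E] [NormedSpace ℂ E]
    {T : E →ₗ.[ℂ] E} {lam : ℂ} {R : E →L[ℂ] E} (h1 : ∀ z w, (z, w) ∈ T.graph → R (lam • z - w) = z)
    (h2 : ∀ w, (R w, lam • R w - w) ∈ T.graph) : IsResolventAt T lam R := by
  refine ⟨fun z => ?_, fun w => ?_⟩
  · rw [shifted_apply]
    exact h1 _ _ (T.mem_graph z)
  · obtain ⟨y, hy1, hy2⟩ := T.mem_graph_iff.1 (h2 w)
    dsimp only at hy1 hy2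
    refine ⟨hy1 ▸ y.2, ?_⟩
    have : (⟨R w, hy1 ▸ y.2⟩ : T.domain) = y := Subtype.ext hy1.symm
    rw [this, shifted_apply, hy2, hy1]
    abel

omit h in
/-- The resolvent of `L + c∂` in `L²_α`. -/
def freeResolvent (a b c α : ℝ) (lam : ℂ) : State α →L[ℂ] State α :=
  (undiagonalize a b α).comp
    ((blockOp (fm α fun ξ => (lam - branch a b c α 1 ξ)⁻¹) 0 0
      (fm α fun ξ => (lam - branch a b c α (-1) ξ)⁻¹)).comp (diagonalize a b α))

lemma le_norm_sub_branch {σ : ℂ} (hσ : σ = 1 ∨ σ = -1) (lam : ℂ) (ξ : ℝ) :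
    lam.re + gap a b c α ≤ ‖lam - branch a b c α σ ξ‖ := by
  refine le_trans ?_ (Complex.re_le_norm _)
  rw [Complex.sub_re]
  linarith [branch_re_le h hσ ξ]

/-- The decay as `lam.re → ∞` is what later provides a point where the compact perturbation times
the resolvent is a strict contraction. -/
lemma norm_freeResolvent_le {lam : ℂ} (hl : -gap a b c α < lam.re) :
    ‖freeResolvent a b c α lam‖ ≤
      ‖undiagonalize a b α‖ * ‖diagonalize a b α‖ * (lam.re + gap a b c α)⁻¹ := by
  have hp : 0 < lam.re + gap a b c α := by linarith
  have hb {σ : ℂ} (hσ : σ = 1 ∨ σ = -1) :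
      ‖fm α fun ξ => (lam - branch a b c α σ ξ)⁻¹‖ ≤ (lam.re + gap a b c α)⁻¹ := by
    refine norm_fm_le α ((measurable_branch a b c α σ).const_sub _).inv (by positivity) fun ξ => ?_
    refine (norm_inv _).trans_le ?_
    exact inv_anti₀ hp (le_norm_sub_branch h hσ lam ξ)
  refine (ContinuousLinearMap.opNorm_comp_le _ _).trans ?_
  rw [mul_assoc]
  gcongr
  refine (ContinuousLinearMap.opNorm_comp_le _ _).trans ?_
  rw [mul_comm]
  gcongr
  exact norm_blockOp_diag_le (hb (.inl rfl)) (hb (.inr rfl))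

lemma isResolventAt_freeResolvent {lam : ℂ} (hl : -gap a b c α < lam.re) :
    IsResolventAt (L0 a b c α) lam (freeResolvent a b c α lam) := by
  have hp : 0 < lam.re + gap a b c α := by linarith
  have hne {σ : ℂ} (hσ : σ = 1 ∨ σ = -1) (ξ : ℝ) : lam - branch a b c α σ ξ ≠ 0 :=
    norm_pos_iff.1 (hp.trans_le (le_norm_sub_branch h hσ lam ξ))
  have hbm {σ : ℂ} (hσ : σ = 1 ∨ σ = -1) : IsBddMeas fun ξ => (lam - branch a b c α σ ξ)⁻¹ :=
    isBddMeas_inv ((measurable_branch a b c α σ).const_sub _) hp (le_norm_sub_branch h hσ lam)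
  have key {σ : ℂ} (hσ : σ = 1 ∨ σ = -1) (f g : L2w α)
      (hfg : ∀ᵐ ξ, ft α g ξ = branch a b c α σ ξ * ft α f ξ) :
      fm α (fun ξ => (lam - branch a b c α σ ξ)⁻¹) (lam • f - g) = f := by
    refine ft_ext ?_
    filter_upwards [ft_fm_coe α (hbm hσ) (lam • f - g), ft_sub_coe (lam • f) g, ft_smul_coe lam f,
      hfg] with ξ e1 e2 e3 e4
    rw [e1, e2, e3, e4, inv_mul_eq_iff_eq_mul₀ (hne hσ ξ)]
    ring
  have key2 {σ : ℂ} (hσ : σ = 1 ∨ σ = -1) (f : L2w α) :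
      ∀ᵐ ξ, ft α (lam • fm α (fun ξ => (lam - branch a b c α σ ξ)⁻¹) f - f) ξ =
        branch a b c α σ ξ * ft α (fm α (fun ξ => (lam - branch a b c α σ ξ)⁻¹) f) ξ := by
    filter_upwards [ft_fm_coe α (hbm hσ) f, ft_sub_coe (lam • fm α _ f) f,
      ft_smul_coe lam (fm α _ f)] with ξ e1 e2 e3
    rw [e2, e3, e1]
    have := hne hσ ξ
    field_simp
    ring
  refine isResolventAt_of_graph (fun z w hzw => ?_) fun w => ?_
  · rw [L0_graph_eq h, mem_L0Graph_iff_ft h] at hzw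
    rw [freeResolvent, ContinuousLinearMap.comp_apply, ContinuousLinearMap.comp_apply]
    conv_rhs => rw [← undiagonalize_diagonalize h z]
    congr 1
    rw [map_sub, map_smul]
    apply State.ext
    · simpa using key (.inl rfl) _ _ hzw.1
    · simpa using key (.inr rfl) _ _ hzw.2
  · rw [L0_graph_eq h, mem_L0Graph_iff_ft h]
    simp only [freeResolvent, ContinuousLinearMap.comp_apply, map_sub, map_smul,
      diagonalize_undiagonalize h]
    constructor
    · simpa using key2 (.inl rfl) (diagonalize a b α w).fst
    · simpa using key2 (.inr rfl) (diagonalize a b α w).snd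

omit h in
/-- The semigroup generated by `L + c∂` in `L²_α`. -/
def freeSemigroup (a b c α : ℝ) (t : ℝ) : State α →L[ℂ] State α :=
  (undiagonalize a b α).comp
    ((blockOp (fm α fun ξ => Complex.exp (t * branch a b c α 1 ξ)) 0 0
      (fm α fun ξ => Complex.exp (t * branch a b c α (-1) ξ))).comp (diagonalize a b α))

lemma norm_freeSemigroup_le {t : ℝ} (ht : 0 ≤ t) :
    ‖freeSemigroup a b c α t‖ ≤ ‖undiagonalize a b α‖ * ‖diagonalize a b α‖ := by
  have hb {σ : ℂ} (hσ : σ = 1 ∨ σ = -1) :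
      ‖fm α fun ξ => Complex.exp (t * branch a b c α σ ξ)‖ ≤ 1 := by
    refine norm_fm_le α ((measurable_branch a b c α σ).const_mul _).cexp zero_le_one fun ξ => ?_
    rw [Complex.norm_exp, Complex.re_ofReal_mul]
    exact Real.exp_le_one_iff.2 (mul_nonpos_of_nonneg_of_nonpos ht (branch_re_neg h hσ ξ).le)
  refine (ContinuousLinearMap.opNorm_comp_le _ _).trans ?_
  gcongr
  refine (ContinuousLinearMap.opNorm_comp_le _ _).trans ?_
  conv_rhs => rw [← one_mul ‖diagonalize a b α‖]
  gcongr
  exact norm_blockOp_diag_le (hb (.inl rfl)) (hb (.inr rfl))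

lemma isC0Semigroup_freeSemigroup : IsC0Semigroup (freeSemigroup a b c α) := by
  have hs {σ : ℂ} (hσ : σ = 1 ∨ σ = -1) :=
    isC0Semigroup_fm (α := α) (measurable_branch a b c α σ) fun x => (branch_re_neg h hσ x).le
  have h1 := hs (.inl rfl)
  have h2 := hs (.inr rfl)
  refine ⟨?_, fun s t hs ht => ?_, fun z t ht => ?_⟩
  · ext1 z
    rw [freeSemigroup, ContinuousLinearMap.comp_apply, ContinuousLinearMap.comp_apply, h1.zero,
      h2.zero]
    conv_rhs => rw [ContinuousLinearMap.id_apply, ← undiagonalize_diagonalize h z]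
    congr 1
    apply State.ext <;> simp
  · ext1 z
    simp only [freeSemigroup, ContinuousLinearMap.comp_apply, h1.add s t hs ht, h2.add s t hs ht,
      diagonalize_undiagonalize h]
    congr 1
    apply State.ext <;> simp
  · refine ((undiagonalize a b α).continuous.tendsto _).comp (State.tendsto_iff.2 ⟨?_, ?_⟩)
    · simpa using (h1.continuous (diagonalize a b α z).fst t ht).tendsto
    · simpa using (h2.continuous (diagonalize a b α z).snd t ht).tendsto

/-- Conjugation by the bounded invertible map `diagonalize` preserves convergence of difference
quotients, so the claim reduces to the two scalar multiplication semigroups. -/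
lemma isGenerator_freeSemigroup : IsGenerator (L0 a b c α) (freeSemigroup a b c α) := by
  intro z w
  have hg {σ : ℂ} (hσ : σ = 1 ∨ σ = -1) := fun f g =>
    tendsto_fm_exp_iff (α := α) (measurable_branch a b c α σ) (branch_re_neg h hσ) f g
  rw [L0_graph_eq h, mem_L0Graph_iff_ft h, ← hg (.inl rfl), ← hg (.inr rfl)]
  set D : ℝ → State α := fun t => blockOp (fm α fun ξ => Complex.exp (t * branch a b c α 1 ξ)) 0 0
      (fm α fun ξ => Complex.exp (t * branch a b c α (-1) ξ)) (diagonalize a b α z) with hD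
  have e1 : Tendsto (fun t : ℝ => ((t : ℂ)⁻¹) • (D t - diagonalize a b α z)) (𝓝[>] 0)
      (𝓝 (diagonalize a b α w)) ↔
      Tendsto (fun t : ℝ => ((t : ℂ)⁻¹) • (freeSemigroup a b c α t z - z)) (𝓝[>] 0) (𝓝 w) := by
    constructor
    · intro ht
      have := ((undiagonalize a b α).continuous.tendsto _).comp ht
      rw [undiagonalize_diagonalize h] at this
      refine this.congr fun t => ?_
      rw [Function.comp_apply, map_smul, map_sub, undiagonalize_diagonalize h]
      rfl
    · intro ht
      refine (((diagonalize a b α).continuous.tendsto _).comp ht).congr fun t => ?_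
      rw [Function.comp_apply, map_smul, map_sub, freeSemigroup, ContinuousLinearMap.comp_apply,
        diagonalize_undiagonalize h]
      rfl
  rw [← e1, State.tendsto_iff]
  simp [hD]

end FreeOperator

end BenneyLuke

namespace BenneyLuke

/-! ### Compactness of `m(D) φ(x)` for symbols vanishing at infinity. -/

section CompactMultipliers

open FourierTransform
open scoped ComplexConjugate

lemma fourier_eq_integral (F : ℝ → ℂ) (ξ : ℝ) :
    𝓕 F ξ = ∫ x, Complex.exp (-(2 * Real.pi * x * ξ : ℝ) * Complex.I) * F x := by
  rw [Real.fourier_eq']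
  refine integral_congr_ae (Eventually.of_forall fun x => ?_)
  simp only [smul_eq_mul, RCLike.inner_apply, conj_trivial]
  congr 3
  push_cast
  ring

/-- The `L²` Fourier transform of an integrable function is given by the Fourier integral. -/
lemma fourier_coe_of_integrable {F : Lp ℂ 2 (volume : Measure ℝ)} (hF : Integrable F) :
    (𝓕 F : Lp ℂ 2 (volume : Measure ℝ)) =ᵐ[volume] 𝓕 (F : ℝ → ℂ) := by
  have hcont : Continuous (𝓕 (F : ℝ → ℂ)) :=
    VectorFourier.fourierIntegral_continuous Real.continuous_fourierChar continuous_inner hF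
  refine ae_eq_of_integral_contDiff_smul_eq ((Lp.memLp _).locallyIntegrable (by norm_num))
    hcont.locallyIntegrable fun g hg hgs => ?_
  have hsm : ContDiff ℝ ∞ fun x : ℝ => (g x : ℂ) := Complex.ofRealCLM.contDiff.comp hg
  have hcs : HasCompactSupport fun x : ℝ => (g x : ℂ) :=
    hgs.comp_left (g := fun r : ℝ => (r : ℂ)) Complex.ofReal_zero
  set S : SchwartzMap ℝ ℂ := hcs.toSchwartzMap hsm
  have h1 := congrArg (fun u => u S) (Lp.fourier_toTemperedDistribution_eq F)
  simp only [TemperedDistribution.fourier_apply, Lp.toTemperedDistribution_apply] at h1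
  have hS : Integrable (S : ℝ → ℂ) := S.integrable
  have h2 := VectorFourier.integral_fourierIntegral_smul_eq_flip (L := innerₗ ℝ)
    Real.continuous_fourierChar continuous_inner hS hF
  rw [flip_innerₗ] at h2
  have h3 : ∫ x, (𝓕 S) x • F x = ∫ x, S x • 𝓕 (F : ℝ → ℂ) x := h2
  rw [h3] at h1
  exact h1.symm

/-- The multiplier operator `m(D) φ` on `L²`. -/
def mulFourierMul (m φ : ℝ → ℂ) : Lp ℂ 2 (volume : Measure ℝ) →L[ℂ] Lp ℂ 2 (volume : Measure ℝ) :=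
  (mulOp volume m).comp
    (((Lp.fourierTransformₗᵢ ℝ ℂ).toContinuousLinearEquiv : Lp ℂ 2 (volume : Measure ℝ) →L[ℂ] _).comp
      (mulOp volume φ))

lemma memLp_of_eq_zero {m : ℝ → ℂ} (hm : IsBddMeas m) {N : ℝ} (h : ∀ x, N < |x| → m x = 0) :
    MemLp m 2 volume := by
  obtain ⟨hmm, C, hC⟩ := hm
  have h1 : MemLp m 2 (volume.restrict (Set.Icc (-N) N)) :=
    MemLp.of_bound hmm.aestronglyMeasurable C (Eventually.of_forall hC)
  have h2 : (Set.Icc (-N) N).indicator m = m := by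
    refine Set.indicator_eq_self.2 fun x hx => ?_
    rw [Set.mem_Icc, ← abs_le]
    by_contra! h3
    exact hx (h x h3)
  rw [← h2]
  exact (memLp_indicator_iff_restrict measurableSet_Icc).2 h1

/-- The Taylor approximation of the operator `m(D) φ`. -/
lemma isCompactOperator_mulFourierMul_of_eq_zero {m φ : ℝ → ℂ} (hm : IsBddMeas m)
    (hφ : IsBddMeas φ) {N : ℝ} (hN : 0 < N) (hm0 : ∀ x, N < |x| → m x = 0)
    (hφ0 : ∀ x, N < |x| → φ x = 0) : IsCompactOperator (mulFourierMul m φ) := by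
  have hpow {u : ℝ → ℂ} (hu : IsBddMeas u) (hu0 : ∀ x, N < |x| → u x = 0) (k : ℕ) :
      IsBddMeas fun x : ℝ => (x : ℂ) ^ k * u x := by
    obtain ⟨h1, C, hC⟩ := hu
    refine ⟨(Complex.measurable_ofReal.pow_const k).mul h1, N ^ k * C, fun x => ?_⟩
    have hC0 : 0 ≤ C := (norm_nonneg _).trans (hC x)
    rcases le_or_gt |x| N with hx | hx
    · rw [norm_mul, norm_pow, Complex.norm_real, Real.norm_eq_abs]
      gcongr
      exact hC x
    · simp only [hu0 x hx, mul_zero, norm_zero]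
      positivity
  have hL {u : ℝ → ℂ} (hu : IsBddMeas u) (hu0 : ∀ x, N < |x| → u x = 0) (k : ℕ) :
      MemLp (fun x : ℝ => (x : ℂ) ^ k * u x) 2 volume :=
    memLp_of_eq_zero (hpow hu hu0 k) fun x hx => by rw [hu0 x hx, mul_zero]
  have hφs : IsBddMeas fun x => conj (φ x) :=
    ⟨Complex.continuous_conj.measurable.comp hφ.1, by simpa using hφ.2⟩
  have hφs0 : ∀ x, N < |x| → conj (φ x) = 0 := fun x hx => by rw [hφ0 x hx, map_zero]
  -- The kernel `m(ξ) e^{-2πixξ} φ(x)` has compact support. Expanding the exponential in powers of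
  -- `x ξ` gives terms `coef k · ξᵏ m(ξ) · xᵏ φ(x)` of rank at most one; the conjugate of `φ`
  -- appears because the inner product is conjugate-linear in its first variable.
  set u : ℕ → Lp ℂ 2 (volume : Measure ℝ) := fun k => (hL hφs hφs0 k).toLp
  set v : ℕ → Lp ℂ 2 (volume : Measure ℝ) := fun k => (hL hm hm0 k).toLp
  set coef : ℕ → ℂ := fun k => (-(2 * Real.pi) * Complex.I) ^ k / k.factorial
  set A : ℕ → Lp ℂ 2 (volume : Measure ℝ) →L[ℂ] Lp ℂ 2 (volume : Measure ℝ) := fun n =>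
    ∑ k ∈ Finset.range n, (innerSL ℂ (u k)).smulRight (coef k • v k) with hA
  have hAc (n : ℕ) : IsCompactOperator (A n) := by
    rw [hA]
    induction n with
    | zero =>
      simp only [Finset.range_zero, Finset.sum_empty]
      exact isCompactOperator_zero
    | succ n ih =>
      have hc := (isCompactOperator_of_locallyCompactSpace_dom (innerSL ℂ (u n))).clm_comp
        ((ContinuousLinearMap.id ℂ ℂ).smulRight (coef n • v n))
      have e : A (n + 1) = A n + (innerSL ℂ (u n)).smulRight (coef n • v n) := by
        simp only [hA, Finset.sum_range_succ]
      rw [← hA] at ih ⊢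
      rw [e]
      exact ih.add hc
  set mL : Lp ℂ 2 (volume : Measure ℝ) := (memLp_of_eq_zero hm hm0).toLp
  set φL : Lp ℂ 2 (volume : Measure ℝ) := (memLp_of_eq_zero hφ hφ0).toLp
  set ρ : ℝ := 2 * Real.pi * N * N with hρ
  have hρ0 : 0 < ρ := by positivity
  -- Remainder of the exponential series for arguments of modulus at most `ρ`, the largest value of
  -- `|2πxξ|` on the supports; the bound is valid once `ρ / (n + 1) ≤ 1 / 2`.
  set ε : ℕ → ℝ := fun n => ρ ^ n / n.factorial * 2 with hε
  have hε0 : Tendsto ε atTop (𝓝 0) := by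
    simpa using (FloorSemiring.tendsto_pow_div_factorial_atTop ρ).mul_const 2
  have key : ∀ᶠ n : ℕ in atTop, ‖A n - mulFourierMul m φ‖ ≤ ε n * (‖φL‖ * ‖mL‖) := by
    have hev : ∀ᶠ n : ℕ in atTop, ρ / (n.succ : ℝ) ≤ 1 / 2 := by
      filter_upwards [eventually_ge_atTop ⌈2 * ρ⌉₊] with n hn
      have : 2 * ρ ≤ n := (Nat.le_ceil _).trans (by exact_mod_cast hn)
      rw [div_le_iff₀ (by positivity)]
      push_cast
      linarith
    filter_upwards [hev] with n hn
    refine ContinuousLinearMap.opNorm_le_bound _ (by positivity) fun f => ?_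
    have hbound : ∀ x ξ : ℝ, |x| ≤ N → |ξ| ≤ N →
        ‖∑ k ∈ Finset.range n, (-(2 * Real.pi * x * ξ : ℝ) * Complex.I) ^ k / (k.factorial : ℂ) -
          Complex.exp (-(2 * Real.pi * x * ξ : ℝ) * Complex.I)‖ ≤ ε n := by
      intro x ξ hx hξ
      have h1 : ‖(-(2 * Real.pi * x * ξ : ℝ) * Complex.I : ℂ)‖ ≤ ρ := by
        rw [norm_mul, Complex.norm_I, mul_one, norm_neg, Complex.norm_real, Real.norm_eq_abs,
          abs_mul, abs_mul, abs_of_pos (by positivity : 0 < 2 * Real.pi), hρ]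
        gcongr
      rw [norm_sub_rev]
      refine (Complex.exp_bound' (le_trans ?_ hn)).trans ?_
      · gcongr
      · rw [hε]; dsimp only; gcongr
    set g := mulOp volume φ f with hg
    have hgc : g =ᵐ[volume] fun x => φ x * f x := mulOp_coe volume hφ f
    have hfi {w : ℝ → ℂ} (hw : MemLp w 2 volume) : Integrable fun x => w x * f x :=
      hw.integrable_mul (Lp.memLp f)
    have hgi : Integrable g := (hfi (memLp_of_eq_zero hφ hφ0)).congr hgc.symm
    have hterm (k : ℕ) (ξ x : ℝ) :
        (-(2 * Real.pi * x * ξ : ℝ) * Complex.I) ^ k / (k.factorial : ℂ) * (φ x * f x) =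
          (coef k * (ξ : ℂ) ^ k) * ((x : ℂ) ^ k * (φ x * f x)) := by
      simp only [coef]
      push_cast
      ring
    have hik (k : ℕ) (ξ : ℝ) : Integrable fun x : ℝ =>
        (-(2 * Real.pi * x * ξ : ℝ) * Complex.I) ^ k / (k.factorial : ℂ) * (φ x * f x) := by
      simp only [hterm]
      refine Integrable.const_mul ?_ _
      simp only [← mul_assoc]
      exact hfi (hL hφ hφ0 k)
    have hl1 : ∫ x, ‖φ x * f x‖ ≤ ‖φL‖ * ‖f‖ := by
      have h2 := integral_mul_norm_le_Lp_mul_Lq (μ := (volume : Measure ℝ)) (f := φ) (g := f)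
        (p := 2) (q := 2) (by constructor <;> norm_num)
        (by simpa using memLp_of_eq_zero hφ hφ0) (by simpa using Lp.memLp f)
      have h3 {w : ℝ → ℂ} (hw : MemLp w 2 volume) :
          (eLpNorm w 2 volume).toReal = (∫ x, ‖w x‖ ^ (2 : ℝ)) ^ (1 / (2 : ℝ)) := by
        rw [hw.eLpNorm_eq_integral_rpow_norm (by norm_num) (by norm_num),
          ENNReal.toReal_ofReal (by positivity)]
        simp
      rw [← h3 (memLp_of_eq_zero hφ hφ0), ← h3 (Lp.memLp f), ← Lp.norm_def f,
        ← Lp.norm_toLp _ (memLp_of_eq_zero hφ hφ0)] at h2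
      simpa only [norm_mul] using h2
    have hmain : ∀ᵐ ξ, ‖((A n - mulFourierMul m φ) f) ξ‖ ≤ (ε n * (‖φL‖ * ‖f‖)) * ‖mL ξ‖ := by
      have e1 : (mulFourierMul m φ f) =ᵐ[volume] fun ξ => m ξ * 𝓕 (g : ℝ → ℂ) ξ := by
        filter_upwards [mulOp_coe volume hm (𝓕 g), fourier_coe_of_integrable hgi] with ξ h1 h2
        rw [← h2, ← h1]
        rfl
      have e2 : (A n f) =ᵐ[volume] fun ξ => ∑ k ∈ Finset.range n,
          coef k * ((ξ : ℂ) ^ k * m ξ) * ∫ x : ℝ, (x : ℂ) ^ k * (φ x * f x) := by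
        clear hn hbound
        induction n with
        | zero =>
          have : A 0 f = 0 := by simp [hA]
          rw [this]
          simp only [Finset.range_zero, Finset.sum_empty]
          exact Lp.coeFn_zero _ _ _
        | succ n ih =>
          have e : A (n + 1) f = A n f + (inner ℂ (u n) f * coef n) • v n := by
            simp only [hA, Finset.sum_range_succ, _root_.add_apply,
              ContinuousLinearMap.smulRight_apply, innerSL_apply_apply, smul_smul]
          have ei : inner ℂ (u n) f = ∫ x : ℝ, (x : ℂ) ^ n * (φ x * f x) := by
            rw [L2.inner_def]
            refine integral_congr_ae ?_
            filter_upwards [(hL hφs hφs0 n).coeFn_toLp] with x hx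
            rw [RCLike.inner_apply, hx, map_mul, map_pow, Complex.conj_ofReal, Complex.conj_conj]
            ring
          rw [e]
          filter_upwards [ih, Lp.coeFn_add (A n f) ((inner ℂ (u n) f * coef n) • v n),
            Lp.coeFn_smul (inner ℂ (u n) f * coef n) (v n), (hL hm hm0 n).coeFn_toLp]
            with ξ h1 h2 h3 h4
          rw [h2, Pi.add_apply, h1, h3, Pi.smul_apply, h4, Finset.sum_range_succ, ei, smul_eq_mul]
          ring
      filter_upwards [e1, e2, Lp.coeFn_sub (A n f) (mulFourierMul m φ f),
        (memLp_of_eq_zero hm hm0).coeFn_toLp] with ξ h1 h2 h3 h4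
      rw [_root_.sub_apply, h3, Pi.sub_apply, h1, h2, h4]
      have e3 : 𝓕 (g : ℝ → ℂ) ξ =
          ∫ x, Complex.exp (-(2 * Real.pi * x * ξ : ℝ) * Complex.I) * (φ x * f x) := by
        rw [fourier_eq_integral]
        refine integral_congr_ae ?_
        filter_upwards [hgc] with x hx
        rw [hx]
      have e4 : ∑ k ∈ Finset.range n, coef k * ((ξ : ℂ) ^ k * m ξ) * ∫ x : ℝ, (x : ℂ) ^ k * (φ x * f x) =
          m ξ * ∫ x, (∑ k ∈ Finset.range n,
            (-(2 * Real.pi * x * ξ : ℝ) * Complex.I) ^ k / (k.factorial : ℂ)) * (φ x * f x) := by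
        simp only [Finset.sum_mul]
        rw [integral_finsetSum _ fun k _ => hik k ξ, Finset.mul_sum]
        refine Finset.sum_congr rfl fun k _ => ?_
        simp only [hterm k ξ]
        rw [integral_const_mul]
        ring
      have hi1 : Integrable fun x : ℝ => (∑ k ∈ Finset.range n,
            (-(2 * Real.pi * x * ξ : ℝ) * Complex.I) ^ k / (k.factorial : ℂ)) * (φ x * f x) := by
        simp only [Finset.sum_mul]
        exact integrable_finsetSum _ fun k _ => hik k ξ
      have hi2 : Integrable fun x : ℝ =>
          Complex.exp (-(2 * Real.pi * x * ξ : ℝ) * Complex.I) * (φ x * f x) := by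
        refine (hfi (memLp_of_eq_zero hφ hφ0)).bdd_mul (c := 1)
          (Continuous.aestronglyMeasurable (by fun_prop)) (Eventually.of_forall fun x => ?_)
        rw [← Complex.ofReal_neg, Complex.norm_exp_ofReal_mul_I]
      rw [e3, e4, ← mul_sub, ← integral_sub hi1 hi2, norm_mul, mul_comm]
      rcases le_or_gt |ξ| N with hξ | hξ
      · gcongr
        calc _ ≤ ∫ x, ε n * ‖φ x * f x‖ := by
              refine norm_integral_le_of_norm_le
                ((hfi (memLp_of_eq_zero hφ hφ0)).norm.const_mul _) (Eventually.of_forall fun x => ?_)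
              rw [← sub_mul, norm_mul]
              rcases le_or_gt |x| N with hx | hx
              · gcongr
                exact hbound x ξ hx hξ
              · rw [hφ0 x hx, zero_mul, norm_zero, mul_zero, mul_zero]
          _ ≤ _ := by
              rw [integral_const_mul]
              gcongr
      · rw [hm0 ξ hξ, norm_zero, mul_zero, mul_zero]
    refine (Lp.norm_le_mul_norm_of_ae_le_mul hmain).trans (le_of_eq ?_)
    ring
  refine isCompactOperator_of_tendsto (l := atTop) (F := A) ?_ (Eventually.of_forall hAc)
  rw [tendsto_iff_norm_sub_tendsto_zero]
  refine squeeze_zero' (Eventually.of_forall fun _ => norm_nonneg _) key ?_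
  simpa using hε0.mul_const (‖φL‖ * ‖mL‖)

/-- Truncation of a function to `[-n, n]`. -/
def truncate (m : ℝ → ℂ) (n : ℕ) (x : ℝ) : ℂ := if |x| ≤ (n : ℝ) + 1 then m x else 0

lemma truncate_eq_zero (m : ℝ → ℂ) (n : ℕ) (x : ℝ) (hx : (n : ℝ) + 1 < |x|) :
    truncate m n x = 0 := if_neg hx.not_ge

lemma isBddMeas_truncate {m : ℝ → ℂ} (hm : IsBddMeas m) (n : ℕ) : IsBddMeas (truncate m n) := by
  obtain ⟨h1, C, hC⟩ := hm
  refine ⟨Measurable.ite (measurableSet_le (by fun_prop) measurable_const) h1 measurable_const, C,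
    fun x => ?_⟩
  unfold truncate
  split_ifs
  · exact hC x
  · rw [norm_zero]
    exact (norm_nonneg _).trans (hC x)

/-- The operator norm is at most the supremum norm, and a function vanishing at infinity is a
uniform limit of its truncations. -/
lemma tendsto_mulOp_truncate {m : ℝ → ℂ} (hm : IsBddMeas m)
    (h0 : Tendsto m (cocompact ℝ) (𝓝 0)) :
    Tendsto (fun n => mulOp volume (truncate m n)) atTop (𝓝 (mulOp volume m)) := by
  rw [Metric.tendsto_atTop]
  intro ε hε
  have h1 : ∀ᶠ x in cocompact ℝ, ‖m x‖ < ε / 2 :=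
    (tendsto_zero_iff_norm_tendsto_zero.1 h0).eventually_lt_const (half_pos hε)
  rw [← Metric.cobounded_eq_cocompact, ← comap_norm_atTop, eventually_comap] at h1
  obtain ⟨r, hr⟩ := eventually_atTop.1 h1
  refine ⟨⌈r⌉₊, fun n hn => ?_⟩
  have hrn : r ≤ n := (Nat.le_ceil r).trans (by exact_mod_cast hn)
  have e : mulOp volume (truncate m n) - mulOp volume m =
      mulOp volume fun x => truncate m n x - m x := by
    have hb : IsBddMeas fun x => truncate m n x - m x := by
      simpa [sub_eq_add_neg] using (isBddMeas_truncate hm n).add (hm.const_mul (-1))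
    ext1 f
    symm
    rw [mulOp_apply_eq_iff volume hb, _root_.sub_apply]
    filter_upwards [mulOp_coe volume (isBddMeas_truncate hm n) f, mulOp_coe volume hm f,
      Lp.coeFn_sub (mulOp volume (truncate m n) f) (mulOp volume m f)] with x e1 e2 e3
    rw [e3, Pi.sub_apply, e1, e2, sub_mul]
  rw [dist_eq_norm, e]
  refine (norm_mulOp_le volume ((isBddMeas_truncate hm n).1.sub hm.1) (half_pos hε).le
    fun x => ?_).trans_lt (half_lt_self hε)
  change ‖truncate m n x - m x‖ ≤ ε / 2
  unfold truncate
  split_ifs with hx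
  · rw [sub_self, norm_zero]
    exact (half_pos hε).le
  · rw [zero_sub, norm_neg]
    refine (hr |x| ?_ x rfl).le
    push Not at hx
    linarith

/-- Truncating both symbols gives compact operators that converge in norm. -/
lemma isCompactOperator_mulFourierMul {m φ : ℝ → ℂ} (hm : IsBddMeas m) (hφ : IsBddMeas φ)
    (hm0 : Tendsto m (cocompact ℝ) (𝓝 0)) (hφ0 : Tendsto φ (cocompact ℝ) (𝓝 0)) :
    IsCompactOperator (mulFourierMul m φ) := by
  refine isCompactOperator_of_tendsto (l := atTop)
    (F := fun n : ℕ => mulFourierMul (truncate m n) (truncate φ n)) ?_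
    (Eventually.of_forall fun n => ?_)
  · have hc (A : Lp ℂ 2 (volume : Measure ℝ) →L[ℂ] Lp ℂ 2 (volume : Measure ℝ)) :
        Continuous fun p : (Lp ℂ 2 (volume : Measure ℝ) →L[ℂ] Lp ℂ 2 (volume : Measure ℝ)) ×
          (Lp ℂ 2 (volume : Measure ℝ) →L[ℂ] Lp ℂ 2 (volume : Measure ℝ)) =>
            p.1.comp (A.comp p.2) := by fun_prop
    exact ((hc _).tendsto (mulOp volume m, mulOp volume φ)).comp
      ((tendsto_mulOp_truncate hm hm0).prodMk_nhds (tendsto_mulOp_truncate hφ hφ0))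
  · exact isCompactOperator_mulFourierMul_of_eq_zero (isBddMeas_truncate hm n)
      (isBddMeas_truncate hφ n) (by positivity : (0 : ℝ) < n + 1) (truncate_eq_zero m n)
      (truncate_eq_zero φ n)

/-- The operator `m(D) φ` is compact in `L²_α` when `m` and `φ` vanish at infinity. -/
theorem isCompactOperator_fm_comp_mulOp {α : ℝ} {m φ : ℝ → ℂ} (hm : IsBddMeas m)
    (hφ : IsBddMeas φ) (hm0 : Tendsto m (cocompact ℝ) (𝓝 0))
    (hφ0 : Tendsto φ (cocompact ℝ) (𝓝 0)) :
    IsCompactOperator ((fm α m).comp (mulOp (weight α) φ)) := by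
  have e : (fm α m).comp (mulOp (weight α) φ) =
      ((ft α).symm.toContinuousLinearEquiv : Lp ℂ 2 (volume : Measure ℝ) →L[ℂ] L2w α).comp
        ((mulFourierMul m φ).comp ((toL2 α).toContinuousLinearEquiv : L2w α →L[ℂ] Lp ℂ 2 (volume : Measure ℝ))) := by
    -- Multiplication by `φ` commutes with multiplication by `e^{αx}`, so the weight disappears.
    have e1 (f : L2w α) : toL2 α (mulOp (weight α) φ f) = mulOp volume φ (toL2 α f) := by
      symm
      rw [mulOp_apply_eq_iff volume hφ]
      filter_upwards [toL2_coe (mulOp (weight α) φ f), toL2_coe f,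
        ae_weight_iff.1 (mulOp_coe (weight α) hφ f)] with x h1 h2 h3
      rw [h1, h2, h3, mul_smul_comm]
    ext1 f
    change (ft α).symm (mulOp volume m (Lp.fourierTransformₗᵢ ℝ ℂ (toL2 α (mulOp (weight α) φ f)))) = _
    rw [e1]
    rfl
  rw [e]
  have h1 : IsCompactOperator ((mulFourierMul m φ).comp
      ((toL2 α).toContinuousLinearEquiv : L2w α →L[ℂ] Lp ℂ 2 (volume : Measure ℝ))) :=
    (isCompactOperator_mulFourierMul hm hφ hm0 hφ0).comp_clm _
  exact h1.clm_comp ((ft α).symm.toContinuousLinearEquiv : Lp ℂ 2 (volume : Measure ℝ) →L[ℂ] L2w α)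

end CompactMultipliers

end BenneyLuke

namespace BenneyLuke

/-! ### The linearization as a compact perturbation of the free operator. -/

section CompactPerturbation

/-- Smooth profiles vanishing at infinity with their derivative. -/
structure IsProfile (Q : ℝ → ℝ) : Prop where
  smooth : ContDiff ℝ ∞ Q
  tendsto : Tendsto Q (cocompact ℝ) (𝓝 0)
  tendsto_deriv : Tendsto (deriv Q) (cocompact ℝ) (𝓝 0)

lemma isBddMeas_of_tendsto {Q : ℝ → ℝ} (hQ : Continuous Q)
    (h : Tendsto Q (cocompact ℝ) (𝓝 0)) : IsBddMeas fun x => (Q x : ℂ) := by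
  set F : ZeroAtInftyContinuousMap ℝ ℝ := ⟨⟨Q, hQ⟩, h⟩
  refine ⟨Complex.measurable_ofReal.comp hQ.measurable, ‖F.toBCF‖, fun x => ?_⟩
  rw [Complex.norm_real]
  exact F.toBCF.norm_coe_le_norm x

lemma tendsto_ofReal_cocompact {Q : ℝ → ℝ} (h : Tendsto Q (cocompact ℝ) (𝓝 0)) :
    Tendsto (fun x => (Q x : ℂ)) (cocompact ℝ) (𝓝 0) := by
  have := (Complex.continuous_ofReal.tendsto 0).comp h
  rwa [Complex.ofReal_zero] at this

lemma IsProfile.isBddMeas {Q : ℝ → ℝ} (h : IsProfile Q) : IsBddMeas fun x => (Q x : ℂ) :=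
  isBddMeas_of_tendsto h.smooth.continuous h.tendsto

lemma IsProfile.continuous_deriv {Q : ℝ → ℝ} (h : IsProfile Q) : Continuous (deriv Q) :=
  (contDiff_infty_iff_deriv.1 h.smooth).2.continuous

lemma IsProfile.isBddMeas_deriv {Q : ℝ → ℝ} (h : IsProfile Q) :
    IsBddMeas fun x => ((deriv Q x : ℝ) : ℂ) :=
  isBddMeas_of_tendsto h.continuous_deriv h.tendsto_deriv

section Decay

variable {b α : ℝ}

lemma tendsto_inv_norm_dsym (α : ℝ) : Tendsto (fun ξ => ‖dsym α ξ‖⁻¹) (cocompact ℝ) (𝓝 0) := by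
  refine Tendsto.inv_tendsto_atTop ?_
  refine tendsto_atTop_mono (f := fun ξ : ℝ => ‖ξ‖) (fun ξ => ?_) tendsto_norm_cocompact_atTop
  refine le_trans ?_ (Complex.abs_im_le_norm _)
  rw [dsym_im, abs_mul, abs_of_pos (by positivity : 0 < 2 * Real.pi), Real.norm_eq_abs]
  have := Real.pi_gt_three
  nlinarith [abs_nonneg ξ]

lemma tendsto_inv_bsym (hb : 0 < b) (hα : 0 < α) (hbα : b * α ^ 2 < 1) :
    Tendsto (fun ξ => (bsym b α ξ)⁻¹) (cocompact ℝ) (𝓝 0) ∧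
      Tendsto (fun ξ => dsym α ξ * (bsym b α ξ)⁻¹) (cocompact ℝ) (𝓝 0) := by
  obtain ⟨C, hC, h⟩ := exists_norm_dsym_sq_le hb hbα
  have h0 : Tendsto (fun ξ => C * ‖dsym α ξ‖⁻¹) (cocompact ℝ) (𝓝 0) := by
    simpa using (tendsto_inv_norm_dsym α).const_mul C
  have hp (ξ : ℝ) : 0 < ‖bsym b α ξ‖ := norm_pos_iff.2 (bsym_ne_zero hb.le hbα ξ)
  have hd (ξ : ℝ) : 0 < ‖dsym α ξ‖ := by
    refine norm_pos_iff.2 fun h1 => ?_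
    have := dsym_re α ξ
    rw [h1, Complex.zero_re] at this
    linarith
  constructor
  · refine squeeze_zero_norm (fun ξ => ?_) h0
    rw [norm_inv, ← div_eq_mul_inv, ← one_div, div_le_div_iff₀ (hp ξ) (hd ξ)]
    nlinarith [h ξ, sq_nonneg (‖dsym α ξ‖ - 1), hd ξ]
  · refine squeeze_zero_norm (fun ξ => ?_) h0
    rw [norm_mul, norm_inv, ← div_eq_mul_inv, ← div_eq_mul_inv, div_le_div_iff₀ (hp ξ) (hd ξ)]
    nlinarith [h ξ]

end Decay

/-- Multiplication by a real function in `L²_α`. -/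
def rmul (α : ℝ) (Q : ℝ → ℝ) : L2w α →L[ℂ] L2w α := mulOp (weight α) fun x => (Q x : ℂ)

lemma rmul_coe {α : ℝ} {Q : ℝ → ℝ} (hQ : IsBddMeas fun x => (Q x : ℂ)) (f : L2w α) :
    rmul α Q f =ᵐ[volume] fun x => (Q x : ℂ) * f x :=
  ae_weight_iff.1 (mulOp_coe (weight α) hQ f)

lemma hasWeakDeriv_rmul {α : ℝ} {Q : ℝ → ℝ} (hQ : IsProfile Q) {f g : L2w α}
    (h : HasWeakDeriv f g) :
    HasWeakDeriv (rmul α Q f) (rmul α Q g + rmul α (deriv Q) f : L2w α) := by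
  refine hasWeakDeriv_congr ?_ ?_ (h.smooth_smul hQ.smooth)
  · filter_upwards [rmul_coe hQ.isBddMeas f] with x hx
    rw [hx, Complex.real_smul]
  · filter_upwards [coeFn_add_volume (rmul α Q g) (rmul α (deriv Q) f), rmul_coe hQ.isBddMeas g,
      rmul_coe hQ.isBddMeas_deriv f] with x h1 h2 h3
    rw [h1, h2, h3, Complex.real_smul, Complex.real_smul]

/-- This moves a derivative from the function onto `B⁻¹`, which is how the first-order terms of the
linearization become bounded operators. -/
lemma fm_weakDeriv {b α : ℝ} (hα : 0 ≤ α) (hb : 0 < b) (hbα : b * α ^ 2 < 1) {f g : L2w α}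
    (h : HasWeakDeriv f g) :
    fm α (fun ξ => (bsym b α ξ)⁻¹) g = fm α (fun ξ => dsym α ξ * (bsym b α ξ)⁻¹) f := by
  rw [hasWeakDeriv_iff_ft hα] at h
  refine ft_ext ?_
  filter_upwards [h, ft_fm_coe α (isBddMeas_inv_bsym hb.le hbα) g,
    ft_fm_coe α (isBddMeas_dsym_mul_inv_bsym hb hbα) f] with ξ h1 h2 h3
  rw [h2, h3, h1]
  ring

/-- The difference between the linearizations about the profile `(Q, R)` and about the state of
rest. -/
def perturbation (b α : ℝ) (Q R : ℝ → ℝ) : State α →L[ℂ] State α :=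
  blockOp 0 0
    (-((fm α fun ξ => dsym α ξ * (bsym b α ξ)⁻¹).comp (rmul α R) +
      (fm α fun ξ => (bsym b α ξ)⁻¹).comp (rmul α (deriv R))))
    (-((2 : ℂ) • (fm α fun ξ => dsym α ξ * (bsym b α ξ)⁻¹).comp (rmul α Q) -
      (fm α fun ξ => (bsym b α ξ)⁻¹).comp (rmul α (deriv Q))))

variable {a b c α : ℝ} {Q R : ℝ → ℝ}

/-- Each block is a sum of operators `m(D) φ(x)` with `m` equal to `B⁻¹` or `d B⁻¹` and `φ` a
profile or its derivative, all vanishing at infinity. -/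
lemma isCompactOperator_perturbation (hα : 0 < α) (hb : 0 < b) (hbα : b * α ^ 2 < 1)
    (hQ : IsProfile Q) (hR : IsProfile R) : IsCompactOperator (perturbation b α Q R) := by
  have h1 := tendsto_inv_bsym hb hα hbα
  have hB := isBddMeas_inv_bsym hb.le hbα
  have hdB := isBddMeas_dsym_mul_inv_bsym hb hbα
  have c1 : IsCompactOperator ((fm α fun ξ => dsym α ξ * (bsym b α ξ)⁻¹).comp (rmul α R)) :=
    isCompactOperator_fm_comp_mulOp hdB hR.isBddMeas h1.2 (tendsto_ofReal_cocompact hR.tendsto)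
  have c2 : IsCompactOperator ((fm α fun ξ => (bsym b α ξ)⁻¹).comp (rmul α (deriv R))) :=
    isCompactOperator_fm_comp_mulOp hB hR.isBddMeas_deriv h1.1
      (tendsto_ofReal_cocompact hR.tendsto_deriv)
  have c3 : IsCompactOperator ((fm α fun ξ => dsym α ξ * (bsym b α ξ)⁻¹).comp (rmul α Q)) :=
    isCompactOperator_fm_comp_mulOp hdB hQ.isBddMeas h1.2 (tendsto_ofReal_cocompact hQ.tendsto)
  have c4 : IsCompactOperator ((fm α fun ξ => (bsym b α ξ)⁻¹).comp (rmul α (deriv Q))) :=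
    isCompactOperator_fm_comp_mulOp hB hQ.isBddMeas_deriv h1.1
      (tendsto_ofReal_cocompact hQ.tendsto_deriv)
  have c5 := (c1.add c2).neg
  have c6 := ((c3.smul (2 : ℂ)).sub c4).neg
  set A := -((fm α fun ξ => dsym α ξ * (bsym b α ξ)⁻¹).comp (rmul α R) +
      (fm α fun ξ => (bsym b α ξ)⁻¹).comp (rmul α (deriv R))) with hA
  set D := -((2 : ℂ) • (fm α fun ξ => dsym α ξ * (bsym b α ξ)⁻¹).comp (rmul α Q) -
      (fm α fun ξ => (bsym b α ξ)⁻¹).comp (rmul α (deriv Q))) with hD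
  have c5' : IsCompactOperator A := c5
  have c6' : IsCompactOperator D := c6
  set E := (WithLp.prodContinuousLinearEquiv 2 ℂ (L2w α) (L2w α) :
    State α →L[ℂ] (L2w α × L2w α))
  set E' := ((WithLp.prodContinuousLinearEquiv 2 ℂ (L2w α) (L2w α)).symm :
    (L2w α × L2w α) →L[ℂ] State α)
  have k1 := (c5'.comp_clm (ContinuousLinearMap.fst ℂ (L2w α) (L2w α) ∘L E)).clm_comp
    (E' ∘L ContinuousLinearMap.inr ℂ (L2w α) (L2w α))
  have k2 := (c6'.comp_clm (ContinuousLinearMap.snd ℂ (L2w α) (L2w α) ∘L E)).clm_comp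
    (E' ∘L ContinuousLinearMap.inr ℂ (L2w α) (L2w α))
  have e : ⇑(perturbation b α Q R) =
      (fun z : State α => (E' ∘L ContinuousLinearMap.inr ℂ (L2w α) (L2w α))
        (A ((ContinuousLinearMap.fst ℂ (L2w α) (L2w α) ∘L E) z))) +
      (fun z : State α => (E' ∘L ContinuousLinearMap.inr ℂ (L2w α) (L2w α))
        (D ((ContinuousLinearMap.snd ℂ (L2w α) (L2w α) ∘L E) z))) := by
    funext z
    apply State.ext
    · change (0 : L2w α) + 0 = 0 + 0
      rfl
    · rfl
  rw [e]
  exact k1.add k2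

/-- The variable-coefficient terms `R q' + 2R' q + 2Q r' + Q' r` of the linearization. -/
def coupling (Q R : ℝ → ℝ) (q dq r dr : L2w α) : L2w α :=
  rmul α R dq + (2 : ℂ) • rmul α (deriv R) q + (2 : ℂ) • rmul α Q dr + rmul α (deriv Q) r

lemma coupling_coe (hQ : IsProfile Q) (hR : IsProfile R) (q dq r dr : L2w α) :
    coupling Q R q dq r dr =ᵐ[volume] fun x =>
      R x * dq x + 2 * (deriv R x * q x) + 2 * (Q x * dr x) + deriv Q x * r x := by
  filter_upwards [rmul_coe hR.isBddMeas dq, rmul_coe hR.isBddMeas_deriv q,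
    rmul_coe hQ.isBddMeas dr, rmul_coe hQ.isBddMeas_deriv r,
    coeFn_smul_volume 2 (rmul α (deriv R) q), coeFn_smul_volume 2 (rmul α Q dr),
    coeFn_add_volume (rmul α R dq) ((2 : ℂ) • rmul α (deriv R) q),
    coeFn_add_volume (rmul α R dq + (2 : ℂ) • rmul α (deriv R) q) ((2 : ℂ) • rmul α Q dr),
    coeFn_add_volume (rmul α R dq + (2 : ℂ) • rmul α (deriv R) q + (2 : ℂ) • rmul α Q dr)
      (rmul α (deriv Q) r)] with x e1 e2 e3 e4 e5 e6 e7 e8 e9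
  rw [coupling, e9, e8, e7, e6, e5, e4, e3, e2, e1]

lemma pair_coupling (hQ : IsProfile Q) (hR : IsProfile R) {φ : ℝ → ℝ} (hφ : IsTest φ)
    (q dq r dr : L2w α) : pair φ (coupling Q R q dq r dr) =
      pair (fun x => R x * φ x) dq + pair (fun x => 2 * deriv R x * φ x) q +
        pair (fun x => 2 * Q x * φ x) dr + pair (fun x => deriv Q x * φ x) r := by
  have two (F : ℝ → ℝ) (hF : IsBddMeas fun x => (F x : ℂ)) (f : L2w α) :
      pair (fun x => 2 * F x * φ x) f = 2 * pair φ (rmul α F f) := by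
    rw [rmul, ← pair_mul_eq hF]
    unfold pair
    rw [← integral_const_mul]
    refine integral_congr_ae (Eventually.of_forall fun x => ?_)
    simp only [Complex.real_smul]
    push_cast
    ring
  rw [coupling, pair_add hφ.continuous hφ.2, pair_add hφ.continuous hφ.2,
    pair_add hφ.continuous hφ.2, pair_smul, pair_smul, two _ hR.isBddMeas_deriv,
    two _ hQ.isBddMeas, pair_mul_eq hR.isBddMeas, pair_mul_eq hQ.isBddMeas_deriv]
  rfl

lemma linRel_iff_pair (hQ : IsProfile Q) (hR : IsProfile R) (z w : State α) :
    LinRel a b c Q R z w ↔ ∃ dq dr : L2w α, HasWeakDeriv z.fst dq ∧ HasWeakDeriv z.snd dr ∧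
      w.fst = (c : ℂ) • dq + dr ∧
      ∀ φ, IsTest φ → pair (fun x => φ x - b * deriv (deriv φ) x) (w.snd - (c : ℂ) • dr) =
        pair (fun x => φ x - a * deriv (deriv φ) x) dq -
          pair φ (coupling Q R z.fst dq z.snd dr) := by
  refine exists_congr fun dq => exists_congr fun dr => and_congr_right fun _ =>
    and_congr_right fun _ => and_congr_right fun _ => forall₂_congr fun φ hφ => ?_
  rw [pair_coupling hQ hR hφ, neg_smul, ← sub_eq_add_neg]
  simp only [sub_add_eq_sub_sub]

/-- By the product rule the coupling terms are `(R q)' + R' q + 2 (Q r)' - Q' r`; inverting `B`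
turns them into minus the second component of the perturbation. Both relations thus hold with the
same weak derivatives `dq` and `dr`. -/
lemma linRel_iff (h : Admissible a b c α) (hQ : IsProfile Q) (hR : IsProfile R) (z w : State α) :
    LinRel a b c Q R z w ↔ (z, w - perturbation b α Q R z) ∈ L0Graph a b c α := by
  rw [mem_L0Graph_iff h, linRel_iff_pair hQ hR]
  refine exists_congr fun dq => exists_congr fun dr => and_congr_right fun hq =>
    and_congr_right fun hr => ?_
  have e1 : (w - perturbation b α Q R z).fst = w.fst := by
    change w.fst - ((0 : L2w α) + 0) = w.fst
    rw [add_zero, sub_zero]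
  rw [e1]
  refine and_congr_right fun _ => ?_
  have e4 : (perturbation b α Q R z).snd =
      -fm α (fun ξ => (bsym b α ξ)⁻¹) (coupling Q R z.fst dq z.snd dr) := by
    have f1 := fm_weakDeriv h.α_pos.le h.b_pos h.b_mul_sq_lt (hasWeakDeriv_rmul hR hq)
    have f2 := fm_weakDeriv h.α_pos.le h.b_pos h.b_mul_sq_lt (hasWeakDeriv_rmul hQ hr)
    rw [map_add] at f1 f2
    rw [coupling, perturbation]
    simp only [blockOp_snd, _root_.neg_apply, _root_.add_apply, _root_.sub_apply,
      _root_.smul_apply, ContinuousLinearMap.comp_apply, map_add, map_smul]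
    rw [← f1, ← f2]
    module
  rw [elliptic_iff h.α_pos.le h.b_pos h.b_mul_sq_lt, WithLp.sub_snd, e4, sub_neg_eq_add,
    sub_eq_iff_eq_add', ← eq_sub_iff_add_eq, add_sub_assoc]

lemma mem_graph_vadd_iff {E : Type*} [NormedAddCommGroup E] [NormedSpace ℂ E] (K : E →L[ℂ] E)
    (T : E →ₗ.[ℂ] E) (z w : E) :
    (z, w) ∈ ((K : E →ₗ[ℂ] E) +ᵥ T).graph ↔ (z, w - K z) ∈ T.graph := by
  rw [LinearPMap.mem_graph_iff, LinearPMap.mem_graph_iff]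
  refine exists_congr fun y => and_congr_right fun hy => ?_
  dsimp only at hy ⊢
  rw [LinearPMap.vadd_apply, ← hy, eq_sub_iff_add_eq']
  rfl

theorem Lc_eq (h : Admissible a b c α) (hQ : IsProfile (qc a b c)) (hR : IsProfile (rc a b c)) :
    Lc a b c α = (perturbation b α (qc a b c) (rc a b c) : State α →ₗ[ℂ] State α) +ᵥ L0 a b c α := by
  have e : LcGraph a b c α =
      ((perturbation b α (qc a b c) (rc a b c) : State α →ₗ[ℂ] State α) +ᵥ L0 a b c α).graph := by
    ext ⟨z, w⟩
    rw [mem_graph_vadd_iff, L0_graph_eq h]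
    exact linRel_iff h hQ hR z w
  rw [Lc, e]
  exact LinearPMap.eq_of_eq_graph (Submodule.toLinearPMap_graph_eq _ fun x hx hx' =>
    LinearPMap.graph_fst_eq_zero_snd _ (x := x.1) (x' := x.2) hx hx')

lemma Lc_graph_eq (h : Admissible a b c α) (hQ : IsProfile (qc a b c))
    (hR : IsProfile (rc a b c)) : (Lc a b c α).graph = LcGraph a b c α := by
  ext ⟨z, w⟩
  rw [Lc_eq h hQ hR, mem_graph_vadd_iff, L0_graph_eq h]
  exact (linRel_iff h hQ hR z w).symm

lemma mem_Lc_domain_iff (h : Admissible a b c α) (hQ : IsProfile (qc a b c))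
    (hR : IsProfile (rc a b c)) (z : State α) : z ∈ (Lc a b c α).domain ↔
    MemH1w α z.fst ∧ MemH1w α z.snd := by
  rw [Lc_eq h hQ hR]
  exact mem_L0_domain_iff h z

theorem exists_semigroup_Lc (h : Admissible a b c α) (hQ : IsProfile (qc a b c))
    (hR : IsProfile (rc a b c)) : ∃ S, IsC0Semigroup S ∧ IsGenerator (Lc a b c α) S := by
  rw [Lc_eq h hQ hR]
  exact exists_semigroup_vadd (isC0Semigroup_freeSemigroup h) (fun t ht => norm_freeSemigroup_le h ht)
    (isGenerator_freeSemigroup h) _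

/-- The half-plane to the right of `-gap` is connected and in the resolvent set of the free
operator. At the real point `‖K‖ C` the resolvent bound gives `‖K R‖ ≤ ‖K‖ C / (‖K‖ C + gap) < 1`.
-/
theorem re_le_of_mem_essSpectrum (h : Admissible a b c α) (hQ : IsProfile (qc a b c))
    (hR : IsProfile (rc a b c)) {lam : ℂ} (hl : lam ∈ essSpectrum (Lc a b c α)) :
    lam.re ≤ -gap a b c α := by
  by_contra! hlt
  have hK := isCompactOperator_perturbation h.α_pos h.b_pos h.b_mul_sq_lt hQ hR
  rw [Lc_eq h hQ hR] at hl
  generalize perturbation b α (qc a b c) (rc a b c) = K at hK hl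
  obtain ⟨C, hC0, hC⟩ : ∃ C, 0 ≤ C ∧ ∀ l : ℂ, -gap a b c α < l.re →
      ‖freeResolvent a b c α l‖ ≤ C * (l.re + gap a b c α)⁻¹ :=
    ⟨_, mul_nonneg (norm_nonneg _) (norm_nonneg _), fun l hl => norm_freeResolvent_le h hl⟩
  have hg := gap_pos h
  have hp : 0 ≤ ‖K‖ * C := mul_nonneg (norm_nonneg _) hC0
  have hμ : -gap a b c α < ((‖K‖ * C : ℝ) : ℂ).re := by
    rw [Complex.ofReal_re]
    linarith
  have hμK : ‖K.comp (freeResolvent a b c α ((‖K‖ * C : ℝ) : ℂ))‖ < 1 := by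
    have h1 := hC _ hμ
    rw [Complex.ofReal_re] at h1
    calc ‖K.comp (freeResolvent a b c α ((‖K‖ * C : ℝ) : ℂ))‖
        ≤ ‖K‖ * (C * (‖K‖ * C + gap a b c α)⁻¹) :=
          (ContinuousLinearMap.opNorm_comp_le _ _).trans
            (mul_le_mul_of_nonneg_left h1 (norm_nonneg _))
      _ = ‖K‖ * C / (‖K‖ * C + gap a b c α) := by rw [div_eq_mul_inv, mul_assoc]
      _ < 1 := by
          rw [div_lt_one (by linarith)]
          linarith
  exact notMem_essSpectrum_of_compact_perturbation (Ω := {z : ℂ | -gap a b c α < z.re})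
    (T₀ := L0 a b c α) (R := freeResolvent a b c α) hK
    (isOpen_lt continuous_const Complex.continuous_re)
    (convex_halfSpace_re_gt _).isPreconnected
    (fun l hl => isResolventAt_freeResolvent h hl) hμ hμK hlt hl

end CompactPerturbation

end BenneyLuke

namespace BenneyLuke

/-! ### Exponentially decaying functions as elements and test functions of `L²_α`. -/

section ExponentialDecay

/-- Continuous functions bounded by a multiple of `e^{-s|x|}`. -/
def ExpDecay (s : ℝ) (f : ℝ → ℝ) : Prop := Continuous f ∧ ∃ C, ∀ x, |f x| ≤ C * Real.exp (-s * |x|)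

namespace ExpDecay

variable {s t : ℝ} {f g : ℝ → ℝ}

lemma add (hf : ExpDecay s f) (hg : ExpDecay s g) : ExpDecay s fun x => f x + g x := by
  obtain ⟨h1, C, hC⟩ := hf
  obtain ⟨h2, D, hD⟩ := hg
  refine ⟨h1.add h2, C + D, fun x => ?_⟩
  rw [add_mul]
  exact (abs_add_le _ _).trans (add_le_add (hC x) (hD x))

lemma bdd_mul (hf : Continuous f) {C : ℝ} (hC : ∀ x, |f x| ≤ C) (hg : ExpDecay s g) :
    ExpDecay s fun x => f x * g x := by
  obtain ⟨h2, D, hD⟩ := hg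
  refine ⟨hf.mul h2, C * D, fun x => ?_⟩
  rw [abs_mul, mul_assoc]
  have hC0 : 0 ≤ C := (abs_nonneg _).trans (hC x)
  exact mul_le_mul (hC x) (hD x) (abs_nonneg _) hC0

lemma const_mul (k : ℝ) (hg : ExpDecay s g) : ExpDecay s fun x => k * g x :=
  bdd_mul continuous_const (fun _ => le_rfl) hg

lemma sub (hf : ExpDecay s f) (hg : ExpDecay s g) : ExpDecay s fun x => f x - g x := by
  simpa [sub_eq_add_neg] using hf.add (hg.const_mul (-1))

lemma mono (hst : t ≤ s) (hf : ExpDecay s f) : ExpDecay t f := by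
  obtain ⟨h1, C, hC⟩ := hf
  have hC0 : 0 ≤ C := by have := (abs_nonneg _).trans (hC 0); simpa using this
  refine ⟨h1, C, fun x => (hC x).trans ?_⟩
  gcongr

lemma exists_abs_le (hs : 0 ≤ s) (hf : ExpDecay s f) : ∃ C, ∀ x, |f x| ≤ C := by
  obtain ⟨-, C, hC⟩ := hf.mono hs
  exact ⟨C, fun x => by simpa using hC x⟩

lemma mul (hs : 0 ≤ s) (hf : ExpDecay s f) (hg : ExpDecay s g) : ExpDecay s fun x => f x * g x := by
  obtain ⟨C, hC⟩ := hf.exists_abs_le hs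
  exact bdd_mul hf.1 hC hg

/-- A factor `x` costs an arbitrarily small part of the decay rate, because `|x| ≤ e^{(s - t)|x|} /
(s - t)`. This is needed for the speed derivative, which contains `x q_c'`. -/
lemma id_mul (hst : t < s) (hf : ExpDecay s f) : ExpDecay t fun x => x * f x := by
  obtain ⟨h1, C, hC⟩ := hf
  have hC0 : 0 ≤ C := by have := (abs_nonneg _).trans (hC 0); simpa using this
  refine ⟨continuous_id.mul h1, C * (s - t)⁻¹, fun x => ?_⟩
  have hp : 0 < s - t := sub_pos.2 hst
  have h2 : |x| ≤ (s - t)⁻¹ * Real.exp ((s - t) * |x|) := by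
    rw [← div_eq_inv_mul, le_div_iff₀ hp]
    have := Real.add_one_le_exp ((s - t) * |x|)
    linarith
  calc |x * f x| = |x| * |f x| := abs_mul _ _
    _ ≤ ((s - t)⁻¹ * Real.exp ((s - t) * |x|)) * (C * Real.exp (-s * |x|)) := by
        gcongr
        exact hC x
    _ = C * (s - t)⁻¹ * (Real.exp ((s - t) * |x|) * Real.exp (-s * |x|)) := by ring
    _ = _ := by
        rw [← Real.exp_add]
        ring_nf

lemma exp_mul {r : ℝ} (hf : ExpDecay s f) : ExpDecay (s - |r|) fun x => Real.exp (r * x) * f x := by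
  obtain ⟨h1, C, hC⟩ := hf
  refine ⟨by fun_prop, C, fun x => ?_⟩
  have hC0 : 0 ≤ C := by have := (abs_nonneg _).trans (hC 0); simpa using this
  rw [abs_mul, Real.abs_exp]
  calc Real.exp (r * x) * |f x| ≤ Real.exp (|r| * |x|) * (C * Real.exp (-s * |x|)) := by
        refine mul_le_mul (Real.exp_le_exp.2 ?_) (hC x) (abs_nonneg _) (Real.exp_pos _).le
        rw [← abs_mul]
        exact le_abs_self _
    _ = C * (Real.exp (|r| * |x|) * Real.exp (-s * |x|)) := by ring
    _ = _ := by
        rw [← Real.exp_add]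
        ring_nf

lemma integrable (hs : 0 < s) (hf : ExpDecay s f) : Integrable f := by
  obtain ⟨h1, C, hC⟩ := hf
  have hC0 : 0 ≤ C := by have := (abs_nonneg _).trans (hC 0); simpa using this
  have h2 : Integrable fun x : ℝ => C * (2 * (1 + (s * x) ^ 2)⁻¹) :=
    ((integrable_inv_one_add_sq.comp_mul_left' hs.ne').const_mul 2).const_mul C
  refine h2.mono' h1.aestronglyMeasurable (Eventually.of_forall fun x => ?_)
  rw [Real.norm_eq_abs]
  refine (hC x).trans ?_
  gcongr
  have h3 : 0 ≤ s * |x| := by positivity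
  have h4 := Real.quadratic_le_exp_of_nonneg h3
  rw [neg_mul, Real.exp_neg, ← div_eq_mul_inv, ← one_div, div_le_div_iff₀ (Real.exp_pos _) (by positivity)]
  rw [mul_pow, sq_abs] at h4
  nlinarith

lemma memLp_two (hs : 0 < s) (hf : ExpDecay s f) : MemLp (fun x => (f x : ℂ)) 2 volume := by
  have h1 : MemLp f 2 volume := by
    rw [memLp_two_iff_integrable_sq hf.1.aestronglyMeasurable]
    simpa only [pow_two] using (mul hs.le hf hf).integrable hs
  exact h1.ofReal

lemma memLp_weight {α : ℝ} (hs : |α| < s) (hf : ExpDecay s f) :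
    MemLp (fun x => (f x : ℂ)) 2 (weight α) := by
  rw [memLp_weight_iff]
  have := (exp_mul (r := α) hf).memLp_two (by linarith)
  simpa only [Complex.real_smul, Complex.ofReal_mul] using this

lemma tendsto_cocompact (hs : 0 < s) (hf : ExpDecay s f) : Tendsto f (cocompact ℝ) (𝓝 0) := by
  obtain ⟨-, C, hC⟩ := hf
  refine squeeze_zero_norm hC ?_
  have h1 : Tendsto (fun x : ℝ => -s * |x|) (cocompact ℝ) atBot :=
    (tendsto_norm_cocompact_atTop (E := ℝ)).const_mul_atTop_of_neg (by linarith)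
  simpa using (Real.tendsto_exp_atBot.comp h1).const_mul C

/-- An exponentially decaying function is integrable against elements of `L²_α`. -/
lemma integrable_smul {α : ℝ} (hs : |α| < s) (hf : ExpDecay s f) (F : L2w α) :
    Integrable fun x => f x • F x := by
  have h1 := (exp_mul (r := -α) hf).memLp_two (by rw [abs_neg]; linarith)
  refine (h1.integrable_mul (memLp_exp_smul F)).congr (Eventually.of_forall fun x => ?_)
  simp only [Pi.mul_apply, Complex.real_smul]
  have h2 : ((Real.exp (-α * x) : ℝ) : ℂ) * ((Real.exp (α * x) : ℝ) : ℂ) = 1 := by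
    rw [← Complex.ofReal_mul, ← Real.exp_add]
    simp
  rw [Complex.ofReal_mul]
  linear_combination (f x * F x) * h2

end ExpDecay

lemma integral_deriv_eq_zero {s : ℝ} (hs : 0 < s) {f f' : ℝ → ℝ} (h : ∀ x, HasDerivAt f (f' x) x)
    (hf : ExpDecay s f) (hf' : ExpDecay s f') : ∫ x, f' x = 0 :=
  integral_eq_zero_of_hasDerivAt_of_integrable h (hf'.integrable hs) (hf.integrable hs)

/-- The element of `L²_α` given by a real function. -/
def lift (α : ℝ) (f : ℝ → ℝ) : L2w α :=
  open Classical in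
  if h : MemLp (fun x => (f x : ℂ)) 2 (weight α) then h.toLp else 0

lemma lift_coe {α s : ℝ} {f : ℝ → ℝ} (hs : |α| < s) (hf : ExpDecay s f) :
    lift α f =ᵐ[volume] fun x => (f x : ℂ) := by
  rw [lift, dif_pos (hf.memLp_weight hs)]
  exact ae_weight_iff.1 (hf.memLp_weight hs).coeFn_toLp

lemma hasWeakDeriv_lift {α s : ℝ} {f f' : ℝ → ℝ} (hs : |α| < s) (hf : ExpDecay s f)
    (hf' : ExpDecay s f') (h : ∀ x, HasDerivAt f (f' x) x) :
    HasWeakDeriv (lift α f) (lift α f') := by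
  refine hasWeakDeriv_congr (lift_coe hs hf).symm (lift_coe hs hf').symm ?_
  exact hasWeakDeriv_of_hasDerivAt (fun x => (h x).ofReal_comp)
    (Complex.continuous_ofReal.comp hf'.1)

lemma exists_cutoff : ∃ χ : ℝ → ℝ, IsTest χ ∧ χ 0 = 1 := by
  let b : ContDiffBump (0 : ℝ) := ⟨1, 2, one_pos, one_lt_two⟩
  exact ⟨b, ⟨b.contDiff, b.hasCompactSupport⟩, b.one_of_mem_closedBall (by simp [b])⟩

/-- A second-order distributional relation in `L²_α` may be tested against exponentially decaying
functions. -/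
theorem integral_eq_zero_of_expDecay {α s : ℝ} (hs : |α| < s) {F₀ F₁ F₂ : L2w α}
    (h : ∀ φ, IsTest φ →
      (∫ x, φ x • F₀ x) + (∫ x, deriv φ x • F₁ x) + (∫ x, deriv (deriv φ) x • F₂ x) = 0)
    {ψ ψ₁ ψ₂ : ℝ → ℝ} (hsm : ContDiff ℝ ∞ ψ) (h1 : ∀ x, HasDerivAt ψ (ψ₁ x) x)
    (h2 : ∀ x, HasDerivAt ψ₁ (ψ₂ x) x) (d0 : ExpDecay s ψ) (d1 : ExpDecay s ψ₁)
    (d2 : ExpDecay s ψ₂) :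
    (∫ x, ψ x • F₀ x) + (∫ x, ψ₁ x • F₁ x) + (∫ x, ψ₂ x • F₂ x) = 0 := by
  obtain ⟨χ, hχ, hχ0⟩ := exists_cutoff
  have hb (u : ℝ → ℝ) (hu : IsTest u) : ∃ D, 0 ≤ D ∧ ∀ x, |u x| ≤ D := by
    obtain ⟨D, hD⟩ := hu.2.exists_bound_of_continuous hu.continuous
    exact ⟨D, (norm_nonneg _).trans (hD 0), hD⟩
  have key (u : ℝ → ℝ) (hu : IsTest u) (k : ℕ) (g : ℝ → ℝ) (hg : ExpDecay s g) (F : L2w α) :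
      Tendsto (fun n : ℕ => ∫ x, ((1 / ((n : ℝ) + 1)) ^ k * u (1 / ((n : ℝ) + 1) * x) * g x) • F x)
        atTop (𝓝 (∫ x, (0 ^ k * u 0 * g x) • F x)) := by
    obtain ⟨D, hD0, hD⟩ := hb u hu
    have hn : Tendsto (fun n : ℕ => 1 / ((n : ℝ) + 1)) atTop (𝓝 0) :=
      tendsto_one_div_add_atTop_nhds_zero_nat
    have hn1 (n : ℕ) : 1 / ((n : ℝ) + 1) ≤ 1 := by
      rw [div_le_one (by positivity)]
      have : (0 : ℝ) ≤ n := n.cast_nonneg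
      linarith
    refine tendsto_integral_of_dominated_convergence (fun x => D * ‖g x • F x‖) (fun n => ?_)
      ((hg.integrable_smul hs F).norm.const_mul D) (fun n => Eventually.of_forall fun x => ?_)
      (Eventually.of_forall fun x => ?_)
    · have hc : Continuous fun x : ℝ => (1 / ((n : ℝ) + 1)) ^ k * u (1 / ((n : ℝ) + 1) * x) * g x := by
        have := hu.continuous
        have := hg.1
        fun_prop
      exact hc.aestronglyMeasurable.smul (locInt F).aestronglyMeasurable
    · rw [mul_smul, norm_smul, Real.norm_eq_abs]
      gcongr
      rw [abs_mul, abs_pow, abs_of_nonneg (by positivity : 0 ≤ 1 / ((n : ℝ) + 1))]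
      calc _ ≤ 1 * D := by
            gcongr
            · exact pow_le_one₀ (by positivity) (hn1 n)
            · exact hD _
        _ = D := one_mul D
    · refine Tendsto.smul_const (Tendsto.mul_const _ (Tendsto.mul (hn.pow k) ?_)) _
      have h3 : Tendsto (fun n : ℕ => 1 / ((n : ℝ) + 1) * x) atTop (𝓝 0) := by
        simpa only [zero_mul] using hn.mul_const x
      exact (hu.continuous.tendsto 0).comp h3
  -- Cut off `ψ` at scale `n + 1`. Every derivative that falls on the cutoff brings a factor `1 / (n
  -- + 1)`, so only the terms with an undifferentiated cutoff survive in the limit; dominated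
  -- convergence applies since `e^{-αx} ψ` is in `L²`.
  set φ : ℕ → ℝ → ℝ := fun n x => χ (1 / ((n : ℝ) + 1) * x) * ψ x with hφ
  have hcomp (u : ℝ → ℝ) (hu : IsTest u) (n : ℕ) (x : ℝ) :
      HasDerivAt (fun x => u (1 / ((n : ℝ) + 1) * x))
        (1 / ((n : ℝ) + 1) * deriv u (1 / ((n : ℝ) + 1) * x)) x := by
    have := (hu.hasDerivAt (1 / ((n : ℝ) + 1) * x)).comp x
      ((hasDerivAt_id x).const_mul (1 / ((n : ℝ) + 1)))
    refine this.congr_deriv ?_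
    ring
  have hφt (n : ℕ) : IsTest (φ n) := by
    have hne : (1 / ((n : ℝ) + 1)) ≠ 0 := by positivity
    have ht : IsTest fun x => χ (1 / ((n : ℝ) + 1) * x) :=
      ⟨hχ.1.comp (contDiff_const.mul contDiff_id),
        hχ.2.comp_homeomorph (Homeomorph.mulLeft₀ _ hne)⟩
    have he : φ n = fun x => ψ x * χ (1 / ((n : ℝ) + 1) * x) := funext fun x => mul_comm _ _
    rw [he]
    exact ht.smooth_mul hsm
  have hφ1 (n : ℕ) (x : ℝ) : deriv (φ n) x =
      1 / ((n : ℝ) + 1) * deriv χ (1 / ((n : ℝ) + 1) * x) * ψ x +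
        χ (1 / ((n : ℝ) + 1) * x) * ψ₁ x := ((hcomp χ hχ n x).mul (h1 x)).deriv
  have hφ2 (n : ℕ) (x : ℝ) : deriv (deriv (φ n)) x =
      (1 / ((n : ℝ) + 1)) ^ 2 * deriv (deriv χ) (1 / ((n : ℝ) + 1) * x) * ψ x +
        2 * ((1 / ((n : ℝ) + 1)) ^ 1 * deriv χ (1 / ((n : ℝ) + 1) * x) * ψ₁ x) +
        (1 / ((n : ℝ) + 1)) ^ 0 * χ (1 / ((n : ℝ) + 1) * x) * ψ₂ x := by
    rw [funext (hφ1 n)]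
    have := (((hcomp _ hχ.deriv n x).const_mul (1 / ((n : ℝ) + 1))).mul (h1 x)).add
      ((hcomp χ hχ n x).mul (h2 x))
    refine this.deriv.trans ?_
    ring
  have hint (u : ℝ → ℝ) (hu : IsTest u) (k n : ℕ) (g : ℝ → ℝ) (hg : ExpDecay s g) (F : L2w α) :
      Integrable fun x => ((1 / ((n : ℝ) + 1)) ^ k * u (1 / ((n : ℝ) + 1) * x) * g x) • F x := by
    obtain ⟨D, hD0, hD⟩ := hb u hu
    refine ExpDecay.integrable_smul hs (ExpDecay.bdd_mul
      (C := (1 / ((n : ℝ) + 1)) ^ k * D) ?_ (fun x => ?_) hg) F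
    · have := hu.continuous
      fun_prop
    · rw [abs_mul, abs_of_nonneg (by positivity : 0 ≤ (1 / ((n : ℝ) + 1)) ^ k)]
      gcongr
      exact hD _
  have L0 := key χ hχ 0 ψ d0 F₀
  have L1 := (key _ hχ.deriv 1 ψ d0 F₁).add (key χ hχ 0 ψ₁ d1 F₁)
  have L2 := ((key _ hχ.deriv.deriv 2 ψ d0 F₂).add
    ((key _ hχ.deriv 1 ψ₁ d1 F₂).const_mul 2)).add (key χ hχ 0 ψ₂ d2 F₂)
  have L := (L0.add L1).add L2
  have hz (n : ℕ) := h (φ n) (hφt n)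
  have e0 (n : ℕ) : ∫ x, φ n x • F₀ x =
      ∫ x, ((1 / ((n : ℝ) + 1)) ^ 0 * χ (1 / ((n : ℝ) + 1) * x) * ψ x) • F₀ x := by
    simp only [hφ, pow_zero, one_mul]
  have e1 (n : ℕ) : ∫ x, deriv (φ n) x • F₁ x =
      (∫ x, ((1 / ((n : ℝ) + 1)) ^ 1 * deriv χ (1 / ((n : ℝ) + 1) * x) * ψ x) • F₁ x) +
        ∫ x, ((1 / ((n : ℝ) + 1)) ^ 0 * χ (1 / ((n : ℝ) + 1) * x) * ψ₁ x) • F₁ x := by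
    rw [← integral_add (hint _ hχ.deriv 1 n ψ d0 F₁) (hint χ hχ 0 n ψ₁ d1 F₁)]
    simp only [hφ1, ← add_smul, pow_zero, pow_one, one_mul]
  have e2 (n : ℕ) : ∫ x, deriv (deriv (φ n)) x • F₂ x =
      (∫ x, ((1 / ((n : ℝ) + 1)) ^ 2 * deriv (deriv χ) (1 / ((n : ℝ) + 1) * x) * ψ x) • F₂ x) +
        2 * (∫ x, ((1 / ((n : ℝ) + 1)) ^ 1 * deriv χ (1 / ((n : ℝ) + 1) * x) * ψ₁ x) • F₂ x) +
        ∫ x, ((1 / ((n : ℝ) + 1)) ^ 0 * χ (1 / ((n : ℝ) + 1) * x) * ψ₂ x) • F₂ x := by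
    have i1 := hint _ hχ.deriv.deriv 2 n ψ d0 F₂
    have i2 := (hint _ hχ.deriv 1 n ψ₁ d1 F₂).const_mul 2
    rw [← integral_const_mul, ← integral_add i1 i2,
      ← integral_add (f := fun x => _ + _) (i1.add i2) (hint χ hχ 0 n ψ₂ d2 F₂)]
    refine integral_congr_ae (Eventually.of_forall fun x => ?_)
    simp only [hφ2, Complex.real_smul]
    push_cast
    ring
  have hlim := tendsto_nhds_unique (L.congr fun n => by rw [← e0, ← e1, ← e2, hz n])
    (tendsto_const_nhds (x := (0 : ℂ)))
  simpa [hχ0] using hlim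

/-- Exponentially decaying classical solutions of the linearized equation. -/
lemma linRel_lift {a b c α s : ℝ} {Q R : ℝ → ℝ} (hQ : IsProfile Q) (hR : IsProfile R)
    (hs : |α| < s) {q q₁ q₂ q₃ r r₁ v v₁ v₂ : ℝ → ℝ} (dq : ExpDecay s q) (dq₁ : ExpDecay s q₁)
    (dq₂ : ExpDecay s q₂) (dq₃ : ExpDecay s q₃) (dr : ExpDecay s r) (dr₁ : ExpDecay s r₁)
    (dv : ExpDecay s v) (dv₁ : ExpDecay s v₁) (dv₂ : ExpDecay s v₂)
    (hq : ∀ x, HasDerivAt q (q₁ x) x) (hq₁ : ∀ x, HasDerivAt q₁ (q₂ x) x)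
    (hq₂ : ∀ x, HasDerivAt q₂ (q₃ x) x) (hr : ∀ x, HasDerivAt r (r₁ x) x)
    (hv : ∀ x, HasDerivAt v (v₁ x) x) (hv₁ : ∀ x, HasDerivAt v₁ (v₂ x) x)
    (heq : ∀ x, v x - b * v₂ x = q₁ x - a * q₃ x -
      (R x * q₁ x + 2 * (deriv R x * q x) + 2 * (Q x * r₁ x) + deriv Q x * r x)) :
    LinRel a b c Q R (WithLp.toLp 2 (lift α q, lift α r))
      (WithLp.toLp 2 ((c : ℂ) • lift α q₁ + lift α r₁, lift α v + (c : ℂ) • lift α r₁)) := by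
  rw [linRel_iff_pair hQ hR]
  refine ⟨lift α q₁, lift α r₁, hasWeakDeriv_lift hs dq dq₁ hq, hasWeakDeriv_lift hs dr dr₁ hr, rfl,
    fun φ hφ => ?_⟩
  change pair (fun x => φ x - b * deriv (deriv φ) x)
    (lift α v + (c : ℂ) • lift α r₁ - (c : ℂ) • lift α r₁) = _ -
      pair φ (coupling Q R (lift α q) (lift α q₁) (lift α r) (lift α r₁))
  have two {f f₁ f₂ : ℝ → ℝ} (d0 : ExpDecay s f) (d1 : ExpDecay s f₁) (d2 : ExpDecay s f₂)
      (h0 : ∀ x, HasDerivAt f (f₁ x) x) (h1 : ∀ x, HasDerivAt f₁ (f₂ x) x) :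
      pair (deriv (deriv φ)) (lift α f) = pair φ (lift α f₂) := by
    rw [(hasWeakDeriv_iff _ _).1 (hasWeakDeriv_lift hs d0 d1 h0) _ hφ.deriv,
      (hasWeakDeriv_iff _ _).1 (hasWeakDeriv_lift hs d1 d2 h1) _ hφ, neg_neg]
  rw [add_sub_cancel_right, pair_elliptic b hφ, pair_elliptic a hφ, two dv dv₁ dv₂ hv hv₁,
    two dq₁ dq₂ dq₃ hq₁ hq₂, ← pair_smul, ← pair_smul, ← pair_sub hφ, ← pair_sub hφ, ← pair_sub hφ]
  congr 1
  refine L2w_ext ?_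
  filter_upwards [coeFn_sub_volume (lift α v) ((b : ℂ) • lift α v₂), coeFn_smul_volume b (lift α v₂),
    coeFn_sub_volume (lift α q₁ - (a : ℂ) • lift α q₃)
      (coupling Q R (lift α q) (lift α q₁) (lift α r) (lift α r₁)),
    coeFn_sub_volume (lift α q₁) ((a : ℂ) • lift α q₃), coeFn_smul_volume a (lift α q₃),
    coupling_coe hQ hR (lift α q) (lift α q₁) (lift α r) (lift α r₁), lift_coe hs dv,
    lift_coe hs dv₂, lift_coe hs dq, lift_coe hs dq₁, lift_coe hs dq₃, lift_coe hs dr,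
    lift_coe hs dr₁] with x e1 e2 e3 e4 e5 e6 l1 l2 l3 l4 l5 l6 l7
  rw [e1, e2, e3, e4, e5, e6, l1, l2, l3, l4, l5, l6, l7]
  exact_mod_cast congrArg (fun r : ℝ => (r : ℂ)) (heq x)

end ExponentialDecay

end BenneyLuke

namespace BenneyLuke

/-! ### The solitary wave: profile equation, decay, dependence on the speed. -/

section SolitaryWave

variable {a b c α : ℝ}

/-- `tanh (α_c x / 2)`. -/
def tc (a b c : ℝ) (x : ℝ) : ℝ :=
  Real.sinh (alphaC a b c * x / 2) / Real.cosh (alphaC a b c * x / 2)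

/-- The first derivative of `q_c`. -/
def qc₁ (a b c : ℝ) (x : ℝ) : ℝ := -alphaC a b c * (tc a b c x * qc a b c x)

/-- The second derivative of `q_c`. -/
def qc₂ (a b c : ℝ) (x : ℝ) : ℝ :=
  (b * c ^ 2 - a)⁻¹ * ((c ^ 2 - 1) * qc a b c x - 3 * c / 2 * (qc a b c x * qc a b c x))

/-- The third derivative of `q_c`. -/
def qc₃ (a b c : ℝ) (x : ℝ) : ℝ :=
  (b * c ^ 2 - a)⁻¹ * ((c ^ 2 - 1) * qc₁ a b c x - 3 * c * (qc a b c x * qc₁ a b c x))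

/-- The fourth derivative of `q_c`. -/
def qc₄ (a b c : ℝ) (x : ℝ) : ℝ :=
  (b * c ^ 2 - a)⁻¹ * ((c ^ 2 - 1) * qc₂ a b c x -
    3 * c * (qc₁ a b c x * qc₁ a b c x + qc a b c x * qc₂ a b c x))

/-- In terms of `t = tanh (α_c x / 2)`, which solves `t' = (α_c / 2)(1 - t²)`, differentiation of
the profile becomes polynomial algebra. -/
lemma qc_eq_tc (a b c x : ℝ) : qc a b c x = (c ^ 2 - 1) / c * (1 - tc a b c x ^ 2) := by
  have h1 := Real.cosh_sq (alphaC a b c * x / 2)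
  have h2 := (Real.cosh_pos (alphaC a b c * x / 2)).ne'
  unfold qc tc
  congr 1
  field_simp
  linarith

lemma hasDerivAt_tc (a b c x : ℝ) :
    HasDerivAt (tc a b c) (alphaC a b c / 2 * (1 - tc a b c x ^ 2)) x := by
  have h2 := (Real.cosh_pos (alphaC a b c * x / 2)).ne'
  have h3 : HasDerivAt (fun x => alphaC a b c * x / 2) (alphaC a b c / 2) x := by
    simpa using ((hasDerivAt_id x).const_mul (alphaC a b c)).div_const 2
  refine (h3.sinh.div h3.cosh h2).congr_deriv ?_
  unfold tc
  field_simp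

lemma hasDerivAt_qc (a b c x : ℝ) : HasDerivAt (qc a b c) (qc₁ a b c x) x := by
  have h1 := ((((hasDerivAt_tc a b c x).pow 2).const_sub 1).const_mul ((c ^ 2 - 1) / c))
  rw [funext (qc_eq_tc a b c)]
  refine h1.congr_deriv ?_
  rw [qc₁, qc_eq_tc]
  push_cast
  ring

lemma contDiff_qc_infty (a b c : ℝ) : ContDiff ℝ ∞ (qc a b c) := by
  unfold qc
  refine contDiff_const.mul (ContDiff.pow (contDiff_const.div ?_ fun x => ?_) 2)
  · exact Real.contDiff_cosh.comp (by fun_prop)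
  · exact (Real.cosh_pos _).ne'

lemma abs_tc_le (a b c x : ℝ) : |tc a b c x| ≤ 1 := by
  have h1 := Real.cosh_sq (alphaC a b c * x / 2)
  have h2 := Real.cosh_pos (alphaC a b c * x / 2)
  rw [tc, abs_div, abs_of_pos h2, div_le_one h2]
  exact abs_le_of_sq_le_sq (by linarith) h2.le

lemma continuous_tc (a b c : ℝ) : Continuous (tc a b c) :=
  continuous_iff_continuousAt.2 fun x => (hasDerivAt_tc a b c x).continuousAt

variable (h : Admissible a b c α)
include h

lemma alphaC_sq : (b * c ^ 2 - a) * alphaC a b c ^ 2 = c ^ 2 - 1 := by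
  rw [alphaC, Real.sq_sqrt (div_nonneg h.sq_sub_one_pos.le h.γ_pos.le),
    mul_div_cancel₀ _ h.γ_pos.ne']

lemma lt_alphaC : α < alphaC a b c := by
  rw [alphaC]
  refine Real.lt_sqrt_of_sq_lt ?_
  rw [lt_div_iff₀ h.γ_pos]
  exact h.lt_alphaC

lemma alphaC_pos : 0 < alphaC a b c := h.α_pos.trans (lt_alphaC h)

lemma qc_pos (x : ℝ) : 0 < qc a b c x := by
  have := Real.cosh_pos (alphaC a b c * x / 2)
  have := h.sq_sub_one_pos
  have := h.c_pos
  unfold qc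
  positivity

/-- The first integral of the profile equation. -/
lemma γ_mul_qc₁_sq (x : ℝ) : (b * c ^ 2 - a) * qc₁ a b c x ^ 2 =
    (c ^ 2 - 1) * qc a b c x ^ 2 - c * qc a b c x ^ 3 := by
  have h1 := alphaC_sq h
  have h2 := h.c_pos.ne'
  have h3 : c * qc a b c x = (c ^ 2 - 1) * (1 - tc a b c x ^ 2) := by
    rw [qc_eq_tc]
    field_simp
  rw [qc₁]
  linear_combination (tc a b c x * qc a b c x) ^ 2 * h1 + qc a b c x ^ 2 * h3

/-- The profile equation. -/
lemma γ_mul_qc₂ (x : ℝ) : (b * c ^ 2 - a) * qc₂ a b c x =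
    (c ^ 2 - 1) * qc a b c x - 3 * c / 2 * qc a b c x ^ 2 := by
  rw [qc₂, mul_inv_cancel_left₀ h.γ_pos.ne']
  ring

/-- This is where the profile equation is verified: `qc₂` is defined by its right-hand side, so that
the third and fourth derivatives follow by differentiating a polynomial in `q_c` and `q_c'`. -/
lemma hasDerivAt_qc₁ (x : ℝ) : HasDerivAt (qc₁ a b c) (qc₂ a b c x) x := by
  have h1 := ((hasDerivAt_tc a b c x).mul (hasDerivAt_qc a b c x)).const_mul (-alphaC a b c)
  refine h1.congr_deriv ?_
  have h2 := alphaC_sq h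
  have h3 : c * qc a b c x = (c ^ 2 - 1) * (1 - tc a b c x ^ 2) := by
    have := h.c_pos.ne'
    rw [qc_eq_tc]
    field_simp
  refine mul_left_cancel₀ h.γ_pos.ne' ?_
  rw [γ_mul_qc₂ h, qc₁]
  linear_combination (tc a b c x ^ 2 - (1 - tc a b c x ^ 2) / 2) * qc a b c x * h2 +
    3 / 2 * qc a b c x * h3

omit h in
lemma hasDerivAt_qc₂ (x : ℝ) : HasDerivAt (qc₂ a b c) (qc₃ a b c x) x := by
  have h0 := hasDerivAt_qc a b c x
  refine (((h0.const_mul (c ^ 2 - 1)).sub ((h0.mul h0).const_mul (3 * c / 2))).const_mul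
    (b * c ^ 2 - a)⁻¹).congr_deriv ?_
  rw [qc₃]
  ring

lemma hasDerivAt_qc₃ (x : ℝ) : HasDerivAt (qc₃ a b c) (qc₄ a b c x) x := by
  have h0 := hasDerivAt_qc a b c x
  have h1 := hasDerivAt_qc₁ h x
  refine (((h1.const_mul (c ^ 2 - 1)).sub ((h0.mul h1).const_mul (3 * c))).const_mul
    (b * c ^ 2 - a)⁻¹).congr_deriv ?_
  rw [qc₄]

/-- From `2 cosh y ≥ e^{|y|}` with `y = α_c x / 2`; squaring gives the decay rate `α_c`. -/
lemma expDecay_qc : ExpDecay (alphaC a b c) (qc a b c) := by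
  refine ⟨(contDiff_qc_infty a b c).continuous, 4 * ((c ^ 2 - 1) / c), fun x => ?_⟩
  rw [abs_of_pos (qc_pos h x), qc]
  have hM : 0 < (c ^ 2 - 1) / c := div_pos h.sq_sub_one_pos h.c_pos
  have hω := alphaC_pos h
  set y := alphaC a b c * x / 2 with hy
  have h1 : Real.exp |y| ≤ 2 * Real.cosh y := by
    rw [Real.cosh_eq]
    rcases abs_cases y with ⟨e, -⟩ | ⟨e, -⟩ <;> rw [e] <;>
      linarith [Real.exp_pos y, Real.exp_pos (-y)]
  have h2 : Real.exp (-alphaC a b c * |x|) = (1 / Real.exp |y|) ^ 2 := by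
    rw [one_div, ← Real.exp_neg, ← Real.exp_nat_mul, hy, abs_div, abs_mul, abs_of_pos hω,
      abs_two]
    congr 1
    push_cast
    ring
  have h3 : (1 / Real.cosh y) ^ 2 ≤ (2 * (1 / Real.exp |y|)) ^ 2 := by
    have := Real.cosh_pos y
    have := Real.exp_pos |y|
    gcongr
    rw [mul_one_div, div_le_div_iff₀ (by positivity) (by positivity)]
    linarith
  rw [h2]
  calc _ ≤ (c ^ 2 - 1) / c * (2 * (1 / Real.exp |y|)) ^ 2 := by gcongr
    _ = _ := by ring

lemma expDecay_qc₁ : ExpDecay (alphaC a b c) (qc₁ a b c) :=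
  (ExpDecay.bdd_mul (continuous_tc a b c) (abs_tc_le a b c) (expDecay_qc h)).const_mul _

lemma expDecay_qc₂ : ExpDecay (alphaC a b c) (qc₂ a b c) := by
  have h0 := expDecay_qc h
  exact ((h0.const_mul _).sub ((ExpDecay.mul (alphaC_pos h).le h0 h0).const_mul _)).const_mul _

lemma expDecay_qc₃ : ExpDecay (alphaC a b c) (qc₃ a b c) := by
  have h0 := expDecay_qc h
  have h1 := expDecay_qc₁ h
  exact ((h1.const_mul _).sub ((ExpDecay.mul (alphaC_pos h).le h0 h1).const_mul _)).const_mul _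

lemma expDecay_qc₄ : ExpDecay (alphaC a b c) (qc₄ a b c) := by
  have h0 := expDecay_qc h
  have h1 := expDecay_qc₁ h
  have h2 := expDecay_qc₂ h
  have hp := (alphaC_pos h).le
  exact ((h2.const_mul _).sub (((ExpDecay.mul hp h1 h1).add
    (ExpDecay.mul hp h0 h2)).const_mul _)).const_mul _

omit h in
lemma deriv_qc : deriv (qc a b c) = qc₁ a b c := funext fun x => (hasDerivAt_qc a b c x).deriv

omit h in
lemma hasDerivAt_rc (x : ℝ) : HasDerivAt (rc a b c) (-c * qc₁ a b c x) x :=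
  (hasDerivAt_qc a b c x).const_mul (-c)

omit h in
lemma deriv_rc : deriv (rc a b c) = fun x => -c * qc₁ a b c x :=
  funext fun x => (hasDerivAt_rc x).deriv

lemma isProfile_qc : IsProfile (qc a b c) where
  smooth := contDiff_qc_infty a b c
  tendsto := (expDecay_qc h).tendsto_cocompact (alphaC_pos h)
  tendsto_deriv := by
    rw [deriv_qc]
    exact (expDecay_qc₁ h).tendsto_cocompact (alphaC_pos h)

lemma isProfile_rc : IsProfile (rc a b c) where
  smooth := contDiff_const.mul (contDiff_qc_infty a b c)
  tendsto := ((expDecay_qc h).const_mul (-c)).tendsto_cocompact (alphaC_pos h)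
  tendsto_deriv := by
    rw [deriv_rc]
    exact ((expDecay_qc₁ h).const_mul (-c)).tendsto_cocompact (alphaC_pos h)

/-! #### The derivative with respect to the speed -/

omit h in
/-- The logarithmic derivative of the amplitude with respect to the speed. -/
def amplRate (c : ℝ) : ℝ := (c ^ 2 + 1) / (c * (c ^ 2 - 1))

omit h in
/-- The logarithmic derivative of the width with respect to the speed. -/
def widthRate (a b c : ℝ) : ℝ := c / (c ^ 2 - 1) - b * c / (b * c ^ 2 - a)

omit h in
/-- The derivative of `q_c` with respect to `c`. -/
def vc (a b c : ℝ) (x : ℝ) : ℝ := amplRate c * qc a b c x + widthRate a b c * (x * qc₁ a b c x)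

omit h in
/-- The first derivative of `vc`. -/
def vc₁ (a b c : ℝ) (x : ℝ) : ℝ :=
  amplRate c * qc₁ a b c x + widthRate a b c * (qc₁ a b c x + x * qc₂ a b c x)

omit h in
/-- The second derivative of `vc`. -/
def vc₂ (a b c : ℝ) (x : ℝ) : ℝ :=
  amplRate c * qc₂ a b c x + widthRate a b c * (2 * qc₂ a b c x + x * qc₃ a b c x)

omit h in
/-- The third derivative of `vc`. -/
def vc₃ (a b c : ℝ) (x : ℝ) : ℝ :=
  amplRate c * qc₃ a b c x + widthRate a b c * (3 * qc₃ a b c x + x * qc₄ a b c x)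

lemma hasDerivAt_alphaC :
    HasDerivAt (fun s => alphaC a b s) (alphaC a b c * widthRate a b c) c := by
  have hγ := h.γ_pos
  have he := h.sq_sub_one_pos
  have h1 : HasDerivAt (fun s : ℝ => s ^ 2) (2 * c) c := by simpa using hasDerivAt_pow 2 c
  have h2 := (h1.sub_const 1).div ((h1.const_mul b).sub_const a) hγ.ne'
  have h3 := h2.sqrt (div_pos he hγ).ne'
  refine h3.congr_deriv ?_
  change _ / (2 * alphaC a b c) = _
  have hω := alphaC_pos h
  have h4 := alphaC_sq h
  rw [div_eq_iff (by positivity), widthRate]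
  have h5 : alphaC a b c ^ 2 = (c ^ 2 - 1) / (b * c ^ 2 - a) := by
    rw [eq_div_iff hγ.ne']
    linarith
  calc _ = 2 * ((c ^ 2 - 1) / (b * c ^ 2 - a)) *
        (c / (c ^ 2 - 1) - b * c / (b * c ^ 2 - a)) := by
        have := hγ.ne'
        have := he.ne'
        generalize hg : b * c ^ 2 - a = g at *
        generalize he : c ^ 2 - 1 = e at *
        field_simp
    _ = _ := by rw [← h5]; ring

/-- The profile is an amplitude times a fixed shape of `α_c x`. Hence its derivative in `c` is the
logarithmic rate of the amplitude times `q_c`, plus that of the width times `x q_c'`. -/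
lemma hasDerivAt_qc_speed (x : ℝ) : HasDerivAt (fun s => qc a b s x) (vc a b c x) c := by
  have hc := h.c_pos.ne'
  have he := h.sq_sub_one_pos.ne'
  have h1 : HasDerivAt (fun s : ℝ => s ^ 2) (2 * c) c := by simpa using hasDerivAt_pow 2 c
  have h2 := (h1.sub_const 1).div (hasDerivAt_id c) hc
  have h3 := (((hasDerivAt_alphaC h).mul_const x).div_const 2).cosh
  have hch := (Real.cosh_pos (alphaC a b c * x / 2)).ne'
  have h4 := h2.mul (((hasDerivAt_const c (1 : ℝ)).div h3 hch).pow 2)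
  refine h4.congr_deriv ?_
  rw [vc, qc₁, qc, tc, amplRate]
  simp only [id, Pi.div_apply, Pi.pow_apply]
  rw [show (2 - 1 : ℕ) = 1 from rfl, pow_one]
  generalize Real.cosh (alphaC a b c * x / 2) = C at hch ⊢
  generalize Real.sinh (alphaC a b c * x / 2) = S
  field_simp
  ring

lemma hasDerivAt_rc_speed (x : ℝ) :
    HasDerivAt (fun s => rc a b s x) (-(qc a b c x + c * vc a b c x)) c := by
  refine ((hasDerivAt_id c).neg.mul (hasDerivAt_qc_speed h x)).congr_deriv ?_
  change -1 * qc a b c x + -c * vc a b c x = _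
  ring

lemma hasDerivAt_vc (x : ℝ) : HasDerivAt (vc a b c) (vc₁ a b c x) x := by
  refine (((hasDerivAt_qc a b c x).const_mul _).add
    (((hasDerivAt_id x).mul (hasDerivAt_qc₁ h x)).const_mul _)).congr_deriv ?_
  simp only [vc₁, id]
  ring

lemma hasDerivAt_vc₁ (x : ℝ) : HasDerivAt (vc₁ a b c) (vc₂ a b c x) x := by
  refine (((hasDerivAt_qc₁ h x).const_mul _).add
    (((hasDerivAt_qc₁ h x).add ((hasDerivAt_id x).mul (hasDerivAt_qc₂ x))).const_mul
      _)).congr_deriv ?_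
  simp only [vc₂, id]
  ring

lemma hasDerivAt_vc₂ (x : ℝ) : HasDerivAt (vc₂ a b c) (vc₃ a b c x) x := by
  refine (((hasDerivAt_qc₂ x).const_mul _).add
    ((((hasDerivAt_qc₂ x).const_mul 2).add
      ((hasDerivAt_id x).mul (hasDerivAt_qc₃ h x))).const_mul _)).congr_deriv ?_
  simp only [vc₃, id]
  ring

omit h in
lemma expDecay_combination {s t u v k : ℝ} {f g : ℝ → ℝ} (hst : t < s) (hf : ExpDecay s f)
    (hg : ExpDecay s g) : ExpDecay t fun x => u * f x + v * (k * f x + x * g x) :=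
  ((hf.const_mul u).mono hst.le).add ((((hf.const_mul k).mono hst.le).add (hg.id_mul hst)).const_mul v)

variable {t : ℝ} (ht : t < alphaC a b c)
include ht

lemma expDecay_vc : ExpDecay t (vc a b c) :=
  (((expDecay_qc h).const_mul _).mono ht.le).add (((expDecay_qc₁ h).id_mul ht).const_mul _)

lemma expDecay_vc₁ : ExpDecay t (vc₁ a b c) := by
  have := expDecay_combination (u := amplRate c) (v := widthRate a b c) (k := 1) ht
    (expDecay_qc₁ h) (expDecay_qc₂ h)
  simp only [one_mul] at this
  exact this

lemma expDecay_vc₂ : ExpDecay t (vc₂ a b c) :=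
  expDecay_combination ht (expDecay_qc₂ h) (expDecay_qc₃ h)

lemma expDecay_vc₃ : ExpDecay t (vc₃ a b c) :=
  expDecay_combination ht (expDecay_qc₃ h) (expDecay_qc₄ h)

end SolitaryWave

end BenneyLuke

namespace BenneyLuke

/-! ### The Jordan chain at zero and the momentum derivative. -/

section Modes

variable {a b c α : ℝ}

lemma lift_add {α s : ℝ} (hs : |α| < s) {f g : ℝ → ℝ} (hf : ExpDecay s f) (hg : ExpDecay s g) :
    lift α (fun x => f x + g x) = lift α f + lift α g := by
  refine L2w_ext ?_
  filter_upwards [lift_coe hs (hf.add hg), lift_coe hs hf, lift_coe hs hg,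
    coeFn_add_volume (lift α f) (lift α g)] with x h1 h2 h3 h4
  rw [h1, h4, h2, h3, Complex.ofReal_add]

lemma lift_const_mul {α s : ℝ} (hs : |α| < s) (k : ℝ) {f : ℝ → ℝ} (hf : ExpDecay s f) :
    lift α (fun x => k * f x) = (k : ℂ) • lift α f := by
  refine L2w_ext ?_
  filter_upwards [lift_coe hs (hf.const_mul k), lift_coe hs hf,
    coeFn_smul_volume k (lift α f)] with x h1 h2 h3
  rw [h1, h3, h2, Complex.ofReal_mul]

/-- The translation mode `(∂ₓ q_c, ∂ₓ r_c)`. -/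
def mode₁ (a b c α : ℝ) : State α :=
  WithLp.toLp 2 (lift α (qc₁ a b c), lift α fun x => -c * qc₁ a b c x)

/-- The speed mode `-(∂_c q_c, ∂_c r_c)`. -/
def mode₂ (a b c α : ℝ) : State α :=
  WithLp.toLp 2 (lift α fun x => -1 * vc a b c x, lift α fun x => qc a b c x + c * vc a b c x)

variable (h : Admissible a b c α)
include h

/-- The speed mode contains `x q_c'` and does not decay at the full rate `α_c`; a slightly smaller
rate `t` still beats the weight. -/
lemma exists_between_alphaC : ∃ t, |α| < t ∧ t < alphaC a b c := by
  rw [abs_of_pos h.α_pos]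
  exact exists_between (lt_alphaC h)

lemma abs_lt_alphaC : |α| < alphaC a b c := by
  rw [abs_of_pos h.α_pos]
  exact lt_alphaC h

/-- With `r = -c q` the first row vanishes, and the second is the profile equation differentiated
twice. -/
lemma mode₁_mem : (mode₁ a b c α, 0) ∈ LcGraph a b c α := by
  have hs := abs_lt_alphaC h
  have key := linRel_lift (a := a) (b := b) (c := c) (α := α) (isProfile_qc h) (isProfile_rc h) hs
    (expDecay_qc₁ h) (expDecay_qc₂ h) (expDecay_qc₃ h) (expDecay_qc₄ h)
    ((expDecay_qc₁ h).const_mul (-c)) ((expDecay_qc₂ h).const_mul (-c))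
    ((expDecay_qc₂ h).const_mul (c ^ 2)) ((expDecay_qc₃ h).const_mul (c ^ 2))
    ((expDecay_qc₄ h).const_mul (c ^ 2)) (hasDerivAt_qc₁ h) hasDerivAt_qc₂ (hasDerivAt_qc₃ h)
    (fun x => (hasDerivAt_qc₁ h x).const_mul (-c)) (fun x => (hasDerivAt_qc₂ x).const_mul (c ^ 2))
    (fun x => (hasDerivAt_qc₃ h x).const_mul (c ^ 2)) (fun x => by
      have h4 : (b * c ^ 2 - a) * qc₄ a b c x = (c ^ 2 - 1) * qc₂ a b c x -
          3 * c * (qc₁ a b c x * qc₁ a b c x + qc a b c x * qc₂ a b c x) := by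
        rw [qc₄, mul_inv_cancel_left₀ h.γ_pos.ne']
      rw [deriv_qc, deriv_rc, rc]
      linear_combination -h4)
  rw [lift_const_mul hs _ (expDecay_qc₂ h), lift_const_mul hs _ (expDecay_qc₂ h)] at key
  have e : (0 : State α) = WithLp.toLp 2
      ((c : ℂ) • lift α (qc₂ a b c) + ((-c : ℝ) : ℂ) • lift α (qc₂ a b c),
        ((c ^ 2 : ℝ) : ℂ) • lift α (qc₂ a b c) +
          (c : ℂ) • ((-c : ℝ) : ℂ) • lift α (qc₂ a b c)) := by
    apply State.ext
    · change (0 : L2w α) = (c : ℂ) • lift α (qc₂ a b c) + ((-c : ℝ) : ℂ) • lift α (qc₂ a b c)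
      push_cast
      module
    · change (0 : L2w α) = ((c ^ 2 : ℝ) : ℂ) • lift α (qc₂ a b c) +
        (c : ℂ) • ((-c : ℝ) : ℂ) • lift α (qc₂ a b c)
      push_cast
      module
  rw [← e] at key
  exact key

-- The relations between the amplitude and width rates that remain when the equation for `∂_c q_c`
-- is reduced, by the profile equation, to the monomials `q_c'` and `q_c q_c'`.
omit α h in
lemma rates_identity {a b c : ℝ} (hc : c ≠ 0) (he : c ^ 2 - 1 ≠ 0) (hg : b * c ^ 2 - a ≠ 0) :
    2 * c * widthRate a b c - c * amplRate c + 2 * b * c ^ 2 * (b * c ^ 2 - a)⁻¹ = 1 ∧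
      widthRate a b c * (c ^ 2 - 1) + b * c * (c ^ 2 - 1) * (b * c ^ 2 - a)⁻¹ = c := by
  unfold widthRate amplRate
  generalize b * c ^ 2 - a = g at hg ⊢
  constructor <;> field_simp <;> ring

/-- Differentiating the travelling-wave equation in `c` gives `𝓛_c (∂_c z_c) = -∂ₓ z_c`. The check
is algebraic: the terms carrying a factor `x` cancel by the equation for the translation mode, the
others by `rates_identity`. -/
lemma mode₂_mem : (mode₂ a b c α, mode₁ a b c α) ∈ LcGraph a b c α := by
  obtain ⟨t, hs, ht⟩ := exists_between_alphaC h
  have d0 := (expDecay_qc h).mono ht.le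
  have d1 := (expDecay_qc₁ h).mono ht.le
  have d2 := (expDecay_qc₂ h).mono ht.le
  have d3 := (expDecay_qc₃ h).mono ht.le
  have v0 := expDecay_vc h ht
  have v1 := expDecay_vc₁ h ht
  have v2 := expDecay_vc₂ h ht
  have v3 := expDecay_vc₃ h ht
  have key := linRel_lift (a := a) (b := b) (c := c) (α := α) (isProfile_qc h) (isProfile_rc h) hs
    (v0.const_mul (-1)) (v1.const_mul (-1)) (v2.const_mul (-1)) (v3.const_mul (-1))
    (d0.add (v0.const_mul c)) (d1.add (v1.const_mul c))
    ((d1.const_mul (-2 * c)).add (v1.const_mul (-c ^ 2)))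
    ((d2.const_mul (-2 * c)).add (v2.const_mul (-c ^ 2)))
    ((d3.const_mul (-2 * c)).add (v3.const_mul (-c ^ 2)))
    (fun x => (hasDerivAt_vc h x).const_mul (-1)) (fun x => (hasDerivAt_vc₁ h x).const_mul (-1))
    (fun x => (hasDerivAt_vc₂ h x).const_mul (-1))
    (fun x => (hasDerivAt_qc a b c x).add ((hasDerivAt_vc h x).const_mul c))
    (fun x => ((hasDerivAt_qc₁ h x).const_mul (-2 * c)).add
      ((hasDerivAt_vc₁ h x).const_mul (-c ^ 2)))
    (fun x => ((hasDerivAt_qc₂ x).const_mul (-2 * c)).add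
      ((hasDerivAt_vc₂ h x).const_mul (-c ^ 2))) (fun x => by
      have hg := h.γ_pos.ne'
      have h3' : qc₃ a b c x = (b * c ^ 2 - a)⁻¹ * ((c ^ 2 - 1) * qc₁ a b c x -
        3 * c * (qc a b c x * qc₁ a b c x)) := rfl
      have h3 : (b * c ^ 2 - a) * qc₃ a b c x = (c ^ 2 - 1) * qc₁ a b c x -
          3 * c * (qc a b c x * qc₁ a b c x) := by
        rw [qc₃, mul_inv_cancel_left₀ hg]
      have h4 : (b * c ^ 2 - a) * qc₄ a b c x = (c ^ 2 - 1) * qc₂ a b c x -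
          3 * c * (qc₁ a b c x * qc₁ a b c x + qc a b c x * qc₂ a b c x) := by
        rw [qc₄, mul_inv_cancel_left₀ hg]
      obtain ⟨h5, h6⟩ := rates_identity h.c_pos.ne' h.sq_sub_one_pos.ne' hg
      rw [deriv_qc, deriv_rc, rc, vc, vc₁, vc₃]
      linear_combination (amplRate c + 3 * widthRate a b c) * h3 + widthRate a b c * x * h4 -
        3 * qc a b c x * qc₁ a b c x * h5 + 2 * qc₁ a b c x * h6 + 2 * b * c * h3')
  rw [lift_const_mul hs _ v1, lift_add hs d1 (v1.const_mul c), lift_const_mul hs _ v1,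
    lift_add hs (d1.const_mul (-2 * c)) (v1.const_mul (-c ^ 2)), lift_const_mul hs _ d1,
    lift_const_mul hs _ v1] at key
  have e : mode₁ a b c α = WithLp.toLp 2
      ((c : ℂ) • ((-1 : ℝ) : ℂ) • lift α (vc₁ a b c) +
        (lift α (qc₁ a b c) + (c : ℂ) • lift α (vc₁ a b c)),
      ((-2 * c : ℝ) : ℂ) • lift α (qc₁ a b c) + ((-c ^ 2 : ℝ) : ℂ) • lift α (vc₁ a b c) +
        (c : ℂ) • (lift α (qc₁ a b c) + (c : ℂ) • lift α (vc₁ a b c))) := by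
    apply State.ext
    · change lift α (qc₁ a b c) = (c : ℂ) • ((-1 : ℝ) : ℂ) • lift α (vc₁ a b c) +
        (lift α (qc₁ a b c) + (c : ℂ) • lift α (vc₁ a b c))
      push_cast
      module
    · change lift α (fun x => -c * qc₁ a b c x) = ((-2 * c : ℝ) : ℂ) • lift α (qc₁ a b c) +
        ((-c ^ 2 : ℝ) : ℂ) • lift α (vc₁ a b c) +
        (c : ℂ) • (lift α (qc₁ a b c) + (c : ℂ) • lift α (vc₁ a b c))
      rw [lift_const_mul hs _ d1]
      push_cast
      module
  rw [← e] at key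
  exact key

/-- The coefficient of `∫ q_c²` in the derivative of the momentum with respect to the speed. -/
def momentumCoeff (e g b c M K : ℝ) : ℝ :=
  1 + b * e / (5 * g) + 2 * M - K + b * e / (5 * g) * (2 * M + K) -
    6 / 5 * (e / c ^ 2) * (M - K / 3)

/-- With `i = 1 / (c² - 1)` one has `M = 1 + 2i` and `0 ≤ K ≤ i`, while `(c² - 1) / c²` lies in `[0,
1]`. Dropping the nonnegative terms leaves at least `1 + 2M - K - 6M / 5 > 0`. -/
lemma momentumCoeff_pos : 0 < momentumCoeff (c ^ 2 - 1) (b * c ^ 2 - a) b c (c * amplRate c)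
    (c * widthRate a b c) := by
  have he := h.sq_sub_one_pos
  have hg := h.γ_pos
  have hc := h.c_pos
  have hb := h.b_pos
  have hM : c * amplRate c = 1 + 2 / (c ^ 2 - 1) := by
    have := he.ne'
    unfold amplRate
    field_simp
    ring
  have hK : c * widthRate a b c = c ^ 2 * (b - a) / ((c ^ 2 - 1) * (b * c ^ 2 - a)) := by
    unfold widthRate
    generalize hgg : b * c ^ 2 - a = g at hg
    obtain rfl : a = b * c ^ 2 - g := by linarith
    have := he.ne'
    have := hg.ne'
    field_simp
    ring
  have hK0 : 0 ≤ c * widthRate a b c := by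
    have : 0 < b - a := sub_pos.2 h.a_lt
    rw [hK]
    positivity
  have hK1 : c * widthRate a b c ≤ 1 / (c ^ 2 - 1) := by
    rw [hK, div_le_div_iff₀ (by positivity) he]
    have : 0 ≤ a * (c ^ 2 - 1) * (c ^ 2 - 1) := by
      have := h.a_pos
      positivity
    linarith
  have hs0 : 0 ≤ (c ^ 2 - 1) / c ^ 2 := by positivity
  have hs1 : (c ^ 2 - 1) / c ^ 2 ≤ 1 := by
    rw [div_le_one (by positivity)]
    linarith
  have hp : 0 < b * (c ^ 2 - 1) / (5 * (b * c ^ 2 - a)) := by positivity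
  have hi : 0 < 1 / (c ^ 2 - 1) := by positivity
  have hM' : c * amplRate c = 1 + 2 * (1 / (c ^ 2 - 1)) := by rw [hM]; ring
  unfold momentumCoeff
  generalize c * widthRate a b c = K at *
  generalize c * amplRate c = M at *
  generalize (c ^ 2 - 1) / c ^ 2 = s at *
  generalize b * (c ^ 2 - 1) / (5 * (b * c ^ 2 - a)) = p at *
  have h1 : 0 ≤ p * (2 * M + K) := mul_nonneg hp.le (by linarith)
  have h2 : s * M ≤ M := mul_le_of_le_one_left (by linarith) hs1
  have h3 : 0 ≤ s * K := mul_nonneg hs0 hK0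
  linarith

/-- The derivative of the momentum with respect to the speed does not vanish. -/
lemma integral_momentum_pos : 0 < ∫ x, ((qc a b c x - b * qc₂ a b c x) *
    (qc a b c x + 2 * c * vc a b c x) - 3 / 2 * (qc a b c x * qc a b c x * vc a b c x)) := by
  have he := h.sq_sub_one_pos.ne'
  have hg := h.γ_pos.ne'
  have hc := h.c_pos.ne'
  obtain ⟨t, hst, ht⟩ := exists_between_alphaC h
  have ht0 : 0 < t := (abs_nonneg α).trans_lt hst
  have hω := alphaC_pos h
  have d0 := expDecay_qc h
  have d1 := expDecay_qc₁ h
  have d2 := expDecay_qc₂ h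
  have d00 := ExpDecay.mul hω.le d0 d0
  have v0 := expDecay_vc h ht
  have hN := momentumCoeff_pos h
  generalize hNe : momentumCoeff (c ^ 2 - 1) (b * c ^ 2 - a) b c (c * amplRate c)
    (c * widthRate a b c) = N at hN
  have dE : ExpDecay t fun x => (qc a b c x - b * qc₂ a b c x) *
      (qc a b c x + 2 * c * vc a b c x) - 3 / 2 * (qc a b c x * qc a b c x * vc a b c x) :=
    (ExpDecay.mul ht0.le ((d0.sub (d2.const_mul b)).mono ht.le)
      ((d0.mono ht.le).add (v0.const_mul (2 * c)))).sub
      ((ExpDecay.mul ht0.le (d00.mono ht.le) v0).const_mul _)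
  have hpos : 0 < ∫ x, N * (qc a b c x * qc a b c x) := by
    rw [integral_const_mul]
    refine mul_pos hN ?_
    refine integral_pos_of_integrable_nonneg_nonzero d00.1 (d00.integrable hω)
      (fun x => mul_self_nonneg _) (x := 0) (mul_pos (qc_pos h 0) (qc_pos h 0)).ne'
  -- The integrand is a combination of `q²`, `q³`, `x q q'` and `x q² q'`. The constants `k₁` and
  -- `k₂` remove the last two by the exact derivatives of `x q²` and `x q³`; `n` is the coefficient
  -- of `q³` that remains.
  obtain ⟨k₁, hk₁⟩ : ∃ k₁, k₁ = c * widthRate a b c *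
    (1 - b * (c ^ 2 - 1) / (b * c ^ 2 - a)) := ⟨_, rfl⟩
  obtain ⟨k₂, hk₂⟩ : ∃ k₂, k₂ = (2 * c * widthRate a b c * (3 * b * c / (2 * (b * c ^ 2 - a))) -
    3 / 2 * widthRate a b c) / 3 := ⟨_, rfl⟩
  obtain ⟨n, hn⟩ : ∃ n, n = 3 * b * c / (2 * (b * c ^ 2 - a)) * (1 + 2 * c * amplRate c) -
    3 / 2 * amplRate c - k₂ := ⟨_, rfl⟩
  -- The derivative of `(2 (b c² - a) / (5c)) q q'` is `4 (c² - 1) / (5c) q² - q³`, by the profile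
  -- equation and its first integral, so `∫ q³` is a multiple of `∫ q²`. Up to a total derivative
  -- the integrand is therefore `N q²`.
  have hzero := integral_deriv_eq_zero (s := t) ht0
    (f := fun x => (k₁ * (x * (qc a b c x * qc a b c x)) +
      k₂ * (x * (qc a b c x * (qc a b c x * qc a b c x)))) -
        n * (2 * (b * c ^ 2 - a) / (5 * c)) * (qc a b c x * qc₁ a b c x))
    (f' := fun x => ((qc a b c x - b * qc₂ a b c x) *
      (qc a b c x + 2 * c * vc a b c x) - 3 / 2 * (qc a b c x * qc a b c x * vc a b c x)) -
        N * (qc a b c x * qc a b c x)) (fun x => ?_)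
    (((d00.id_mul ht).const_mul k₁).add (((ExpDecay.mul hω.le d0 d00).id_mul ht).const_mul k₂) |>.sub
      (((ExpDecay.mul hω.le d0 d1).mono ht.le).const_mul _))
    (dE.sub ((d00.mono ht.le).const_mul N))
  · rw [integral_sub (dE.integrable ht0) ((d00.const_mul N).integrable hω), sub_eq_zero] at hzero
    rw [hzero]
    exact hpos
  · have a0 := hasDerivAt_qc a b c x
    have a1 := hasDerivAt_qc₁ h x
    have e0 := a0.mul a0
    have := ((((hasDerivAt_id x).mul e0).const_mul k₁).add
      (((hasDerivAt_id x).mul (a0.mul e0)).const_mul k₂)).sub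
      ((a0.mul a1).const_mul (n * (2 * (b * c ^ 2 - a) / (5 * c))))
    refine this.congr_deriv ?_
    have f1 := γ_mul_qc₁_sq h x
    have f2 := γ_mul_qc₂ h x
    have f3 : b * qc₂ a b c x = b * (c ^ 2 - 1) / (b * c ^ 2 - a) * qc a b c x -
        3 * b * c / (2 * (b * c ^ 2 - a)) * qc a b c x ^ 2 := by
      field_simp
      linear_combination 2 * b * f2
    have f4 : 2 * (b * c ^ 2 - a) / (5 * c) * (qc₁ a b c x ^ 2 + qc a b c x * qc₂ a b c x) =
        4 * (c ^ 2 - 1) / (5 * c) * qc a b c x ^ 2 - qc a b c x ^ 3 := by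
      rw [div_mul_eq_mul_div, div_eq_iff (by positivity), mul_assoc, mul_add]
      field_simp
      linear_combination 2 * f1 + 2 * qc a b c x * f2
    have hNe' : (1 - b * (c ^ 2 - 1) / (b * c ^ 2 - a)) * (1 + 2 * c * amplRate c) - k₁ +
        n * (4 * (c ^ 2 - 1) / (5 * c)) = N := by
      rw [hn, ← hNe, hk₁, hk₂, momentumCoeff]
      generalize amplRate c = μ
      generalize widthRate a b c = κ
      generalize b * c ^ 2 - a = g at hg
      field_simp
      ring
    simp only [id, Pi.mul_apply]
    rw [vc] at *
    linear_combination -n * f4 + (qc a b c x + 2 * c * (amplRate c * qc a b c x +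
      widthRate a b c * (x * qc₁ a b c x))) * f3 - qc a b c x ^ 2 * hNe' + qc a b c x ^ 3 * hn +
      2 * x * qc a b c x * qc₁ a b c x * hk₁ + 3 * x * qc a b c x ^ 2 * qc₁ a b c x * hk₂

end Modes

end BenneyLuke

namespace BenneyLuke

/-! ### The solvability condition that ends the Jordan chain. -/

section Kernel

variable {a b c α : ℝ}

/-- Integration by parts against an exponentially decaying function. -/
lemma integral_smul_add_eq_zero {s : ℝ} (hs : |α| < s) {f g : L2w α} (hfg : HasWeakDeriv f g)
    {ψ ψ₁ ψ₂ : ℝ → ℝ} (hsm : ContDiff ℝ ∞ ψ) (h1 : ∀ x, HasDerivAt ψ (ψ₁ x) x)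
    (h2 : ∀ x, HasDerivAt ψ₁ (ψ₂ x) x) (d0 : ExpDecay s ψ) (d1 : ExpDecay s ψ₁)
    (d2 : ExpDecay s ψ₂) : (∫ x, ψ x • g x) + ∫ x, ψ₁ x • f x = 0 := by
  have e (ψ : ℝ → ℝ) : ∫ x, ψ x • (0 : L2w α) x = 0 := pair_zero ψ
  have := integral_eq_zero_of_expDecay hs (F₀ := g) (F₁ := f) (F₂ := 0) (fun φ hφ => by
    rw [hfg.2.2 φ hφ, e]
    ring) hsm h1 h2 d0 d1 d2
  rwa [e, add_zero] at this

/-- The second component of the equation `w = 𝓛 z`, as a second-order relation. -/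
lemma exists_weakDeriv_of_mem_LcGraph (h : Admissible a b c α) {z w : State α}
    (hzw : (z, w) ∈ LcGraph a b c α) :
    ∃ dq dr F₀ F₂ : L2w α, HasWeakDeriv z.fst dq ∧ HasWeakDeriv z.snd dr ∧
      w.fst = (c : ℂ) • dq + dr ∧
      F₀ =ᵐ[volume] (fun x => w.snd x - c * dr x - dq x +
        (-c * qc a b c x * dq x + 2 * (-c * qc₁ a b c x * z.fst x) + 2 * (qc a b c x * dr x) +
          qc₁ a b c x * z.snd x)) ∧
      F₂ =ᵐ[volume] (fun x => a * dq x - b * (w.snd x - c * dr x)) ∧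
      ∀ φ, IsTest φ → (∫ x, φ x • F₀ x) + (∫ x, deriv φ x • (0 : L2w α) x) +
        (∫ x, deriv (deriv φ) x • F₂ x) = 0 := by
  obtain ⟨dq, dr, h1, h2, h3, h4⟩ := (linRel_iff_pair (isProfile_qc h) (isProfile_rc h) z w).1 hzw
  refine ⟨dq, dr, w.snd - (c : ℂ) • dr - dq + coupling (qc a b c) (rc a b c) z.fst dq z.snd dr,
    (a : ℂ) • dq - (b : ℂ) • (w.snd - (c : ℂ) • dr), h1, h2, h3, ?_, ?_, fun φ hφ => ?_⟩
  · generalize w.snd = W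
    filter_upwards [coeFn_add_volume (W - (c : ℂ) • dr - dq)
        (coupling (qc a b c) (rc a b c) z.fst dq z.snd dr),
      coeFn_sub_volume (W - (c : ℂ) • dr) dq, coeFn_sub_volume W ((c : ℂ) • dr),
      coeFn_smul_volume (c : ℂ) dr,
      coupling_coe (isProfile_qc h) (isProfile_rc h) z.fst dq z.snd dr] with x n1 n2 n3 n4 n5
    rw [n1, n2, n3, n4, n5, deriv_qc, deriv_rc, rc]
    push_cast
    ring
  · generalize w.snd = W
    filter_upwards [coeFn_sub_volume W ((c : ℂ) • dr), coeFn_smul_volume (c : ℂ) dr,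
      coeFn_smul_volume (a : ℂ) dq, coeFn_smul_volume (b : ℂ) (W - (c : ℂ) • dr),
      coeFn_sub_volume ((a : ℂ) • dq) ((b : ℂ) • (W - (c : ℂ) • dr))] with x n1 n2 n3 n4 n5
    rw [n5, n3, n4, n1, n2]
  · have h5 := h4 φ hφ
    rw [pair_elliptic b hφ, pair_elliptic a hφ] at h5
    change pair φ _ + pair (deriv φ) 0 + pair (deriv (deriv φ)) _ = 0
    rw [pair_zero, pair_add hφ.continuous hφ.2, pair_sub hφ, pair_sub hφ.deriv.deriv, pair_smul,
      pair_smul]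
    linear_combination h5

lemma integral_combination {A B C D E F : ℝ → ℂ} (iA : Integrable A) (iB : Integrable B)
    (iC : Integrable C) (iD : Integrable D) (iE : Integrable E) (iF : Integrable F) (k l : ℂ) :
    ∫ x, ((A x + B x) + k * (C x + D x) + l * (E x + F x)) =
      ((∫ x, A x) + ∫ x, B x) + k * ((∫ x, C x) + ∫ x, D x) + l * ((∫ x, E x) + ∫ x, F x) := by
  have i1 : Integrable fun x => A x + B x := iA.add iB
  have i2 : Integrable fun x => k * (C x + D x) := (iC.add iD).const_mul k
  have i3 : Integrable fun x => l * (E x + F x) := (iE.add iF).const_mul l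
  rw [integral_add (f := fun x => (A x + B x) + k * (C x + D x)) (i1.add i2) i3,
    integral_add i1 i2, integral_const_mul, integral_const_mul, integral_add iA iB,
    integral_add iC iD, integral_add iE iF]

variable (h : Admissible a b c α)
include h

/-- The Jordan chain of `𝓛_c` at `0` cannot be extended beyond `mode₂`. -/
lemma eq_zero_of_mem_smul_mode₂ {z : State α} {β : ℂ}
    (hz : (z, β • mode₂ a b c α) ∈ LcGraph a b c α) : β = 0 := by
  obtain ⟨dq, dr, F₀, F₂, hq, hr, hfst, hF₀, hF₂, htest⟩ := exists_weakDeriv_of_mem_LcGraph h hz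
  obtain ⟨t, hs, ht⟩ := exists_between_alphaC h
  have ht0 : 0 < t := (abs_nonneg α).trans_lt hs
  have hω := (alphaC_pos h).le
  have d0 := expDecay_qc h
  have d1 := expDecay_qc₁ h
  have d2 := expDecay_qc₂ h
  have v0 := expDecay_vc h ht
  have d00 := (ExpDecay.mul hω d0 d0).mono ht.le
  have d01 := ((ExpDecay.mul hω d0 d1).const_mul 2).mono ht.le
  have d02 := (((ExpDecay.mul hω d1 d1).add (ExpDecay.mul hω d0 d2)).const_mul 2).mono ht.le
  have e0 (x : ℝ) : HasDerivAt (fun x => qc a b c x * qc a b c x)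
      (2 * (qc a b c x * qc₁ a b c x)) x := by
    refine ((hasDerivAt_qc a b c x).mul (hasDerivAt_qc a b c x)).congr_deriv ?_
    ring
  have e1 (x : ℝ) : HasDerivAt (fun x => 2 * (qc a b c x * qc₁ a b c x))
      (2 * (qc₁ a b c x * qc₁ a b c x + qc a b c x * qc₂ a b c x)) x :=
    ((hasDerivAt_qc a b c x).mul (hasDerivAt_qc₁ h x)).const_mul 2
  have hsm := contDiff_qc_infty a b c
  have t1 := integral_smul_add_eq_zero hs hq (hsm.mul hsm) e0 e1 d00 d01 d02
  have t2 := integral_smul_add_eq_zero hs hr (hsm.mul hsm) e0 e1 d00 d01 d02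
  have t3 := integral_eq_zero_of_expDecay hs htest hsm (hasDerivAt_qc a b c) (hasDerivAt_qc₁ h)
    (d0.mono ht.le) (d1.mono ht.le) (d2.mono ht.le)
  rw [show (∫ x, qc₁ a b c x • (0 : L2w α) x) = 0 from pair_zero _, add_zero] at t3
  -- The second row tested with `q_c`, plus `c` times and minus one half of the identities obtained
  -- by integrating `q_c²` by parts against the two components of `z`. These weights are chosen to
  -- cancel all terms in `z` without derivatives.
  have key := integral_combination ((d0.mono ht.le).integrable_smul hs F₀)
    ((d2.mono ht.le).integrable_smul hs F₂) (d00.integrable_smul hs dq)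
    (d01.integrable_smul hs z.fst) (d00.integrable_smul hs dr) (d01.integrable_smul hs z.snd)
    (c : ℂ) (-1 / 2)
  rw [t1, t2] at key
  rw [t3] at key
  have hpos := integral_momentum_pos h
  -- After `dr` is eliminated by the first row, the coefficient of `dq` is `(c² - 1) q_c - (3c / 2)
  -- q_c² - (b c² - a) q_c''`, which is zero by the profile equation. Only the momentum derivative
  -- times `β` remains.
  have hE : ∫ x : ℝ, (((qc a b c x - b * qc₂ a b c x) * (qc a b c x + 2 * c * vc a b c x) -
      3 / 2 * (qc a b c x * qc a b c x * vc a b c x) : ℝ) : ℂ) * β = 0 := by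
    rw [mul_zero, mul_zero, add_zero, add_zero] at key
    refine (integral_congr_ae ?_).trans key
    have hdr : dr = (β • mode₂ a b c α).fst - (c : ℂ) • dq := by rw [hfst]; abel
    have m1 : (β • mode₂ a b c α).fst =ᵐ[volume] fun x => β * ((-1 * vc a b c x : ℝ) : ℂ) := by
      filter_upwards [coeFn_smul_volume β (lift α fun x => -1 * vc a b c x),
        lift_coe hs (v0.const_mul (-1))] with x h1 h2
      rw [← h2, ← h1]
      rfl
    have m2 : (β • mode₂ a b c α).snd =ᵐ[volume]
        fun x => β * ((qc a b c x + c * vc a b c x : ℝ) : ℂ) := by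
      filter_upwards [coeFn_smul_volume β (lift α fun x => qc a b c x + c * vc a b c x),
        lift_coe hs ((d0.mono ht.le).add (v0.const_mul c))] with x h1 h2
      rw [← h2, ← h1]
      rfl
    have m3 : dr =ᵐ[volume] fun x => β * ((-1 * vc a b c x : ℝ) : ℂ) - c * dq x := by
      rw [hdr]
      filter_upwards [coeFn_sub_volume (β • mode₂ a b c α).fst ((c : ℂ) • dq), m1,
        coeFn_smul_volume (c : ℂ) dq] with x h1 h2 h3
      rw [h1, h2, h3]
    filter_upwards [m2, m3, hF₀, hF₂] with x n2 n3 n4 n5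
    simp only [Complex.real_smul]
    rw [n4, n5, n2, n3]
    have f2 := congrArg (fun x : ℝ => (x : ℂ)) (γ_mul_qc₂ h x)
    push_cast at f2 ⊢
    linear_combination dq x * f2
  rw [integral_mul_const, integral_complex_ofReal, mul_eq_zero] at hE
  exact hE.resolve_left (Complex.ofReal_ne_zero.2 hpos.ne')

end Kernel

end BenneyLuke

namespace BenneyLuke

/-! ### One-dimensionality of the kernel, by a Wronskian argument. -/

section GeneralizedKernel

variable {a b c α : ℝ} (h : Admissible a b c α)

lemma contDiff_qc₁ (a b c : ℝ) : ContDiff ℝ ∞ (qc₁ a b c) := by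
  rw [← deriv_qc]
  exact (contDiff_infty_iff_deriv.1 (contDiff_qc_infty a b c)).2

lemma contDiff_qc₂ (a b c : ℝ) : ContDiff ℝ ∞ (qc₂ a b c) :=
  contDiff_const.mul ((contDiff_const.mul (contDiff_qc_infty a b c)).sub
    (contDiff_const.mul ((contDiff_qc_infty a b c).mul (contDiff_qc_infty a b c))))

/-- Two solutions of `y'' = m y` with vanishing Wronskian are proportional. -/
lemma exists_eq_const_mul_of_wronskian {p p₁ m : ℝ → ℝ} (s0 : ContDiff ℝ ∞ p)
    (s1 : ContDiff ℝ ∞ p₁) (h0 : ∀ x, HasDerivAt p (p₁ x) x)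
    (h1 : ∀ x, HasDerivAt p₁ (m x * p x) x) (hS : ∀ x, 0 < p x ^ 2 + p₁ x ^ 2) {q dq : ℝ → ℂ}
    (hq : HasWeakDeriv q dq) (hdq : HasWeakDeriv dq fun x => (m x : ℂ) * q x)
    (hW : (fun x => (p x : ℂ) * dq x - (p₁ x : ℂ) * q x) =ᵐ[volume] fun _ => 0) :
    ∃ C : ℂ, q =ᵐ[volume] fun x => C * (p x : ℂ) := by
  have sS : ContDiff ℝ ∞ fun x => p x ^ 2 + p₁ x ^ 2 := (s0.pow 2).add (s1.pow 2)
  have hS0 (x : ℝ) : (p x : ℂ) ^ 2 + (p₁ x : ℂ) ^ 2 ≠ 0 := by exact_mod_cast (hS x).ne'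
  have dS (x : ℝ) : HasDerivAt (fun x => p x ^ 2 + p₁ x ^ 2)
      (2 * p x * p₁ x + 2 * p₁ x * (m x * p x)) x := by
    refine (((h0 x).pow 2).add ((h1 x).pow 2)).congr_deriv ?_
    push_cast
    ring
  -- The candidate constant is `(p q + p₁ q') / (p² + p₁²)` rather than `q / p`, since `p` may
  -- vanish. Its derivative is a multiple of the Wronskian, and where the Wronskian is zero its
  -- product with `p` is `q`.
  obtain ⟨u, hu⟩ : ∃ u : ℝ → ℝ, u = fun x => p x / (p x ^ 2 + p₁ x ^ 2) := ⟨_, rfl⟩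
  obtain ⟨v, hv⟩ : ∃ v : ℝ → ℝ, v = fun x => p₁ x / (p x ^ 2 + p₁ x ^ 2) := ⟨_, rfl⟩
  have su : ContDiff ℝ ∞ u := by
    rw [hu]
    exact s0.div sS fun x => (hS x).ne'
  have sv : ContDiff ℝ ∞ v := by
    rw [hv]
    exact s1.div sS fun x => (hS x).ne'
  have du (x : ℝ) : deriv u x = (p₁ x * (p x ^ 2 + p₁ x ^ 2) -
      p x * (2 * p x * p₁ x + 2 * p₁ x * (m x * p x))) / (p x ^ 2 + p₁ x ^ 2) ^ 2 := by
    rw [hu]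
    exact ((h0 x).div (dS x) (hS x).ne').deriv
  have dv (x : ℝ) : deriv v x = (m x * p x * (p x ^ 2 + p₁ x ^ 2) -
      p₁ x * (2 * p x * p₁ x + 2 * p₁ x * (m x * p x))) / (p x ^ 2 + p₁ x ^ 2) ^ 2 := by
    rw [hv]
    exact ((h1 x).div (dS x) (hS x).ne').deriv
  obtain ⟨C, hC⟩ := (hasWeakDeriv_congr (ae_eq_refl _) (g' := fun _ => 0) (by
    filter_upwards [hW] with x hx
    have hSx := hS0 x
    rw [du, dv, hu, hv]
    simp only [Complex.real_smul]
    push_cast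
    generalize (p x : ℂ) = P at *
    generalize (p₁ x : ℂ) = P₁ at *
    generalize (m x : ℂ) = M at *
    generalize q x = y at *
    generalize dq x = y₁ at *
    have e : P / (P ^ 2 + P₁ ^ 2) * y₁ + (P₁ * (P ^ 2 + P₁ ^ 2) -
        P * (2 * P * P₁ + 2 * P₁ * (M * P))) / (P ^ 2 + P₁ ^ 2) ^ 2 * y +
        (P₁ / (P ^ 2 + P₁ ^ 2) * (M * y) + (M * P * (P ^ 2 + P₁ ^ 2) -
        P₁ * (2 * P * P₁ + 2 * P₁ * (M * P))) / (P ^ 2 + P₁ ^ 2) ^ 2 * y₁) =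
        (1 + M) * (P ^ 2 - P₁ ^ 2) * (P * y₁ - P₁ * y) / (P ^ 2 + P₁ ^ 2) ^ 2 := by
      field_simp
      ring
    rw [e, hx]
    simp) ((hq.smooth_smul su).add (hdq.smooth_smul sv))).ae_eq_const
  refine ⟨C, ?_⟩
  filter_upwards [hC, hW] with x n1 n2
  have hSx := hS0 x
  rw [hu, hv] at n1
  rw [← n1]
  simp only [Complex.real_smul]
  push_cast
  field_simp
  linear_combination -(p₁ x : ℂ) * n2

include h

/-- If both vanish, the first integral gives `(c² - 1) q² = c q³` and the profile equation gives
`(c² - 1) q² = (3c / 2) q³`, which contradicts `q > 0`. -/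
lemma qc₁_sq_add_qc₂_sq_pos (x : ℝ) : 0 < qc₁ a b c x ^ 2 + qc₂ a b c x ^ 2 := by
  by_contra hn
  have h1 : qc₁ a b c x = 0 := by nlinarith [sq_nonneg (qc₁ a b c x), sq_nonneg (qc₂ a b c x)]
  have h2 : qc₂ a b c x = 0 := by nlinarith [sq_nonneg (qc₁ a b c x), sq_nonneg (qc₂ a b c x)]
  have f1 := γ_mul_qc₁_sq h x
  have f2 := γ_mul_qc₂ h x
  rw [h1] at f1
  rw [h2] at f2
  have hq := qc_pos h x
  have hc := h.c_pos
  have : 0 < c * qc a b c x ^ 3 := by positivity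
  have : c * qc a b c x ^ 3 = 0 := by linear_combination -2 * f1 + 2 * qc a b c x * f2
  linarith

/-- Solutions in `L²_α` of the second-order equation satisfied by `∂ₓ q_c` are multiples of it. -/
lemma exists_eq_smul_qc₁ {q dq : L2w α} (hq : HasWeakDeriv q dq)
    (hdq : HasWeakDeriv dq fun x => (((b * c ^ 2 - a)⁻¹ *
      ((c ^ 2 - 1) - 3 * c * qc a b c x) : ℝ) : ℂ) * q x) :
    ∃ k : ℂ, q = k • lift α (qc₁ a b c) := by
  obtain ⟨m, hm⟩ : ∃ m : ℝ → ℝ, m = fun x => (b * c ^ 2 - a)⁻¹ *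
    ((c ^ 2 - 1) - 3 * c * qc a b c x) := ⟨_, rfl⟩
  have hdq : HasWeakDeriv dq fun x => (m x : ℂ) * q x := by rw [hm]; exact hdq
  have h3 (x : ℝ) : qc₃ a b c x = m x * qc₁ a b c x := by rw [hm, qc₃]; ring
  have hω := alphaC_pos h
  have s1 := contDiff_qc₁ a b c
  have s2 := contDiff_qc₂ a b c
  have D1 : deriv (qc₁ a b c) = qc₂ a b c := funext fun x => (hasDerivAt_qc₁ h x).deriv
  have D2 : deriv (qc₂ a b c) = qc₃ a b c := funext fun x => (hasDerivAt_qc₂ x).deriv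
  have b1 := isBddMeas_of_tendsto s1.continuous ((expDecay_qc₁ h).tendsto_cocompact hω)
  have b2 := isBddMeas_of_tendsto s2.continuous ((expDecay_qc₂ h).tendsto_cocompact hω)
  -- The Wronskian has zero derivative, hence is constant; it lies in `L²_α` because `∂ₓ q_c` and
  -- its derivative are bounded, and the only constant there is zero.
  have hW : (fun x => (qc₁ a b c x : ℂ) * dq x - (qc₂ a b c x : ℂ) * q x) =ᵐ[volume]
      fun _ => 0 := by
    have hW0 := (hdq.smooth_smul s1).sub (hq.smooth_smul s2)
    have hW1 : HasWeakDeriv (rmul α (qc₁ a b c) dq - rmul α (qc₂ a b c) q : L2w α)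
        fun _ => 0 := by
      refine hasWeakDeriv_congr ?_ (Eventually.of_forall fun x => ?_) hW0
      · filter_upwards [coeFn_sub_volume (rmul α (qc₁ a b c) dq) (rmul α (qc₂ a b c) q),
          rmul_coe b1 dq, rmul_coe b2 q] with x n1 n2 n3
        rw [n1, n2, n3, Complex.real_smul, Complex.real_smul]
      · simp only [D1, D2, h3, Complex.real_smul, Complex.ofReal_mul]
        ring
    obtain ⟨C, hC⟩ := hW1.ae_eq_const
    have hz := eq_zero_of_ae_eq_const h.α_pos.le hC
    rw [hz] at hC
    filter_upwards [coeFn_sub_volume (rmul α (qc₁ a b c) dq) (rmul α (qc₂ a b c) q),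
      rmul_coe b1 dq, rmul_coe b2 q, coeFn_zero_volume α] with x n1 n2 n3 n4
    rw [hz] at n1
    rw [← n2, ← n3, ← n1, n4]
  obtain ⟨C, hC⟩ := exists_eq_const_mul_of_wronskian s1 s2 (hasDerivAt_qc₁ h)
    (fun x => h3 x ▸ hasDerivAt_qc₂ x) (qc₁_sq_add_qc₂_sq_pos h) hq hdq hW
  refine ⟨C, L2w_ext ?_⟩
  filter_upwards [hC, coeFn_smul_volume C (lift α (qc₁ a b c)),
    lift_coe (abs_lt_alphaC h) (expDecay_qc₁ h)] with x n1 n3 n4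
  rw [n1, n3, n4]

/-- The kernel of `𝓛_c` is spanned by the translation mode. -/
lemma exists_eq_smul_mode₁ {z : State α} (hz : (z, 0) ∈ LcGraph a b c α) :
    ∃ k : ℂ, z = k • mode₁ a b c α := by
  obtain ⟨dq, dr, F₀, F₂, hq, hr, hfst, hF₀, hF₂, htest⟩ := exists_weakDeriv_of_mem_LcGraph h hz
  have hdr : dr = -(c : ℂ) • dq := by
    have hfst : (0 : L2w α) = (c : ℂ) • dq + dr := hfst
    rw [neg_smul, eq_neg_iff_add_eq_zero, add_comm, ← hfst]
  -- The first row says that `c q + r` has zero derivative, so it is a constant in `L²_α`, hence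
  -- zero.
  have hr0 : z.snd = -(c : ℂ) • z.fst := by
    have h1 : HasWeakDeriv ((c : ℂ) • z.fst + z.snd : L2w α) fun _ => 0 := by
      refine hasWeakDeriv_congr ?_ ?_ ((hq.const_mul c).add hr)
      · filter_upwards [coeFn_add_volume ((c : ℂ) • z.fst) z.snd,
          coeFn_smul_volume (c : ℂ) z.fst] with x n1 n2
        rw [n1, n2]
      · rw [hdr]
        filter_upwards [coeFn_smul_volume (-(c : ℂ)) dq] with x n1
        rw [n1]
        ring
    obtain ⟨C, hC⟩ := h1.ae_eq_const
    have := eq_zero_of_ae_eq_const h.α_pos.le hC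
    rw [neg_smul, eq_neg_iff_add_eq_zero, add_comm, this]
  have m1 : dr =ᵐ[volume] fun x => -(c : ℂ) * dq x := by
    rw [hdr]
    exact coeFn_smul_volume _ _
  have m2 : z.snd =ᵐ[volume] fun x => -(c : ℂ) * z.fst x := by
    rw [hr0]
    exact coeFn_smul_volume _ _
  have m3 : (0 : State α).snd =ᵐ[volume] fun _ => 0 := coeFn_zero_volume α
  obtain ⟨m, hm⟩ : ∃ m : ℝ → ℝ, m = fun x => (b * c ^ 2 - a)⁻¹ *
    ((c ^ 2 - 1) - 3 * c * qc a b c x) := ⟨_, rfl⟩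
  have hγ : (b : ℂ) * c ^ 2 - a ≠ 0 := by exact_mod_cast h.γ_pos.ne'
  have hms : ContDiff ℝ ∞ m := by
    rw [hm]
    exact contDiff_const.mul (contDiff_const.sub (contDiff_const.mul (contDiff_qc_infty a b c)))
  have hmd (x : ℝ) : deriv m x = (b * c ^ 2 - a)⁻¹ * (-(3 * c * qc₁ a b c x)) := by
    rw [hm]
    exact ((((hasDerivAt_qc a b c x).const_mul (3 * c)).const_sub (c ^ 2 - 1)).const_mul _).deriv
  obtain ⟨G, hG⟩ : ∃ G : L2w α, G =ᵐ[volume] fun x => (m x : ℂ) * z.fst x := by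
    refine ⟨(((b * c ^ 2 - a)⁻¹ * (c ^ 2 - 1) : ℝ) : ℂ) • z.fst -
      (((b * c ^ 2 - a)⁻¹ * (3 * c) : ℝ) : ℂ) • rmul α (qc a b c) z.fst, ?_⟩
    filter_upwards [coeFn_sub_volume ((((b * c ^ 2 - a)⁻¹ * (c ^ 2 - 1) : ℝ) : ℂ) • z.fst)
      ((((b * c ^ 2 - a)⁻¹ * (3 * c) : ℝ) : ℂ) • rmul α (qc a b c) z.fst),
      coeFn_smul_volume (((b * c ^ 2 - a)⁻¹ * (c ^ 2 - 1) : ℝ) : ℂ) z.fst,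
      coeFn_smul_volume (((b * c ^ 2 - a)⁻¹ * (3 * c) : ℝ) : ℂ) (rmul α (qc a b c) z.fst),
      rmul_coe (isProfile_qc h).isBddMeas z.fst] with x n1 n2 n3 n4
    rw [n1, n2, n3, n4, hm]
    push_cast
    ring
  have hGd := hasWeakDeriv_congr (Eventually.of_forall fun x => Complex.real_smul) (ae_eq_refl _)
    (hq.smooth_smul hms)
  have hGd' := hasWeakDeriv_congr hG.symm (ae_eq_refl _) hGd
  -- With `r = -c q` the second row is `(b c² - a)` times `(m q)' = (dq)''` in the sense of
  -- distributions. Integrating once gives `(dq)' = m q + C`, and the constant is zero in `L²_α`.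
  obtain ⟨C, hC⟩ := exists_hasWeakDeriv_add_const (F := dq) (G := G) (locInt dq) (locInt G)
    fun φ hφ => by
      have h1 := htest φ hφ
      rw [show (∫ x, deriv φ x • (0 : L2w α) x) = 0 from pair_zero _, add_zero] at h1
      rw [hGd'.2.2 φ hφ]
      have e1 : ∫ x, φ x • F₀ x = ((b * c ^ 2 - a : ℝ) : ℂ) *
          ∫ x, φ x • (m x • dq x + deriv m x • z.fst x) := by
        rw [← integral_const_mul]
        refine integral_congr_ae ?_
        filter_upwards [hF₀, m1, m2, m3] with x n1 n2 n3 n4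
        rw [n1, n4, n2, n3, hmd, hm]
        simp only [Complex.real_smul]
        push_cast
        generalize (b : ℂ) * (c : ℂ) ^ 2 - a = g at hγ ⊢
        field_simp
        ring
      have e2 : ∫ x, deriv (deriv φ) x • F₂ x = -((b * c ^ 2 - a : ℝ) : ℂ) *
          ∫ x, deriv (deriv φ) x • dq x := by
        rw [← integral_const_mul]
        refine integral_congr_ae ?_
        filter_upwards [hF₂, m1, m3] with x n1 n2 n4
        rw [n1, n4, n2]
        simp only [Complex.real_smul]
        push_cast
        ring
      rw [e1, e2] at h1
      have hγ' : ((b * c ^ 2 - a : ℝ) : ℂ) ≠ 0 := by exact_mod_cast h.γ_pos.ne'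
      refine mul_left_cancel₀ hγ' ?_
      linear_combination -h1
  obtain rfl := const_eq_zero_of_hasWeakDeriv h.α_pos.le hC
  have hC' := hasWeakDeriv_congr (ae_eq_refl _) (g' := fun x => (m x : ℂ) * z.fst x) (by
    filter_upwards [hG] with x n1
    rw [n1, add_zero]) hC
  rw [hm] at hC'
  obtain ⟨k, hk⟩ := exists_eq_smul_qc₁ h hq hC'
  refine ⟨k, State.ext hk ?_⟩
  change z.snd = k • lift α fun x => -c * qc₁ a b c x
  rw [hr0, hk, lift_const_mul (abs_lt_alphaC h) _ (expDecay_qc₁ h)]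
  push_cast
  module

end GeneralizedKernel

end BenneyLuke

namespace BenneyLuke

/-! ### The generalized eigenspace at zero. -/

section Multiplicity

variable {a b c α : ℝ} (h : Admissible a b c α)
include h

/-- If it were zero, the continuous function `q_c'` would vanish identically, and so would its
derivative; but the two have no common zero. -/
lemma mode₁_ne_zero : mode₁ a b c α ≠ 0 := by
  intro h0
  have h1 : lift α (qc₁ a b c) = 0 := congrArg WithLp.fst h0
  have h2 : (fun x => (qc₁ a b c x : ℂ)) =ᵐ[volume] fun _ => 0 := by
    refine (lift_coe (abs_lt_alphaC h) (expDecay_qc₁ h)).symm.trans ?_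
    rw [h1]
    exact coeFn_zero_volume α
  have h3 := (Continuous.ae_eq_iff_eq volume
    (Complex.continuous_ofReal.comp (contDiff_qc₁ a b c).continuous) continuous_const).1 h2
  have h4 : qc₁ a b c = fun _ => 0 := funext fun x => Complex.ofReal_eq_zero.1 (congrFun h3 x)
  have h5 : qc₂ a b c 0 = 0 := by
    rw [← (hasDerivAt_qc₁ h 0).deriv, h4, deriv_const]
  have := qc₁_sq_add_qc₂_sq_pos h 0
  rw [h5, h4] at this
  simp at this

/-- If `𝓛_c z = k z₁ + l z₂`, then `𝓛_c (z - k z₂) = l z₂`. The solvability condition forces `l =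
0`, and `z - k z₂` is in the kernel, hence a multiple of `z₁`. -/
lemma mem_span_modes_of_mem_LcGraph {z w : State α} (hz : (z, w) ∈ LcGraph a b c α)
    (hw : w ∈ Submodule.span ℂ {mode₁ a b c α, mode₂ a b c α}) :
    z ∈ Submodule.span ℂ {mode₁ a b c α, mode₂ a b c α} := by
  obtain ⟨k, l, rfl⟩ := Submodule.mem_span_pair.1 hw
  have h1 := Submodule.sub_mem _ hz (Submodule.smul_mem _ k (mode₂_mem h))
  rw [Prod.smul_mk, Prod.mk_sub_mk, add_sub_cancel_left] at h1
  obtain rfl := eq_zero_of_mem_smul_mode₂ h h1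
  rw [zero_smul] at h1
  obtain ⟨m, hm⟩ := exists_eq_smul_mode₁ h h1
  exact Submodule.mem_span_pair.2 ⟨m, k, by rw [← hm, sub_add_cancel]⟩

lemma mem_kerPow_succ_of_mem_LcGraph {z w : State α} (hz : (z, w) ∈ LcGraph a b c α) {n : ℕ}
    (hw : w ∈ kerPow (Lc a b c α) 0 n) : z ∈ kerPow (Lc a b c α) 0 (n + 1) := by
  rw [← Lc_graph_eq h (isProfile_qc h) (isProfile_rc h), LinearPMap.mem_graph_iff] at hz
  obtain ⟨y, hy, hyw⟩ := hz
  dsimp only at hy hyw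
  subst hy
  refine mem_kerPow_succ.2 ⟨y.2, ?_⟩
  rw [shifted_apply, zero_smul, zero_sub, hyw]
  exact Submodule.neg_mem _ hw

theorem genEigenspace_Lc_zero : genEigenspace (Lc a b c α) 0 =
    Submodule.span ℂ {mode₁ a b c α, mode₂ a b c α} := by
  refine le_antisymm (iSup_le fun n => ?_) ?_
  · induction n with
    | zero => exact bot_le
    | succ n ih =>
      intro z hz
      obtain ⟨hd, hz⟩ := mem_kerPow_succ.1 hz
      refine mem_span_modes_of_mem_LcGraph h (w := Lc a b c α ⟨z, hd⟩) ?_ ?_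
      · rw [← Lc_graph_eq h (isProfile_qc h) (isProfile_rc h)]
        exact (Lc a b c α).mem_graph ⟨z, hd⟩
      · have := ih hz
        rwa [shifted_apply, zero_smul, zero_sub, Submodule.neg_mem_iff] at this
  · have h1 : mode₁ a b c α ∈ kerPow (Lc a b c α) 0 1 :=
      mem_kerPow_succ_of_mem_LcGraph h (mode₁_mem h) (Submodule.zero_mem _)
    have h2 := mem_kerPow_succ_of_mem_LcGraph h (mode₂_mem h) h1
    rw [Submodule.span_le, Set.pair_subset_iff]
    exact ⟨Submodule.mem_iSup_of_mem 1 h1, Submodule.mem_iSup_of_mem 2 h2⟩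

/-- Independence: applying `𝓛_c` to a relation `s z₁ + t z₂ = 0` gives `t z₁ = 0`, so `t = 0`, and
then `s = 0`. -/
theorem finrank_genEigenspace_Lc_zero :
    Module.finrank ℂ (genEigenspace (Lc a b c α) 0) = 2 := by
  have hli : LinearIndependent ℂ ![mode₁ a b c α, mode₂ a b c α] := by
    rw [LinearIndependent.pair_iff]
    intro s t hst
    have h1 := Submodule.add_mem _ (Submodule.smul_mem _ s (mode₁_mem h))
      (Submodule.smul_mem _ t (mode₂_mem h))
    rw [Prod.smul_mk, Prod.smul_mk, Prod.mk_add_mk, hst, smul_zero, zero_add,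
      ← Lc_graph_eq h (isProfile_qc h) (isProfile_rc h)] at h1
    have h2 := LinearPMap.graph_fst_eq_zero_snd _ h1 rfl
    have ht := (smul_eq_zero.1 h2).resolve_right (mode₁_ne_zero h)
    subst ht
    rw [zero_smul, add_zero] at hst
    exact ⟨(smul_eq_zero.1 hst).resolve_right (mode₁_ne_zero h), rfl⟩
  have := finrank_span_eq_card hli
  rwa [Matrix.range_cons_cons_empty, ← genEigenspace_Lc_zero h, Fintype.card_fin] at this

end Multiplicity

lemma admissible_of_lt_alphaC {a b c α : ℝ} (ha : 0 < a) (hab : a < b) (hc : 1 < c) (hα : 0 < α)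
    (hαc : α < alphaC a b c) : Admissible a b c α where
  a_pos := ha
  a_lt := hab
  one_lt := hc
  α_pos := hα
  lt_alphaC := by
    have hγ : 0 < b * c ^ 2 - a := by
      have h1 : 1 < c ^ 2 := one_lt_pow₀ hc two_ne_zero
      nlinarith [ha.trans hab]
    rwa [alphaC, Real.lt_sqrt hα.le, lt_div_iff₀ hγ] at hαc

end BenneyLuke

end

/-! ### Assembly of the assertions. -/

theorem lemma2p1 (a b c α : ℝ) (ha : 0 < a) (hab : a < b) (hc : 1 < c)
    (hα : 0 < α) (hαc : α < BenneyLuke.alphaC a b c) :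
    -- the operators are well defined, with domain `H¹_α`
    ((BenneyLuke.Lc a b c α).graph = BenneyLuke.LcGraph a b c α ∧
      (BenneyLuke.L0 a b c α).graph = BenneyLuke.L0Graph a b c α ∧
      (∀ z : BenneyLuke.State α, z ∈ (BenneyLuke.Lc a b c α).domain ↔
        BenneyLuke.MemH1w α z.fst ∧ BenneyLuke.MemH1w α z.snd) ∧
      (∀ z : BenneyLuke.State α, z ∈ (BenneyLuke.L0 a b c α).domain ↔
        BenneyLuke.MemH1w α z.fst ∧ BenneyLuke.MemH1w α z.snd)) ∧
    -- compact perturbation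
    (∃ K : BenneyLuke.State α →L[ℂ] BenneyLuke.State α, IsCompactOperator K ∧
      BenneyLuke.Lc a b c α =
        (K : BenneyLuke.State α →ₗ[ℂ] BenneyLuke.State α) +ᵥ BenneyLuke.L0 a b c α) ∧
    -- generation of a semigroup
    (∃ S : ℝ → BenneyLuke.State α →L[ℂ] BenneyLuke.State α,
      BenneyLuke.IsC0Semigroup S ∧ BenneyLuke.IsGenerator (BenneyLuke.Lc a b c α) S) ∧
    -- the essential spectrum is strictly in the left half-plane
    (∃ δ > 0, ∀ lam ∈ BenneyLuke.essSpectrum (BenneyLuke.Lc a b c α), lam.re ≤ -δ) ∧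
    -- zero is an eigenvalue of algebraic multiplicity two
    (∃ z₁ z₂ : BenneyLuke.State α,
      (z₁.fst =ᵐ[MeasureTheory.volume]
        fun x => ((deriv (BenneyLuke.qc a b c) x : ℝ) : ℂ)) ∧
      (z₁.snd =ᵐ[MeasureTheory.volume]
        fun x => ((deriv (BenneyLuke.rc a b c) x : ℝ) : ℂ)) ∧
      (z₂.fst =ᵐ[MeasureTheory.volume]
        fun x => ((-deriv (fun s => BenneyLuke.qc a b s x) c : ℝ) : ℂ)) ∧
      (z₂.snd =ᵐ[MeasureTheory.volume]
        fun x => ((-deriv (fun s => BenneyLuke.rc a b s x) c : ℝ) : ℂ)) ∧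
      z₁ ≠ 0 ∧
      (z₁, 0) ∈ (BenneyLuke.Lc a b c α).graph ∧
      (z₂, z₁) ∈ (BenneyLuke.Lc a b c α).graph ∧
      BenneyLuke.genEigenspace (BenneyLuke.Lc a b c α) 0 = Submodule.span ℂ {z₁, z₂} ∧
      Module.finrank ℂ (BenneyLuke.genEigenspace (BenneyLuke.Lc a b c α) 0) = 2) := by
  open BenneyLuke in
  have h := admissible_of_lt_alphaC ha hab hc hα hαc
  have hQ := isProfile_qc h
  have hR := isProfile_rc h
  have hs := abs_lt_alphaC h
  obtain ⟨t, hst, ht⟩ := exists_between_alphaC h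
  refine ⟨⟨Lc_graph_eq h hQ hR, L0_graph_eq h, mem_Lc_domain_iff h hQ hR, mem_L0_domain_iff h⟩,
    ⟨perturbation b α (qc a b c) (rc a b c),
      isCompactOperator_perturbation h.α_pos h.b_pos h.b_mul_sq_lt hQ hR, Lc_eq h hQ hR⟩,
    exists_semigroup_Lc h hQ hR,
    ⟨gap a b c α, gap_pos h, fun lam hl => re_le_of_mem_essSpectrum h hQ hR hl⟩,
    mode₁ a b c α, mode₂ a b c α, ?_, ?_, ?_, ?_, mode₁_ne_zero h, ?_, ?_,
    genEigenspace_Lc_zero h, finrank_genEigenspace_Lc_zero h⟩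
  · rw [deriv_qc]
    exact lift_coe hs (expDecay_qc₁ h)
  · rw [deriv_rc]
    exact lift_coe hs ((expDecay_qc₁ h).const_mul (-c))
  · refine (lift_coe hst ((expDecay_vc h ht).const_mul (-1))).trans (.of_forall fun x => ?_)
    simp only [(hasDerivAt_qc_speed h x).deriv, neg_one_mul]
  · refine (lift_coe hst (((expDecay_qc h).mono ht.le).add
      ((expDecay_vc h ht).const_mul c))).trans (.of_forall fun x => ?_)
    simp only [(hasDerivAt_rc_speed h x).deriv, neg_neg]
  · rw [Lc_graph_eq h hQ hR]
    exact mode₁_mem h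
  · rw [Lc_graph_eq h hQ hR]
    exact mode₂_mem h
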